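/- **Conventions.** A Pauli operator on $N$ qubits means $\pm A_1\otimes\cdots\otimes A_N$ with $A_i\in\{I,X,Y,Z\}$; measuring it gives an outcome $\pm1$ and the projected post-measurement state. $P$ is *dependent* on $Q_1,\dots,Q_K$ if $P=\pm Q_1^{a_1}\cdots Q_K^{a_K}$ with $a_i\in\{0,1\}$; a list is *independent* if no member is dependent on the others. A *stabiliser state* of $n$ qubits is $\sigma=2^{-(n-s)}\prod_{i=1}^s\frac{I+S_i}{2}$, where $S_1,\dots,S_s$ are independent generators of a commuting group of Pauli operators not containing $-I$. An *adaptive Clifford circuit* is a sequence of steps, each a gate $H$, $S$ or $CX$ (or no operation) or a non-destructive $Z$ measurement of one line; each step is determined by the description of the circuit, by random coins drawn in advance, by its position and by the previous measurement outcomes. It is *non-adaptive* if no step depends on the values of previous outcomes. Its output is the string of all its measurement outcomes. In a uniform family $\{C_w\}$, indexed by descriptions $w\in\{0,1\}^*$, the numbers of qubits, of steps and of coins (in unary), the generators of the input stabiliser state, and the step function are computable in classical polynomial time. A *PBC circuit* on $t$ qubits is a sequence of measurements of Pauli operators on $t$ qubits, where each next measurement (or the decision to stop) is determined by the previous outcomes,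 such that in every branch the measured operators commute pairwise and are independent; it is *non-adaptive* if these choices do not depend on the values of previous outcomes. In a uniform family of randomly chosen PBC circuits $\{\tilde C_{w,r}\}$, $r$ is a string of fair coins of polynomial-time computable length and the next measurement is computed in polynomial time from $w$, $r$ and the previous outcomes. $\{C_w\}$ on inputs $\sigma_w\otimes\rho$ is *weakly simulated* by $\{\tilde C_{w,r}\}$ on inputs $\rho$ if there is a polynomial-time function $f$ such that, for all $w$ and all states $\rho$, drawing uniform $r$, running $\tilde C_{w,r}$ on $\rho$ to obtain outcomes $m$, and returning $f(w,r,m)$ gives exactly the output distribution of $C_w$ on $\sigma_w\otimes\rho$. **Theorem.** Let $\{C_w\}$ be a uniform family of adaptive Clifford circuits, $C_w$ acting on $n+t$ qubits (where $n=n_w$, $t=t_w$) with input $\sigma_w\otimes\rho$, where $\sigma_w$ is a stabiliser state of $n$ qubits and $\rho$ is an arbitrary (mixed) state of $t$ qubits. (i) $\{C_w\}$ is weakly simulated by a uniform family of randomly chosen (generally adaptive) PBC circuits on $t$ qubits with input $\rho$, each making at most $t$ measurements. The family does not depend on $\rho$. (ii) If all $C_w$ are non-adaptive, then the PBC circuits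 can be chosen non-adaptive (for each value of the coins). (iii) Suppose that some $Z$ measurements of the $C_w$ are postselected to outcome $+1$, as specified by the step function. Then $\{C_w\}$ is weakly simulated, in each of the following two senses, by a uniform family (one for each sense, not depending on $\rho$) of randomly chosen PBC circuits on $t$ qubits with input $\rho$, each with at most $t$ measurements, in which some measurements are postselected to outcome $+1$. (a) For arbitrary $C_w$, where a postselected measurement, in the original and in the PBC circuit, is the operation that projects the current state onto outcome $+1$ and renormalises it. The output distributions agree for all $w$ and $\rho$ such that, for every value of the coins, with probability one no postselected measurement of $C_w$ is reached at which the outcome $+1$ has probability zero. (b) For non-adaptive $C_w$, where the output distribution of a postselected circuit (for fixed coins) is the one conditional on the event that all its postselected measurements have outcome $+1$. The PBC circuits can then be chosen non-adaptive, and the output distributions agree for all $w$ and $\rho$ such that this event has non-zero probability for $C_w$ on $\sigma_w\otimes\rho$, for every value of the coins. -/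

import Mathlib

open scoped Matrix ComplexOrder

noncomputable section

namespace CliffordPBC

/-! ## Classical computation with a step count

Programs act on finite binary trees. Every elementary operation is charged the size of the tree
it reads or copies, so a run of cost `c` handles only trees of size at most `c` plus the input
size and takes polynomial time in `c` on a Turing machine; conversely the language has pairing,
projections, case distinction and unbounded iteration and simulates Turing machines with
polynomial overhead. -/

/-- Data: binary trees. -/
inductive Val where
  | nil : Val
  | pair : Val → Val → Val

/-- Number of nodes and leaves. -/
def Val.size : Val → ℕ
  | .nil => 1
  | .pair a b => a.size + b.size + 1

/-- Programs, each denoting a partial function from trees to trees. -/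
inductive Prog where
  | id : Prog
  | nil : Prog
  | fst : Prog
  | snd : Prog
  | pair : Prog → Prog → Prog
  | seq : Prog → Prog → Prog
  | cond : Prog → Prog → Prog → Prog
  | loop : Prog → Prog → Prog

/-- `Runs p x y c`: on input `x` the program `p` halts with output `y`, at cost `c`.
`seq p q` runs `p`, then `q`; `cond b p q` runs `q` if `b` returns `nil` and `p` otherwise;
`loop b p` iterates `p` while `b` returns a value other than `nil`. -/
inductive Runs : Prog → Val → Val → ℕ → Prop where
  | id (x : Val) : Runs .id x x x.size
  | nil (x : Val) : Runs .nil x .nil x.size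
  | fst_nil : Runs .fst .nil .nil 1
  | fst_pair (a b : Val) : Runs .fst (.pair a b) a (Val.pair a b).size
  | snd_nil : Runs .snd .nil .nil 1
  | snd_pair (a b : Val) : Runs .snd (.pair a b) b (Val.pair a b).size
  | pair {p q : Prog} {x a b : Val} {c d : ℕ} (hp : Runs p x a c) (hq : Runs q x b d) :
      Runs (.pair p q) x (.pair a b) (c + d + x.size)
  | seq {p q : Prog} {x y z : Val} {c d : ℕ} (hp : Runs p x y c) (hq : Runs q y z d) :
      Runs (.seq p q) x z (c + d + 1)
  | cond_false {b p q : Prog} {x y : Val} {c d : ℕ}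
      (hb : Runs b x .nil c) (hq : Runs q x y d) :
      Runs (.cond b p q) x y (c + d + x.size)
  | cond_true {b p q : Prog} {x y u v : Val} {c d : ℕ}
      (hb : Runs b x (.pair u v) c) (hp : Runs p x y d) :
      Runs (.cond b p q) x y (c + d + x.size)
  | loop_stop {b p : Prog} {x : Val} {c : ℕ} (hb : Runs b x .nil c) :
      Runs (.loop b p) x x (c + x.size)
  | loop_step {b p : Prog} {x y z u v : Val} {c d e : ℕ}
      (hb : Runs b x (.pair u v) c) (hp : Runs p x y d) (hl : Runs (.loop b p) y z e) :
      Runs (.loop b p) x z (c + d + e + x.size)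

/-- The map `inp a ↦ out a` is computed by one program in time polynomial in the size of the
input `inp a`. -/
def PolyTime {α : Type} (inp out : α → Val) : Prop :=
  ∃ (p : Prog) (q : Polynomial ℕ), ∀ a : α, ∃ c : ℕ,
    Runs p (inp a) (out a) c ∧ c ≤ q.eval (inp a).size

/-! ### Encodings as trees -/

def encBool : Bool → Val
  | false => .nil
  | true => .pair .nil .nil

/-- Unary numerals. -/
def encNat : ℕ → Val
  | 0 => .nil
  | k + 1 => .pair .nil (encNat k)

def encList {α : Type} (e : α → Val) : List α → Val
  | [] => .nil
  | a :: l => .pair (e a) (encList e l)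

def encBits (l : List Bool) : Val := encList encBool l

def encCoins {m : ℕ} (r : Fin m → Bool) : Val := encBits (List.ofFn r)

/-! ## Qubits, Pauli operators and Clifford gates -/

/-- Operators on `N` qubits; the computational basis is indexed by bit assignments. -/
abbrev Op (N : ℕ) := Matrix (Fin N → Bool) (Fin N → Bool) ℂ

/-- The tensor product of one-qubit operators. -/
def tensorOp {N : ℕ} (A : Fin N → Matrix Bool Bool ℂ) : Op N :=
  Matrix.of fun x y => ∏ j, A j (x j) (y j)

/-- The one-qubit operator `A` on line `i`, the identity elsewhere. -/
def onLine {N : ℕ} (i : Fin N) (A : Matrix Bool Bool ℂ) : Op N :=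
  tensorOp (Function.update (fun _ => 1) i A)

/-- The tensor product of a state of the first `n` qubits and a state of the last `t` qubits. -/
def tensorState {n t : ℕ} (σ : Op n) (ρ : Op t) : Op (n + t) :=
  Matrix.of fun x y =>
    σ (fun i => x (Fin.castAdd t i)) (fun i => y (Fin.castAdd t i)) *
      ρ (fun j => x (Fin.natAdd n j)) (fun j => y (Fin.natAdd n j))

/-- Density matrices. -/
def IsState {N : ℕ} (ρ : Op N) : Prop := ρ.PosSemidef ∧ ρ.trace = 1

inductive Letter where
  | I | X | Y | Z

def Letter.mat : Letter → Matrix Bool Bool ℂ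
  | .I => 1
  | .X => Matrix.of fun x y => if x = y then 0 else 1
  | .Y => Matrix.of fun x y => if x = y then 0 else if x then Complex.I else -Complex.I
  | .Z => Matrix.of fun x y => if x = y then (if x then -1 else 1) else 0

def encLetter : Letter → Val
  | .I => encNat 0
  | .X => encNat 1
  | .Y => encNat 2
  | .Z => encNat 3

/-- The Hermitian elements `± A₁ ⊗ ⋯ ⊗ A_N` of the Pauli group, i.e. those that can be measured
with outcomes `±1`. -/
structure Pauli (N : ℕ) where
  neg : Bool
  letter : Fin N → Letter

def Pauli.op {N : ℕ} (P : Pauli N) : Op N :=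
  (if P.neg then -1 else 1 : ℂ) • tensorOp fun j => (P.letter j).mat

def encPauli {N : ℕ} (P : Pauli N) : Val :=
  .pair (encBool P.neg) (encList encLetter (List.ofFn P.letter))

/-- `P = ± Q₁^{a₁} ⋯ Q_K^{a_K}` for some exponents `a_i ∈ {0,1}`. -/
def DependentOn {N : ℕ} (P : Pauli N) (Q : List (Pauli N)) : Prop :=
  ∃ Q' : List (Pauli N), Q'.Sublist Q ∧
    (P.op = (Q'.map Pauli.op).prod ∨ P.op = -(Q'.map Pauli.op).prod)

/-- No member of the list depends on the others. -/
def Independent {N : ℕ} (Q : List (Pauli N)) : Prop :=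
  ∀ i : Fin Q.length, ¬ DependentOn (Q.get i) (Q.eraseIdx i)

def PairwiseCommuting {N : ℕ} (Q : List (Pauli N)) : Prop :=
  Q.Pairwise fun P P' => Commute P.op P'.op

/-- Independent generators of a stabiliser group: a commuting group of Pauli operators that does
not contain `-1`. -/
def IsStabiliserGenerators {N : ℕ} (S : List (Pauli N)) : Prop :=
  PairwiseCommuting S ∧ Independent S ∧
    (-1 : Op N) ∉ Submonoid.closure {A : Op N | ∃ P ∈ S, A = P.op}

/-- The stabiliser state `2^{-(N-s)} ∏ (1 + S_i)/2` with generators `S₁, …, S_s`; it is pure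
exactly if `s = N`. -/
def stabiliserState {N : ℕ} (S : List (Pauli N)) : Op N :=
  ((2 : ℂ) ^ S.length / 2 ^ N) • (S.map fun P => (1 / 2 : ℂ) • (1 + P.op)).prod

def hadamard : Matrix Bool Bool ℂ :=
  Matrix.of fun x y => (1 / (Real.sqrt 2 : ℂ)) * (if x && y then -1 else 1)

def phaseGate : Matrix Bool Bool ℂ :=
  Matrix.of fun x y => if x = y then (if x then Complex.I else 1) else 0

/-- Controlled NOT with control `c` and target `d`. -/
def cnot {N : ℕ} (c d : Fin N) : Op N :=
  Matrix.of fun x y => if x = Function.update y d (xor (y d) (y c)) then 1 else 0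

/-! ## Processes of unitary gates and measurements

The outcome `+1` is recorded as `false` and the outcome `-1` as `true`. -/

inductive Action (N : ℕ) where
  /-- apply a unitary -/
  | gate (U : Op N)
  /-- measure the observable `M` (with `M² = 1`) non-destructively; if `post` is true, the
  measurement is postselected to outcome `+1` -/
  | measure (M : Op N) (post : Bool)
  | halt

/-- The unnormalised state after outcome `b` of a measurement of `M`. -/
def collapse {N : ℕ} (M : Op N) (b : Bool) (A : Op N) : Op N :=
  let E : Op N := (1 / 2 : ℂ) • (1 + (if b then -1 else 1 : ℂ) • M)
  E * A * E

/-- (Sub)distributions on strings of measurement outcomes. -/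
abbrev Dist := List Bool →₀ ℝ

def mass (D : Dist) : ℝ := D.sum fun _ p => p

/-- `run act f k o A` runs `act` for at most `f` more steps, from step number `k`, recorded
outcomes `o` and unnormalised state `A`. It returns the joint Born weights of the strings of
recorded outcomes in which every postselected measurement has outcome `+1`. -/
def run {N : ℕ} (act : ℕ → List Bool → Action N) : ℕ → ℕ → List Bool → Op N → Dist
  | 0, _, o, A => Finsupp.single o A.trace.re
  | f + 1, k, o, A =>
    match act k o with
    | .halt => Finsupp.single o A.trace.re
    | .gate U => run act f (k + 1) o (U * A * Uᴴ)
    | .measure M post =>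
      run act f (k + 1) (o ++ [false]) (collapse M false A) +
        if post then 0 else run act f (k + 1) (o ++ [true]) (collapse M true A)

/-- The same, but with postselection as an operation on the current state: a postselected
measurement projects the state onto outcome `+1` and renormalises it. A branch in which this has
probability zero is lost, so that the total mass is then less than that of `A`. -/
def runStepwise {N : ℕ} (act : ℕ → List Bool → Action N) : ℕ → ℕ → List Bool → Op N → Dist
  | 0, _, o, A => Finsupp.single o A.trace.re
  | f + 1, k, o, A =>
    match act k o with
    | .halt => Finsupp.single o A.trace.re
    | .gate U => runStepwise act f (k + 1) o (U * A * Uᴴ)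
    | .measure M post =>
      if post then
        runStepwise act f (k + 1) (o ++ [false])
          ((A.trace / (collapse M false A).trace) • collapse M false A)
      else
        runStepwise act f (k + 1) (o ++ [false]) (collapse M false A) +
          runStepwise act f (k + 1) (o ++ [true]) (collapse M true A)

/-- The distribution obtained by drawing `m` fair coins `r` and then sampling from `D r`. -/
def coinAverage {m : ℕ} (D : (Fin m → Bool) → Dist) : Dist :=
  ((2 : ℝ) ^ m)⁻¹ • ∑ r, D r

/-! ## Adaptive Clifford circuits -/

/-- One step of a circuit on `N` lines. -/
inductive Step (N : ℕ) where
  | skip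
  | H (i : Fin N)
  | S (i : Fin N)
  | CX (c d : Fin N) (h : c ≠ d)
  /-- a `Z` measurement of line `i`, postselected to outcome `+1` if `post` is true -/
  | measure (i : Fin N) (post : Bool)

def Step.action {N : ℕ} : Step N → Action N
  | .skip => .gate 1
  | .H i => .gate (onLine i hadamard)
  | .S i => .gate (onLine i phaseGate)
  | .CX c d _ => .gate (cnot c d)
  | .measure i post => .measure (onLine i Letter.Z.mat) post

def encStep {N : ℕ} : Step N → Val
  | .skip => .pair (encNat 0) .nil
  | .H i => .pair (encNat 1) (encNat i)
  | .S i => .pair (encNat 2) (encNat i)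
  | .CX c d _ => .pair (encNat 3) (.pair (encNat c) (encNat d))
  | .measure i post => .pair (encNat 4) (.pair (encNat i) (encBool post))

/-- A uniform family of adaptive Clifford circuits `C_w`, indexed by descriptions `w`. The circuit
`C_w` acts on `n w + t w` qubits, the first `n w` of which start in a stabiliser state. It has
`len w` steps, each of them computed in polynomial time from `w`, random coins, the number of the
step, and the outcomes of the previous measurements. -/
structure CliffordFamily where
  n : List Bool → ℕ
  t : List Bool → ℕ
  len : List Bool → ℕ
  coins : List Bool → ℕ
  gens : ∀ w, List (Pauli (n w))
  step : ∀ w, (Fin (coins w) → Bool) → ℕ → List Bool → Step (n w + t w)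
  gens_stabiliser : ∀ w, IsStabiliserGenerators (gens w)
  n_poly : PolyTime encBits (fun w => encNat (n w))
  t_poly : PolyTime encBits (fun w => encNat (t w))
  len_poly : PolyTime encBits (fun w => encNat (len w))
  coins_poly : PolyTime encBits (fun w => encNat (coins w))
  gens_poly : PolyTime encBits (fun w => encList encPauli (gens w))
  step_poly : PolyTime
    (fun a : (Σ w : List Bool, Fin (coins w) → Bool) × ℕ × List Bool =>
      .pair (encBits a.1.1) (.pair (encCoins a.1.2) (.pair (encNat a.2.1) (encBits a.2.2))))
    (fun a => encStep (step a.1.1 a.1.2 a.2.1 a.2.2))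

namespace CliffordFamily

variable (C : CliffordFamily)

/-- The steps do not depend on the values of previous outcomes. -/
def NonAdaptive : Prop :=
  ∀ w r k o o', o.length = o'.length → C.step w r k o = C.step w r k o'

def NoPostselection : Prop :=
  ∀ w r k o i, C.step w r k o ≠ .measure i true

/-- The input state `σ ⊗ ρ`. -/
def input (w : List Bool) (ρ : Op (C.t w)) : Op (C.n w + C.t w) :=
  tensorState (stabiliserState (C.gens w)) ρ

/-- Joint weights of all measurement outcomes of `C_w`, for coins `r`; without postselection this
is the output distribution. -/
def dist (w : List Bool) (r : Fin (C.coins w) → Bool) (ρ : Op (C.t w)) : Dist :=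
  run (fun k o => (C.step w r k o).action) (C.len w) 0 [] (C.input w ρ)

/-- The output distribution conditional on the event that all postselected measurements of the
circuit have outcome `+1`. -/
def condDist (w : List Bool) (r : Fin (C.coins w) → Bool) (ρ : Op (C.t w)) : Dist :=
  (mass (C.dist w r ρ))⁻¹ • C.dist w r ρ

/-- The output distribution with stepwise postselection. -/
def stepwiseDist (w : List Bool) (r : Fin (C.coins w) → Bool) (ρ : Op (C.t w)) : Dist :=
  runStepwise (fun k o => (C.step w r k o).action) (C.len w) 0 [] (C.input w ρ)

end CliffordFamily

/-! ## Pauli based computation -/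

/-- The description of the next measurement; `none` means that the circuit has ended. -/
def encNext {N : ℕ} : Option (Pauli N × Bool) → Val
  | none => .nil
  | some (P, post) => .pair (encPauli P) (encBool post)

/-- `o` is a string of outcomes of measurements that are all made. -/
def Reachable {N : ℕ} (next : List Bool → Option (Pauli N × Bool)) (o : List Bool) : Prop :=
  ∀ k < o.length, (next (o.take k)).isSome

/-- The Pauli operators measured along `o`, in order. -/
def measured {N : ℕ} (next : List Bool → Option (Pauli N × Bool)) (o : List Bool) :
    List (Pauli N) :=
  (List.range o.length).filterMap fun k => (next (o.take k)).map Prod.fst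

/-- A PBC circuit on `N` qubits, given by its next measurement (and whether this is postselected
to outcome `+1`) as a function of the previous outcomes: in every branch the measured Paulis
commute pairwise and are independent, and there are at most `N` of them. -/
def IsPBC {N : ℕ} (next : List Bool → Option (Pauli N × Bool)) : Prop :=
  ∀ o, Reachable next o →
    PairwiseCommuting (measured next o) ∧ Independent (measured next o) ∧ o.length ≤ N

def pbcAction {N : ℕ} : Option (Pauli N × Bool) → Action N
  | none => .halt
  | some (P, post) => .measure P.op post

/-- A uniform family of randomly chosen PBC circuits on `t w` qubits: for each value `r` of the
random coins `next w r` is a PBC circuit, and its next measurement is computed in polynomial time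
from `w`, `r` and the previous outcomes. -/
structure PBCFamily (t : List Bool → ℕ) where
  coins : List Bool → ℕ
  next : ∀ w, (Fin (coins w) → Bool) → List Bool → Option (Pauli (t w) × Bool)
  isPBC : ∀ w r, IsPBC (next w r)
  coins_poly : PolyTime encBits (fun w => encNat (coins w))
  next_poly : PolyTime
    (fun a : (Σ w : List Bool, Fin (coins w) → Bool) × List Bool =>
      .pair (encBits a.1.1) (.pair (encCoins a.1.2) (encBits a.2)))
    (fun a => encNext (next a.1.1 a.1.2 a.2))

namespace PBCFamily

variable {t : List Bool → ℕ} (B : PBCFamily t)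

/-- The measured Paulis do not depend on the values of previous outcomes. -/
def NonAdaptive : Prop :=
  ∀ w r o o', o.length = o'.length → B.next w r o = B.next w r o'

def NoPostselection : Prop :=
  ∀ w r o P, B.next w r o ≠ some (P, true)

/-- Joint weights of all measurement outcomes; since a PBC circuit on `t w` qubits makes at most
`t w` measurements, `t w` steps suffice. -/
def dist (w : List Bool) (r : Fin (B.coins w) → Bool) (ρ : Op (t w)) : Dist :=
  run (fun _ o => pbcAction (B.next w r o)) (t w) 0 [] ρ

def condDist (w : List Bool) (r : Fin (B.coins w) → Bool) (ρ : Op (t w)) : Dist :=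
  (mass (B.dist w r ρ))⁻¹ • B.dist w r ρ

def stepwiseDist (w : List Bool) (r : Fin (B.coins w) → Bool) (ρ : Op (t w)) : Dist :=
  runStepwise (fun _ o => pbcAction (B.next w r o)) (t w) 0 [] ρ

end PBCFamily

/-- Weak simulation of the family `C` by the family `B`, where `DC` and `DB` are their output
distributions (given coins and input): a polynomial time post-processing of the coins and outcomes
of `B_w` on input `ρ` yields a sample of the output distribution of `C_w` on input `σ ⊗ ρ`, for all
states `ρ` with `dom w ρ`. -/
def WeaklySimulatedBy (C : CliffordFamily) (B : PBCFamily C.t)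
    (DC : ∀ w, (Fin (C.coins w) → Bool) → Op (C.t w) → Dist)
    (DB : ∀ w, (Fin (B.coins w) → Bool) → Op (C.t w) → Dist)
    (dom : ∀ w, Op (C.t w) → Prop) : Prop :=
  ∃ post : ∀ w, (Fin (B.coins w) → Bool) → List Bool → List Bool,
    PolyTime
      (fun a : (Σ w : List Bool, Fin (B.coins w) → Bool) × List Bool =>
        .pair (encBits a.1.1) (.pair (encCoins a.1.2) (encBits a.2)))
      (fun a => encBits (post a.1.1 a.1.2 a.2)) ∧
    ∀ w (ρ : Op (C.t w)), IsState ρ → dom w ρ →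
      coinAverage (fun r => DC w r ρ) =
        coinAverage (fun r => (DB w r ρ).mapDomain (post w r))

end CliffordPBC

end

open CliffordPBC

noncomputable section
namespace CliffordPBC

/-! ## Closure properties of polynomial time -/

/-! The circuit is simulated classically, except for those measurements that really concern `ρ`. The
current state is written as `V B Vᴴ`, where `V` is a product of Clifford rotations `(1 + iP)/√2` and
`B` is described by a tableau of pairs `(Q, D)`. The `Q` commute and stabilise `B`; each `D`
anticommutes with its own `Q` and commutes with the other `Q`. On Paulis that commute with the whole
tableau, `B` has the expectation values of a completely mixed state of the first lines next to an
unnormalised state `R` of the last lines (`Tracks`). Gates only extend `V` (`Step.gate_eq`).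

A `Z` measurement is pulled back through `V` to a Pauli `M` acting on `B` (`SimState.measure_spec`).
If `M` anticommutes with some `Q`, the outcome is a fair coin and the projection acts on `B` as a
rotation, which is moved into `V`. Otherwise `M` may be multiplied by some of the `Q` until it
commutes with every `D`. If the result acts on the first lines, which look completely mixed, the
outcome is again a fair coin and the result joins the tableau. If it acts on the last lines only, it
is measured on them and joins the tableau. If it is `±1`, the outcome is determined. The stabiliser
input itself arises in this way from measurements of its generators (`initTab_spec`). Induction on
the steps, with one coin for each, gives equality of distributions (`simulate_correct`).

The queried Paulis commute, and each has a partner that anticommutes with it and commutes with the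
others. So they are independent (`Tableau.Dual.independent`), and with their partners they form
linearly independent vectors of a symplectic space of dimension `2t`, which allows at most `t`
queries (`Tableau.Dual.length_le`).

All decisions of the simulation depend on the symplectic form, which does not see signs, whereas the
values of previous outcomes enter as signs only (`SimState.Like.measure`). A query without
postselection is stripped of its sign, and the sign is restored in the classical outcome; hence a
non-adaptive circuit gives non-adaptive queries. A postselected query has to keep its sign.
Therefore the measurements of a non-adaptive circuit with postselection are first deferred: they are
replaced by controlled NOTs to fresh ancillas, which are measured at the end, the postselected ones
first (`run_defer`). In this order conditioning on all postselected outcomes agrees with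
renormalising at each of them (`runStepwise_of_postFirst`).

Polynomial time follows from closure under composition, case distinction and iteration with
polynomially many rounds and polynomially large intermediate states (`PolyTime.iterate`,
`PolyTime.foldl`); a simulated step adds a bounded number of Paulis to the record
(`Config.Bounded.advance`). -/

theorem Val.size_pos (v : Val) : 1 ≤ v.size := by cases v <;> simp [Val.size]

/-- Every operation pays for the tree that it reads, so outputs cannot outgrow the cost. This is why
polynomial bounds survive composition. -/
theorem Runs.size_le {p : Prog} {x y : Val} {c : ℕ} (h : Runs p x y c) : y.size ≤ c := by
  induction h with
  | id x => exact le_rfl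
  | nil x => exact x.size_pos
  | fst_nil => exact le_rfl
  | fst_pair a b => simp only [Val.size]; omega
  | snd_nil => exact le_rfl
  | snd_pair a b => simp only [Val.size]; omega
  | pair hp hq ihp ihq => rename_i x _ _ _ _; have := x.size_pos; simp only [Val.size]; omega
  | seq => omega
  | cond_false => omega
  | cond_true => omega
  | loop_stop => omega
  | loop_step => omega

theorem eval_mono (q : Polynomial ℕ) {x y : ℕ} (h : x ≤ y) : q.eval x ≤ q.eval y := by
  simp only [Polynomial.eval_eq_sum, Polynomial.sum]
  gcongr

namespace PolyTime

variable {α β : Type} {inp out out' : α → Val}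

/-- The same program serves any family of its inputs. The index type carries data and side
conditions that the program does not see. -/
theorem reindex (h : PolyTime inp out) (φ : β → α) :
    PolyTime (fun b => inp (φ b)) (fun b => out (φ b)) := by
  obtain ⟨p, q, h⟩ := h
  exact ⟨p, q, fun b => h (φ b)⟩

theorem comp {mid : α → Val} (h : PolyTime inp mid) (h' : PolyTime mid out) :
    PolyTime inp out := by
  obtain ⟨p, q, h⟩ := h
  obtain ⟨p', q', h'⟩ := h'
  refine ⟨.seq p p', q + q'.comp q + 1, fun a => ?_⟩
  obtain ⟨c, hc, hcq⟩ := h a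
  obtain ⟨d, hd, hdq⟩ := h' a
  refine ⟨c + d + 1, .seq hc hd, ?_⟩
  have := eval_mono q' (hc.size_le.trans hcq)
  simp only [Polynomial.eval_add, Polynomial.eval_comp, Polynomial.eval_one]
  omega

theorem out_size (h : PolyTime inp out) :
    ∃ q : Polynomial ℕ, ∀ a, (out a).size ≤ q.eval (inp a).size := by
  obtain ⟨p, q, h⟩ := h
  exact ⟨q, fun a => let ⟨_, hc, hq⟩ := h a; hc.size_le.trans hq⟩

theorem refl : PolyTime inp inp :=
  ⟨.id, .X, fun a => ⟨_, .id _, by simp⟩⟩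

theorem nil : PolyTime inp (fun _ => .nil) :=
  ⟨.nil, .X, fun a => ⟨_, .nil _, by simp⟩⟩

theorem pair (h : PolyTime inp out) (h' : PolyTime inp out') :
    PolyTime inp (fun a => .pair (out a) (out' a)) := by
  obtain ⟨p, q, h⟩ := h
  obtain ⟨p', q', h'⟩ := h'
  refine ⟨.pair p p', q + q' + .X, fun a => ?_⟩
  obtain ⟨c, hc, hcq⟩ := h a
  obtain ⟨d, hd, hdq⟩ := h' a
  refine ⟨_, .pair hc hd, ?_⟩
  simp only [Polynomial.eval_add, Polynomial.eval_X]
  omega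

theorem fst (h : PolyTime inp (fun a => .pair (out a) (out' a))) : PolyTime inp out :=
  h.comp ⟨.fst, .X, fun a => ⟨_, .fst_pair _ _, by simp⟩⟩

theorem snd (h : PolyTime inp (fun a => .pair (out a) (out' a))) : PolyTime inp out' :=
  h.comp ⟨.snd, .X, fun a => ⟨_, .snd_pair _ _, by simp⟩⟩

theorem pfst : PolyTime (fun a => .pair (out a) (out' a)) out := refl.fst

theorem psnd : PolyTime (fun a => .pair (out a) (out' a)) out' := refl.snd

theorem const (v : Val) : PolyTime inp (fun _ => v) := by
  induction v with
  | nil => exact nil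
  | pair a b iha ihb => exact iha.pair ihb

/-- Case distinction on whether a computed tree is `nil`; each branch only has to be computed
where it applies. -/
theorem branch {t : α → Val} (ht : PolyTime inp t)
    (h0 : PolyTime (fun a : {a // t a = .nil} => inp a) (fun a => out a))
    (h1 : PolyTime (fun a : {a // t a ≠ .nil} => inp a) (fun a => out a)) :
    PolyTime inp out := by
  obtain ⟨b, q, hb⟩ := ht
  obtain ⟨p₀, q₀, h0⟩ := h0
  obtain ⟨p₁, q₁, h1⟩ := h1
  refine ⟨.cond b p₁ p₀, q + q₀ + q₁ + .X, fun a => ?_⟩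
  obtain ⟨c, hc, hcq⟩ := hb a
  simp only [Polynomial.eval_add, Polynomial.eval_X]
  rcases hv : t a with _ | ⟨u, v⟩
  · obtain ⟨d, hd, hdq⟩ := h0 ⟨a, hv⟩
    rw [hv] at hc
    exact ⟨_, .cond_false hc hd, by simp only at hdq; omega⟩
  · obtain ⟨d, hd, hdq⟩ := h1 ⟨a, by simp [hv]⟩
    rw [hv] at hc
    exact ⟨_, .cond_true hc hd, by simp only at hdq; omega⟩

theorem encBool_eq_nil {b : Bool} : encBool b = .nil ↔ b = false := by cases b <;> simp [encBool]

/-- Case distinction on a computed bit. -/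
theorem caseBool {t : α → Bool} (ht : PolyTime inp (fun a => encBool (t a)))
    (h0 : PolyTime (fun a : {a // t a = false} => inp a) (fun a => out a))
    (h1 : PolyTime (fun a : {a // t a = true} => inp a) (fun a => out a)) :
    PolyTime inp out :=
  ht.branch
    (h0.reindex fun a : {a // encBool (t a) = .nil} => ⟨a.1, encBool_eq_nil.1 a.2⟩)
    (h1.reindex fun a : {a // encBool (t a) ≠ .nil} =>
      ⟨a.1, by have := a.2; rw [Ne, encBool_eq_nil] at this; simpa using this⟩)

theorem restrict {p : α → Prop} (h : PolyTime inp out) :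
    PolyTime (fun a : {a // p a} => inp a) (fun a => out a) := h.reindex Subtype.val

theorem congr (h : PolyTime inp out) (e : ∀ a, out a = out' a) : PolyTime inp out' := by
  rwa [← funext e]

/-- Case distinction on a computed bit between everywhere computable branches. -/
theorem ite {t : α → Bool} (ht : PolyTime inp (fun a => encBool (t a)))
    (h1 : PolyTime inp out) (h0 : PolyTime inp out') :
    PolyTime inp (fun a => if t a then out a else out' a) :=
  ht.caseBool (h0.restrict.congr fun a => by simp [a.2]) (h1.restrict.congr fun a => by simp [a.2])

/-! ### Bits -/

variable {s t : α → Bool}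

theorem not (hs : PolyTime inp (fun a => encBool (s a))) :
    PolyTime inp (fun a => encBool (!s a)) :=
  (hs.ite (const (encBool false)) (const (encBool true))).congr fun a => by cases s a <;> rfl

theorem and (hs : PolyTime inp (fun a => encBool (s a)))
    (ht : PolyTime inp (fun a => encBool (t a))) :
    PolyTime inp (fun a => encBool (s a && t a)) :=
  (hs.ite ht (const (encBool false))).congr fun a => by cases s a <;> rfl

theorem xor (hs : PolyTime inp (fun a => encBool (s a)))
    (ht : PolyTime inp (fun a => encBool (t a))) :
    PolyTime inp (fun a => encBool (Bool.xor (s a) (t a))) :=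
  (hs.ite ht.not ht).congr fun a => by cases s a <;> simp

/-! ### Finite types -/

/-- The program descends along the fixed tree `v`. No bound on its cost is needed, since `of_finite`
applies it to finitely many inputs. -/
theorem runs_eqConst (v : Val) : ∃ p : Prog, ∀ x, ∃ c,
    Runs p x (open scoped Classical in encBool (decide (x = v))) c := by
  classical
  induction v with
  | nil =>
    refine ⟨.cond .id .nil (.pair .nil .nil), fun x => ?_⟩
    rcases x with _ | ⟨u, v⟩
    · simpa [encBool] using ⟨_, .cond_false (.id _) (.pair (.nil _) (.nil _))⟩
    · simpa [encBool] using ⟨_, .cond_true (.id _) (.nil _)⟩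
  | pair a b iha ihb =>
    obtain ⟨p, hp⟩ := iha
    obtain ⟨q, hq⟩ := ihb
    refine ⟨.cond .id (.cond (.seq .fst p) (.seq .snd q) .nil) .nil, fun x => ?_⟩
    rcases x with _ | ⟨u, v⟩
    · simpa [encBool] using ⟨_, .cond_false (.id _) (.nil _)⟩
    · obtain ⟨c, hc⟩ := hp u
      obtain ⟨d, hd⟩ := hq v
      by_cases hu : u = a
      · simp only [hu, decide_true, encBool] at hc
        refine ⟨_, .cond_true (.id _) (.cond_true (.seq (.fst_pair _ _) (hu ▸ hc))
          (.seq (.snd_pair _ _) (y := v) (d := d) ?_))⟩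
        convert hd using 2
        simp [hu]
      · simp only [hu, decide_false, encBool] at hc
        have : decide (Val.pair u v = Val.pair a b) = false := by simp [hu]
        rw [this]
        exact ⟨_, .cond_true (.id _) (.cond_false (.seq (.fst_pair _ _) hc) (.nil _))⟩

/-- Every function on a finite type is polynomial-time computable. -/
theorem of_finite [Finite α] (hinp : Function.Injective inp) : PolyTime inp out := by
  classical
  obtain ⟨_⟩ := nonempty_fintype α
  suffices h : ∀ l : List α, ∃ p : Prog, ∀ a ∈ l, ∃ c, Runs p (inp a) (out a) c by
    obtain ⟨p, hp⟩ := h Finset.univ.toList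
    choose c hc using fun a => hp a (by simp)
    exact ⟨p, .C (Finset.univ.sup c), fun a => ⟨c a, hc a, by
      simpa using Finset.le_sup (f := c) (Finset.mem_univ a)⟩⟩
  intro l
  induction l with
  | nil => exact ⟨.nil, by simp⟩
  | cons b l ih =>
    obtain ⟨p, hp⟩ := ih
    obtain ⟨e, he⟩ := runs_eqConst (inp b)
    obtain ⟨k, q, hk⟩ := const (inp := inp) (out b)
    refine ⟨.cond e k p, fun a ha => ?_⟩
    obtain ⟨c, hc⟩ := he (inp a)
    obtain ⟨d, hd, -⟩ := hk a
    by_cases hab : a = b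
    · subst hab
      simp only [decide_true, encBool] at hc
      exact ⟨_, .cond_true hc hd⟩
    · have : inp a ≠ inp b := fun h => hab (hinp h)
      simp only [this, decide_false, encBool] at hc
      obtain ⟨d', hd'⟩ := hp a (by simpa [hab] using ha)
      exact ⟨_, .cond_false hc hd'⟩

/-- A function with values in a finite type followed by any other function. -/
theorem finite_comp {f : α → β} {e : β → Val} [Finite β] (he : Function.Injective e)
    (hf : PolyTime inp (fun a => e (f a))) (g : β → Val) : PolyTime inp (fun a => g (f a)) :=
  hf.comp ((of_finite (out := g) he).reindex f)

/-! ### Iteration -/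

/-- `x i` is the state after `i` rounds and `B` bounds the cost of one round; the failing test at
the end counts as a further round. Induction on the number of rounds shifts all sequences by one. -/
theorem runs_loop {b p : Prog} (x : ℕ → Val) (k : ℕ) (cb cp : ℕ → ℕ)
    (hb : ∀ i < k, ∃ u v, Runs b (x i) (.pair u v) (cb i)) (hk : Runs b (x k) .nil (cb k))
    (hp : ∀ i < k, Runs p (x i) (x (i + 1)) (cp i)) (B : ℕ)
    (hB : ∀ i ≤ k, cb i + cp i + (x i).size ≤ B) :
    ∃ c, Runs (.loop b p) (x 0) (x k) c ∧ c ≤ (k + 1) * B := by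
  induction k generalizing x cb cp with
  | zero => exact ⟨_, Runs.loop_stop hk, by have := hB 0 le_rfl; omega⟩
  | succ k ih =>
    obtain ⟨c, hc, hcB⟩ := ih (fun i => x (i + 1)) (fun i => cb (i + 1)) (fun i => cp (i + 1))
      (fun i hi => hb (i + 1) (by omega)) hk (fun i hi => hp (i + 1) (by omega))
      (fun i hi => hB (i + 1) (by omega))
    obtain ⟨u, v, h0⟩ := hb 0 (by omega)
    refine ⟨_, .loop_step h0 (hp 0 (by omega)) hc, ?_⟩
    have := hB 0 (by omega)
    linarith [add_mul (k + 1) 1 B]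

/-- The cost is the number of rounds times the cost of a round on the largest state that occurs. The
bound on intermediate states is essential: a polynomial-time body may square the size of its
argument. -/
theorem iterate {σ : α → Type} {enc : ∀ a, σ a → Val} {init : ∀ a, σ a}
    {body : ∀ a, σ a → σ a} {test : ∀ a, σ a → Bool} {k : α → ℕ}
    (hinit : PolyTime inp (fun a => enc a (init a)))
    (hbody : PolyTime (fun x : Σ a, σ a => enc x.1 x.2) (fun x => enc x.1 (body x.1 x.2)))
    (htest : PolyTime (fun x : Σ a, σ a => enc x.1 x.2) (fun x => encBool (test x.1 x.2)))
    (hk : ∃ q : Polynomial ℕ, ∀ a, k a ≤ q.eval (inp a).size)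
    (htrue : ∀ a, ∀ i < k a, test a ((body a)^[i] (init a)) = true)
    (hfalse : ∀ a, test a ((body a)^[k a] (init a)) = false)
    (hsize : ∃ q : Polynomial ℕ, ∀ a, ∀ i ≤ k a,
      (enc a ((body a)^[i] (init a))).size ≤ q.eval (inp a).size) :
    PolyTime inp (fun a => enc a ((body a)^[k a] (init a))) := by
  obtain ⟨p₀, q₀, h0⟩ := hinit
  obtain ⟨p, qp, hp⟩ := hbody
  obtain ⟨b, qb, hb⟩ := htest
  obtain ⟨qk, hk⟩ := hk
  obtain ⟨qs, hsize⟩ := hsize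
  refine ⟨.seq p₀ (.loop b p), q₀ + (qk + 1) * (qb + qp + .X).comp qs + 1, fun a => ?_⟩
  obtain ⟨c₀, hc₀, hcq₀⟩ := h0 a
  choose cp hcp hcpq using fun i => hp ⟨a, (body a)^[i] (init a)⟩
  choose cb hcb hcbq using fun i => hb ⟨a, (body a)^[i] (init a)⟩
  obtain ⟨c, hc, hcq⟩ := runs_loop (b := b) (p := p) (fun i => enc a ((body a)^[i] (init a))) (k a)
    cb cp (fun i hi => ⟨.nil, .nil, by simpa [htrue a i hi, encBool] using hcb i⟩)
    (by simpa [hfalse a, encBool] using hcb (k a))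
    (fun i hi => by simpa [Function.iterate_succ_apply'] using hcp i)
    ((qb + qp + .X).eval (qs.eval (inp a).size)) (fun i hi => by
      refine le_trans ?_ (eval_mono _ (hsize a i hi))
      simp only [Polynomial.eval_add, Polynomial.eval_X]
      have := hcbq i
      have := hcpq i
      simp only at *
      omega)
  refine ⟨_, .seq hc₀ hc, ?_⟩
  have : (k a + 1) * ((qb + qp + .X).eval (qs.eval (inp a).size)) ≤
      (qk.eval (inp a).size + 1) * ((qb + qp + .X).eval (qs.eval (inp a).size)) := by
    gcongr; exact hk a
  simp only [Polynomial.eval_add, Polynomial.eval_mul, Polynomial.eval_comp,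
    Polynomial.eval_one] at *
  omega

end PolyTime
end CliffordPBC
end

noncomputable section
namespace CliffordPBC

/-! ### Lists -/

section Sizes

variable {τ : Type} {e : τ → Val}

theorem size_encList_le {l : List τ} {B : ℕ} (h : ∀ x ∈ l, (e x).size ≤ B) :
    (encList e l).size ≤ l.length * (B + 1) + 1 := by
  induction l with
  | nil => simp [encList, Val.size]
  | cons a l ih =>
    have h1 := h a (by simp)
    have h2 := ih fun x hx => h x (by simp [hx])
    simp only [encList, Val.size, List.length_cons, add_mul, one_mul] at *
    omega

theorem length_lt_size_encList (l : List τ) : l.length < (encList e l).size := by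
  induction l with
  | nil => simp [encList, Val.size]
  | cons a l ih => simp only [encList, Val.size, List.length_cons]; omega

theorem size_le_size_encList {l : List τ} {x : τ} (h : x ∈ l) :
    (e x).size ≤ (encList e l).size := by
  induction l with
  | nil => simp at h
  | cons a l ih =>
    simp only [encList, Val.size]
    rcases List.mem_cons.1 h with rfl | h
    · omega
    · have := ih h; omega

theorem size_encList_drop_le (l : List τ) (i : ℕ) :
    (encList e (l.drop i)).size ≤ (encList e l).size := by
  induction l generalizing i with
  | nil => simp
  | cons a l ih =>
    cases i with
    | zero => simp
    | succ i => have := ih i; simp only [List.drop_succ_cons, encList, Val.size]; omega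

theorem size_encBool_le (b : Bool) : (encBool b).size ≤ 3 := by
  cases b <;> simp [encBool, Val.size]

theorem size_encNat (k : ℕ) : (encNat k).size = 2 * k + 1 := by
  induction k with
  | zero => rfl
  | succ k ih => simp only [encNat, Val.size, ih]; omega

theorem size_encBits_le (l : List Bool) : (encBits l).size ≤ l.length * 4 + 1 :=
  size_encList_le fun b _ => size_encBool_le b

end Sizes

/-- Reduces unary arithmetic to operations on lists. -/
theorem encNat_eq_encList (k : ℕ) :
    encNat k = encList (fun _ : Unit => .nil) (List.replicate k ()) := by
  induction k with
  | zero => rfl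
  | succ k ih => simp [encNat, List.replicate_succ, encList, ih]

namespace PolyTime

variable {α β : Type} {inp out out' : α → Val}

/-- Forget the additional data of an extended context. -/
theorem weaken (h : PolyTime inp out) (φ : β → α) {v : β → Val} :
    PolyTime (fun b => .pair (inp (φ b)) (v b)) (fun b => out (φ b)) :=
  pfst.comp (h.reindex φ)

section

variable {σ τ τ' : α → Type} {es : ∀ a, σ a → Val} {et : ∀ a, τ a → Val} {et' : ∀ a, τ' a → Val}
  {l l' : ∀ a, List (τ a)}

/-- In the non-empty case head and tail are appended to the input, and their relation to `l` is kept
in the index type, so that the branch may use data that exist only there. -/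
theorem caseList (hl : PolyTime inp (fun a => encList (et a) (l a)))
    (h0 : PolyTime (fun a : {a // l a = []} => inp a) (fun a => out a))
    (h1 : PolyTime (fun x : {x : Σ a, τ a × List (τ a) // l x.1 = x.2.1 :: x.2.2} =>
      .pair (inp x.1.1) (.pair (et x.1.1 x.1.2.1) (encList (et x.1.1) x.1.2.2)))
      (fun x => out x.1.1)) :
    PolyTime inp out := by
  refine hl.branch (h0.reindex fun a : {a // encList (et a) (l a) = .nil} => ⟨a.1, ?_⟩) ?_
  · obtain ⟨a, ha⟩ := a
    rcases h : l a with _ | ⟨x, m⟩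
    · rfl
    · simp [h, encList] at ha
  · have key : ∀ a : {a // encList (et a) (l a) ≠ .nil}, ∃ x m, l a.1 = x :: m := by
      rintro ⟨a, ha⟩
      rcases h : l a with _ | ⟨x, m⟩
      · simp [h, encList] at ha
      · exact ⟨x, m, rfl⟩
    choose x m hxm using key
    have := h1.reindex fun a : {a // encList (et a) (l a) ≠ .nil} => ⟨⟨a.1, x a, m a⟩, hxm a⟩
    refine (refl.restrict.pair ?_).comp this
    refine hl.restrict.congr fun a => ?_
    rw [hxm a]; rfl

/-- The loop state consists of the accumulator and the rest of the list, next to the original input,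
which the step may consult. Hence only accumulators of prefixes need a size bound. -/
theorem foldl {init : ∀ a, σ a} {step : ∀ a, σ a → τ a → σ a}
    (hl : PolyTime inp (fun a => encList (et a) (l a)))
    (hinit : PolyTime inp (fun a => es a (init a)))
    (hstep : PolyTime
      (fun x : Σ a, σ a × τ a => .pair (inp x.1) (.pair (es x.1 x.2.1) (et x.1 x.2.2)))
      (fun x => es x.1 (step x.1 x.2.1 x.2.2)))
    (hsize : ∃ q : Polynomial ℕ, ∀ a, ∀ m, m <+: l a →
      (es a (m.foldl (step a) (init a))).size ≤ q.eval (inp a).size) :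
    PolyTime inp (fun a => es a ((l a).foldl (step a) (init a))) := by
  have hit : ∀ a, ∀ i ≤ (l a).length,
      (fun x : σ a × List (τ a) => match x.2 with
        | [] => x
        | y :: m => (step a x.1 y, m))^[i] (init a, l a) =
      (((l a).take i).foldl (step a) (init a), (l a).drop i) := by
    intro a i hi
    induction i with
    | zero => simp
    | succ i ih =>
      have hlt : i < (l a).length := by omega
      rw [Function.iterate_succ_apply', ih (by omega), List.drop_eq_getElem_cons hlt,
        List.take_succ_eq_append_getElem hlt, List.foldl_append]
      rfl
  have main := iterate (inp := inp) (σ := fun a => σ a × List (τ a))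
    (enc := fun a x => .pair (inp a) (.pair (es a x.1) (encList (et a) x.2)))
    (init := fun a => (init a, l a))
    (body := fun a x => match x.2 with
        | [] => x
        | y :: m => (step a x.1 y, m))
    (test := fun a x => !x.2.isEmpty) (k := fun a => (l a).length)
    (refl.pair (hinit.pair hl)) ?_ ?_ ?_ ?_ ?_ ?_
  · refine main.snd.fst.congr fun a => ?_
    rw [hit a _ le_rfl]; simp
  · refine caseList (et := fun x : Σ a, σ a × List (τ a) => et x.1) (l := fun x => x.2.2)
      psnd.snd (refl.congr ?_) ?_
    · rintro ⟨⟨a, s, m⟩, h⟩; simp only at h; subst h; rfl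
    · refine (pfst.fst.pair (?_ : PolyTime _ fun x : {x : Σ b : (Σ a, σ a × List (τ a)),
        τ b.1 × List (τ b.1) // x.1.2.2 = x.2.1 :: x.2.2} =>
          .pair (es x.1.1.1 (step x.1.1.1 x.1.1.2.1 x.1.2.1)) (encList (et _) x.1.2.2))).congr ?_
      · refine pair ?_ psnd.snd
        exact (pfst.fst.pair (pfst.snd.fst.pair psnd.fst)).comp
          (hstep.reindex fun x : {x : Σ b : (Σ a, σ a × List (τ a)),
            τ b.1 × List (τ b.1) // x.1.2.2 = x.2.1 :: x.2.2} =>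
              ⟨x.1.1.1, x.1.1.2.1, x.1.2.1⟩)
      · rintro ⟨⟨⟨a, s, m⟩, y, m'⟩, h⟩
        simp only at h
        simp only [h]
  · refine branch (t := fun x => encList (et x.1) x.2.2) psnd.snd
      ((const (encBool false)).congr ?_) ((const (encBool true)).congr ?_)
    · rintro ⟨⟨a, s, _ | ⟨y, m⟩⟩, h⟩
      · rfl
      · simp [encList] at h
    · rintro ⟨⟨a, s, _ | ⟨y, m⟩⟩, h⟩
      · simp [encList] at h
      · rfl
  · obtain ⟨q, hq⟩ := hl.out_size
    exact ⟨q, fun a => ((length_lt_size_encList _).le).trans (hq a)⟩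
  · intro a i hi
    rw [hit a i hi.le]
    simpa using hi
  · intro a
    rw [hit a _ le_rfl]; simp
  · obtain ⟨q, hq⟩ := hl.out_size
    obtain ⟨q', hq'⟩ := hsize
    refine ⟨.X + q + q' + 2, fun a i hi => ?_⟩
    rw [hit a i hi]
    have h1 := (size_encList_drop_le (e := et a) (l a) i).trans (hq a)
    have h2 := hq' a _ (List.take_prefix i (l a))
    simp only [Val.size, Polynomial.eval_add, Polynomial.eval_X, Polynomial.eval_ofNat]
    omega

theorem size_encList_reverse {τ : Type} {e : τ → Val} (l : List τ) :
    (encList e l.reverse).size = (encList e l).size := by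
  have app : ∀ l m : List τ, (encList e (l ++ m)).size + 1 =
      (encList e l).size + (encList e m).size := by
    intro l m
    induction l with
    | nil => simp [encList, Val.size]; omega
    | cons a l ih => simp only [List.cons_append, encList, Val.size]; omega
  induction l with
  | nil => rfl
  | cons a l ih =>
    have := app l.reverse [a]
    simp only [List.reverse_cons, encList, Val.size] at *
    omega

theorem reverse (hl : PolyTime inp (fun a => encList (et a) (l a))) :
    PolyTime inp (fun a => encList (et a) (l a).reverse) := by
  have hf : ∀ {τ : Type} (l m : List τ), l.foldl (fun m x => x :: m) m = l.reverse ++ m := by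
    intro τ l; induction l with
    | nil => simp
    | cons a l ih => intro m; simp [ih]
  have := foldl (σ := fun a => List (τ a)) (es := fun a => encList (et a)) (et := et) (l := l)
    (init := fun _ => []) (step := fun a m x => x :: m) hl nil (psnd.snd.pair psnd.fst) ?_
  · exact this.congr fun a => by rw [hf]; simp
  · obtain ⟨q, hq⟩ := hl.out_size
    -- The reverse of a prefix is a suffix of the reversed list, so it is no larger than `l a`.
    refine ⟨q, fun a m hm => le_trans ?_ (hq a)⟩
    rw [hf, List.append_nil, ← size_encList_reverse (l a)]
    obtain ⟨k, hk⟩ := hm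
    rw [← hk]
    have := size_encList_drop_le (e := et a) (k.reverse ++ m.reverse) k.length
    rw [← List.length_reverse, List.drop_left] at this
    simpa using this

theorem append (hl : PolyTime inp (fun a => encList (et a) (l a)))
    (hl' : PolyTime inp (fun a => encList (et a) (l' a))) :
    PolyTime inp (fun a => encList (et a) (l a ++ l' a)) := by
  have hf : ∀ {τ : Type} (l m : List τ), l.foldl (fun m x => x :: m) m = l.reverse ++ m := by
    intro τ l; induction l with
    | nil => simp
    | cons a l ih => intro m; simp [ih]
  have := foldl (σ := fun a => List (τ a)) (es := fun a => encList (et a)) (et := et)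
    (l := fun a => (l a).reverse)
    (init := l') (step := fun a m x => x :: m) hl.reverse hl' (psnd.snd.pair psnd.fst) ?_
  · exact this.congr fun a => by rw [hf]; simp
  · obtain ⟨q, hq⟩ := hl.out_size
    obtain ⟨q', hq'⟩ := hl'.out_size
    -- There are at most `q + q'` entries of size at most `q + q'`; the first two summands are
    -- slack.
    refine ⟨q * (q + 1) + q' * (q' + 1) + (q + q') * (q + q' + 1) + 1, fun a m hm => ?_⟩
    rw [hf]
    have B : ∀ x ∈ m.reverse ++ l' a, (et a x).size ≤ (q + q').eval (inp a).size := by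
      intro x hx
      simp only [Polynomial.eval_add]
      rcases List.mem_append.1 hx with hx | hx
      · have : x ∈ l a := by simpa using hm.subset (List.mem_reverse.1 hx)
        have := (size_le_size_encList (e := et a) this).trans (hq a)
        omega
      · have := (size_le_size_encList (e := et a) hx).trans (hq' a)
        omega
    refine (size_encList_le B).trans ?_
    have h1 : (m.reverse ++ l' a).length ≤ (q + q').eval (inp a).size := by
      simp only [Polynomial.eval_add, List.length_append, List.length_reverse]
      have h3 := hm.length_le
      have h1 := ((length_lt_size_encList (e := et a) _).le).trans (hq a)
      have h2 := ((length_lt_size_encList (e := et a) _).le).trans (hq' a)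
      simp only [List.length_reverse] at h3
      omega
    have := Nat.mul_le_mul_right ((q + q').eval (inp a).size + 1) h1
    simp only [Polynomial.eval_add, Polynomial.eval_mul, Polynomial.eval_one] at *
    omega

theorem flatMap {f : ∀ a, τ a → List (τ' a)}
    (hl : PolyTime inp (fun a => encList (et a) (l a)))
    (hf : PolyTime (fun x : Σ a, τ a => .pair (inp x.1) (et x.1 x.2))
      (fun x => encList (et' x.1) (f x.1 x.2))) :
    PolyTime inp (fun a => encList (et' a) ((l a).flatMap (f a))) := by
  have := foldl (σ := fun a => List (τ' a)) (es := fun a => encList (et' a)) (et := et) (l := l)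
    (init := fun _ => []) (step := fun a m x => m ++ f a x) hl nil
    (append (l := fun x : Σ a, List (τ' a) × τ a => x.2.1) (et := fun x => et' x.1) psnd.fst
      ((pfst.pair psnd.snd).comp
        (hf.reindex fun x : Σ a, List (τ' a) × τ a => ⟨x.1, x.2.2⟩))) ?_
  · exact this.congr fun a => by
      rw [List.flatMap_eq_foldl]
  · obtain ⟨q, hq⟩ := hl.out_size
    obtain ⟨q', hq'⟩ := hf.out_size
    -- Bounds the value of `f a` at an entry: its input is `inp a` paired with a tree of size at
    -- most `q`.
    let Q := q'.comp (.X + q + 1)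
    refine ⟨(q * Q) * (Q + 1) + 1, fun a m hm => ?_⟩
    rw [← List.flatMap_eq_foldl]
    have hx : ∀ x ∈ m, (encList (et' a) (f a x)).size ≤ Q.eval (inp a).size := by
      intro x hx
      refine (hq' ⟨a, x⟩).trans ?_
      rw [Polynomial.eval_comp]
      refine eval_mono _ ?_
      have := (size_le_size_encList (e := et a) (hm.subset hx)).trans (hq a)
      simp only [Val.size, Polynomial.eval_add, Polynomial.eval_X, Polynomial.eval_one]
      omega
    refine (size_encList_le (B := Q.eval (inp a).size) ?_).trans ?_
    · intro y hy
      obtain ⟨x, hxm, hy⟩ := List.mem_flatMap.1 hy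
      exact (size_le_size_encList hy).trans (hx x hxm)
    · have h1 : (m.flatMap (f a)).length ≤ m.length * Q.eval (inp a).size := by
        rw [List.length_flatMap]
        refine (List.sum_le_card_nsmul _ (Q.eval (inp a).size) ?_).trans (by simp)
        simp only [List.mem_map]
        rintro _ ⟨x, hxm, rfl⟩
        exact (length_lt_size_encList (e := et' a) _).le.trans (hx x hxm)
      have h2 : m.length ≤ q.eval (inp a).size :=
        hm.length_le.trans (((length_lt_size_encList (e := et a) _).le).trans (hq a))
      simp only [Polynomial.eval_add, Polynomial.eval_mul, Polynomial.eval_one]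
      gcongr
      exact h1.trans (by gcongr)

theorem map {f : ∀ a, τ a → τ' a} (hl : PolyTime inp (fun a => encList (et a) (l a)))
    (hf : PolyTime (fun x : Σ a, τ a => .pair (inp x.1) (et x.1 x.2))
      (fun x => et' x.1 (f x.1 x.2))) :
    PolyTime inp (fun a => encList (et' a) ((l a).map (f a))) :=
  (hl.flatMap (f := fun a x => [f a x]) (hf.pair nil)).congr fun a => by
    rw [List.map_eq_flatMap]

theorem filter {p : ∀ a, τ a → Bool} (hl : PolyTime inp (fun a => encList (et a) (l a)))
    (hp : PolyTime (fun x : Σ a, τ a => .pair (inp x.1) (et x.1 x.2))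
      (fun x => encBool (p x.1 x.2))) :
    PolyTime inp (fun a => encList (et a) ((l a).filter (p a))) := by
  refine (hl.flatMap (et' := et) (f := fun a x => if p a x then [x] else [])
    ((hp.ite (psnd.pair nil) nil).congr fun x => ?_)).congr fun a => ?_
  · cases p x.1 x.2 <;> rfl
  · congr 1
    induction l a with
    | nil => rfl
    | cons x m ih => simp only [List.flatMap_cons, ih, List.filter_cons]; split <;> rfl

theorem tail (hl : PolyTime inp (fun a => encList (et a) (l a))) :
    PolyTime inp (fun a => encList (et a) (l a).tail) := by
  refine hl.caseList (nil.congr fun a => by rw [a.2]; rfl) (psnd.snd.congr fun a => ?_)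
  rw [a.2]; rfl

end

/-! ### Numbers -/

variable {m k : α → ℕ}

theorem succ (hm : PolyTime inp (fun a => encNat (m a))) :
    PolyTime inp (fun a => encNat (m a + 1)) := nil.pair hm

theorem add (hm : PolyTime inp (fun a => encNat (m a))) (hk : PolyTime inp (fun a => encNat (k a))) :
    PolyTime inp (fun a => encNat (m a + k a)) := by
  simp only [encNat_eq_encList] at *
  exact (append (τ := fun _ => Unit) (et := fun _ _ => .nil) hm hk).congr fun a => by simp

theorem length {τ : α → Type} {et : ∀ a, τ a → Val} {l : ∀ a, List (τ a)}
    (hl : PolyTime inp (fun a => encList (et a) (l a))) :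
    PolyTime inp (fun a => encNat (l a).length) := by
  simp only [encNat_eq_encList] at *
  refine (map (et' := fun _ _ => .nil) (f := fun _ _ => ()) hl nil).congr fun a => ?_
  congr 1
  exact List.map_const' ..

theorem replicate {τ : α → Type} {et : ∀ a, τ a → Val} {x : ∀ a, τ a}
    (hm : PolyTime inp (fun a => encNat (m a))) (hx : PolyTime inp (fun a => et a (x a))) :
    PolyTime inp (fun a => encList (et a) (List.replicate (m a) (x a))) := by
  simp only [encNat_eq_encList] at hm
  refine (map (et' := et) (f := fun a _ => x a) hm (hx.weaken Sigma.fst)).congr fun a => ?_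
  simp

/-- Iteration of a function with outputs of bounded size a given number of times. -/
theorem natIterate {σ : α → Type} {es : ∀ a, σ a → Val} {init : ∀ a, σ a}
    {step : ∀ a, σ a → σ a} (hm : PolyTime inp (fun a => encNat (m a)))
    (hinit : PolyTime inp (fun a => es a (init a)))
    (hstep : PolyTime (fun x : Σ a, σ a => .pair (inp x.1) (es x.1 x.2))
      (fun x => es x.1 (step x.1 x.2)))
    (hsize : ∃ q : Polynomial ℕ, ∀ a, ∀ i ≤ m a,
      (es a ((step a)^[i] (init a))).size ≤ q.eval (inp a).size) :
    PolyTime inp (fun a => es a ((step a)^[m a] (init a))) := by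
  have key : ∀ a i, (List.replicate i ()).foldl (fun s _ => step a s) (init a) =
      (step a)^[i] (init a) := by
    intro a i
    generalize init a = s
    induction i generalizing s with
    | zero => rfl
    | succ i ih => simp [List.replicate_succ, ih]
  simp only [encNat_eq_encList] at hm
  refine (foldl (es := es) (init := init) (step := fun a s _ => step a s) hm hinit
    ((pfst.pair psnd.fst).comp (hstep.reindex fun x : Σ a, σ a × Unit => ⟨x.1, x.2.1⟩))
    ?_).congr fun a => by rw [key]
  obtain ⟨q, hq⟩ := hsize
  refine ⟨q, fun a l hl => ?_⟩
  have h1 : l = List.replicate l.length () := List.eq_replicate_of_mem (by simp)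
  have h2 := hl.length_le
  rw [h1, key]
  exact hq a _ (by simpa using h2)

theorem drop {τ : α → Type} {et : ∀ a, τ a → Val} {l : ∀ a, List (τ a)}
    (hl : PolyTime inp (fun a => encList (et a) (l a))) (hm : PolyTime inp (fun a => encNat (m a))) :
    PolyTime inp (fun a => encList (et a) ((l a).drop (m a))) := by
  have key : ∀ {τ : Type} (l : List τ) i, List.tail^[i] l = l.drop i := by
    intro τ l i
    induction i with
    | zero => rfl
    | succ i ih => rw [Function.iterate_succ_apply', ih, List.tail_drop]
  refine (natIterate (es := fun a => encList (et a)) (init := l) (step := fun a => List.tail) hm hl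
    (tail (τ := fun x : Σ a, List (τ a) => τ x.1) (et := fun x => et x.1) psnd) ?_).congr
    fun a => by rw [key]
  obtain ⟨q, hq⟩ := hl.out_size
  exact ⟨q, fun a i _ => by rw [key]; exact (size_encList_drop_le _ _).trans (hq a)⟩

theorem sub (hm : PolyTime inp (fun a => encNat (m a))) (hk : PolyTime inp (fun a => encNat (k a))) :
    PolyTime inp (fun a => encNat (m a - k a)) := by
  simp only [encNat_eq_encList] at hm ⊢
  exact (drop (τ := fun _ => Unit) (et := fun _ _ => .nil) hm hk).congr fun a => by simp

theorem lt (hm : PolyTime inp (fun a => encNat (m a))) (hk : PolyTime inp (fun a => encNat (k a))) :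
    PolyTime inp (fun a => encBool (decide (m a < k a))) := by
  refine (hk.sub hm).branch ((const (encBool false)).congr fun a => ?_)
    ((const (encBool true)).congr fun a => ?_)
  · obtain ⟨a, ha⟩ := a
    congr 1
    by_contra h
    have : k a - m a ≠ 0 := by simp at h ⊢; omega
    obtain ⟨d, hd⟩ := Nat.exists_eq_succ_of_ne_zero this
    simp [hd, encNat] at ha
  · obtain ⟨a, ha⟩ := a
    congr 1
    by_contra h
    have : k a - m a = 0 := by simp at h ⊢; omega
    simp [this, encNat] at ha

theorem eqNat (hm : PolyTime inp (fun a => encNat (m a)))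
    (hk : PolyTime inp (fun a => encNat (k a))) :
    PolyTime inp (fun a => encBool (decide (m a = k a))) := by
  refine ((hm.lt hk).not.and (hk.lt hm).not).congr fun a => ?_
  congr 1
  rw [Bool.eq_iff_iff]
  simp only [Bool.and_eq_true, Bool.not_eq_true', decide_eq_false_iff_not, decide_eq_true_eq]
  omega

theorem take {τ : α → Type} {et : ∀ a, τ a → Val} {l : ∀ a, List (τ a)}
    (hl : PolyTime inp (fun a => encList (et a) (l a))) (hm : PolyTime inp (fun a => encNat (m a))) :
    PolyTime inp (fun a => encList (et a) ((l a).take (m a))) :=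
  (hl.reverse.drop (hl.length.sub hm)).reverse.congr fun a => by
    congr 1
    rw [List.drop_reverse, List.reverse_reverse]
    rcases le_total (m a) (l a).length with h | h
    · congr 1; omega
    · rw [Nat.sub_eq_zero_of_le h, Nat.sub_zero, List.take_length, List.take_of_length_le h]

/-- The list `0, …, m - 1`. -/
theorem range (hm : PolyTime inp (fun a => encNat (m a))) :
    PolyTime inp (fun a => encList encNat (List.range (m a))) := by
  have key : ∀ i, (fun l : List ℕ => l ++ [l.length])^[i] [] = List.range i := by
    intro i
    induction i with
    | zero => rfl
    | succ i ih => rw [Function.iterate_succ_apply', ih, List.range_succ]; simp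
  refine (natIterate (es := fun a => encList encNat) (init := fun _ => [])
    (step := fun a l => l ++ [l.length]) hm nil
    (append (τ := fun x : Σ _ : α, List ℕ => ℕ) (et := fun x => encNat) psnd
      (psnd.length.pair nil)) ?_).congr fun a => by rw [key]
  obtain ⟨q, hq⟩ := hm.out_size
  refine ⟨q * (2 * q + 2) + 1, fun a i hi => ?_⟩
  rw [key]
  have h1 := hq a
  rw [size_encNat] at h1
  refine (size_encList_le (B := 2 * q.eval (inp a).size + 1) ?_).trans ?_
  · intro j hj
    rw [List.mem_range] at hj
    rw [size_encNat]; omega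
  · simp only [Polynomial.eval_add, Polynomial.eval_mul, Polynomial.eval_one,
      Polynomial.eval_ofNat, List.length_range]
    gcongr ?_ * ?_ + 1 <;> omega

theorem ofFn {N : α → ℕ} {τ : α → Type} {et : ∀ a, τ a → Val} {f : ∀ a, Fin (N a) → τ a}
    (hN : PolyTime inp (fun a => encNat (N a)))
    (hf : PolyTime (fun x : Σ a, Fin (N a) => .pair (inp x.1) (encNat x.2))
      (fun x => et x.1 (f x.1 x.2))) :
    PolyTime inp (fun a => encList (et a) (List.ofFn (f a))) := by
  have hmap : ∀ a, (List.finRange (N a)).map (f a) = List.ofFn (f a) := fun a => by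
    rw [List.ofFn_eq_map]
  refine (map (et := fun a (j : Fin (N a)) => encNat j) (et' := et) (f := f) (l := fun a =>
    List.finRange (N a)) (hN.range.congr fun a => ?_) hf).congr fun a => by rw [hmap]
  have : List.range (N a) = (List.finRange (N a)).map Fin.val := by simp
  rw [this]
  induction List.finRange (N a) with
  | nil => rfl
  | cons x l ih => simp only [List.map_cons, encList, ih]

/-- Lookup in a list of known length. -/
theorem lookup {N : α → ℕ} {τ : α → Type} {et : ∀ a, τ a → Val} {f : ∀ a, Fin (N a) → τ a}
    {j : ∀ a, Fin (N a)} (hf : PolyTime inp (fun a => encList (et a) (List.ofFn (f a))))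
    (hj : PolyTime inp (fun a => encNat (j a))) :
    PolyTime inp (fun a => et a (f a (j a))) := by
  refine (hf.drop hj).caseList (out := fun a => et a (f a (j a))) ?_ (psnd.fst.congr fun x => ?_)
  · refine nil.congr ?_
    rintro ⟨a, ha⟩
    have := congrArg List.length ha
    simp only [List.length_drop, List.length_ofFn, List.length_nil] at this
    have := (j a).2
    omega
  · obtain ⟨⟨a, y, m⟩, h⟩ := x
    have hlt : (j a : ℕ) < (List.ofFn (f a)).length := by simp
    simp only [List.drop_eq_getElem_cons hlt, List.cons.injEq, List.getElem_ofFn] at h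
    simp [← h.1]

end PolyTime
end CliffordPBC
end

noncomputable section
namespace CliffordPBC

/-! ## Algebra of Pauli operators -/

instance : DecidableEq Letter := fun a b => by
  cases a <;> cases b <;> first | exact isTrue rfl | exact isFalse (by simp)

instance : Fintype Letter := ⟨{.I, .X, .Y, .Z}, fun a => by cases a <;> simp⟩

namespace Letter

/-- The product of two one-qubit Paulis up to phase. -/
def mul : Letter → Letter → Letter
  | .I, b => b
  | a, .I => a
  | .X, .X => .I
  | .X, .Y => .Z
  | .X, .Z => .Y
  | .Y, .X => .Z
  | .Y, .Y => .I
  | .Y, .Z => .X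
  | .Z, .X => .Y
  | .Z, .Y => .X
  | .Z, .Z => .I

/-- The power of `i` in the product of two one-qubit Paulis. -/
def phase : Letter → Letter → ZMod 4
  | .X, .Y => 1
  | .Y, .Z => 1
  | .Z, .X => 1
  | .Y, .X => 3
  | .Z, .Y => 3
  | .X, .Z => 3
  | _, _ => 0

/-- `1` for anticommuting and `0` for commuting one-qubit Paulis. -/
def sym (a b : Letter) : ZMod 2 := ZMod.castHom (by norm_num : 2 ∣ 4) (ZMod 2) (phase a b)

theorem sym_mul (a b c : Letter) : sym (mul a b) c = sym a c + sym b c := by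
  revert a b c; decide

theorem sym_comm (a b : Letter) : sym a b = sym b a := by revert a b; decide

theorem sym_self (a : Letter) : sym a a = 0 := by revert a; decide

/-- Non-degeneracy of the form: `X` and `Z` together detect every other letter. It is the reason why
these two suffice as candidates for partners. -/
theorem eq_I_of_sym {a : Letter} (hX : sym a .X = 0) (hZ : sym a .Z = 0) : a = .I := by
  revert a; decide

end Letter

/-- `i ^ a`. -/
def iPow (a : ZMod 4) : ℂ := Complex.I ^ a.val

theorem iPow_add (a b : ZMod 4) : iPow (a + b) = iPow a * iPow b := by
  rw [iPow, iPow, iPow, ← pow_add, ZMod.val_add, ← pow_mod_orderOf]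
  conv_rhs => rw [← pow_mod_orderOf]
  have : orderOf Complex.I = 4 := by
    refine orderOf_eq_prime_pow (p := 2) (n := 1) ?_ ?_ |>.trans (by norm_num)
    · norm_num
    · simp
  rw [this, Nat.mod_mod]

theorem iPow_zero : iPow 0 = 1 := by simp [iPow]

theorem iPow_sum {ι : Type} (s : Finset ι) (f : ι → ZMod 4) :
    iPow (∑ i ∈ s, f i) = ∏ i ∈ s, iPow (f i) := by
  classical
  induction s using Finset.induction_on with
  | empty => simp [iPow_zero]
  | insert a s ha ih => rw [Finset.sum_insert ha, Finset.prod_insert ha, iPow_add, ih]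

theorem Letter.mat_mul (a b : Letter) : a.mat * b.mat = iPow (phase a b) • (mul a b).mat := by
  have h1 : (1 : ZMod 4).val = 1 := rfl
  have h3 : (3 : ZMod 4).val = 3 := rfl
  ext x y
  cases a <;> cases b <;> cases x <;> cases y <;>
    simp [Letter.mat, Letter.phase, Letter.mul, Matrix.mul_apply, iPow, h1, h3, Complex.I_pow_three]

theorem Letter.mat_conjTranspose (a : Letter) : a.matᴴ = a.mat := by
  ext x y
  cases a <;> cases x <;> cases y <;> simp [Letter.mat, Matrix.conjTranspose_apply]

/-! ### Tensor products of one-qubit operators. -/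

section tensorOp

variable {N : ℕ}

theorem tensorOp_mul (A B : Fin N → Matrix Bool Bool ℂ) :
    tensorOp A * tensorOp B = tensorOp fun j => A j * B j := by
  ext x y
  simp only [tensorOp, Matrix.mul_apply, Matrix.of_apply, Finset.prod_univ_sum,
    Fintype.piFinset_univ, Finset.prod_mul_distrib]

theorem tensorOp_smul (c : Fin N → ℂ) (A : Fin N → Matrix Bool Bool ℂ) :
    tensorOp (fun j => c j • A j) = (∏ j, c j) • tensorOp A := by
  ext x y
  simp [tensorOp, Finset.prod_mul_distrib]

theorem tensorOp_one : tensorOp (fun _ : Fin N => (1 : Matrix Bool Bool ℂ)) = 1 := by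
  ext x y
  simp only [tensorOp, Matrix.of_apply, Matrix.one_apply]
  by_cases h : x = y
  · simp [h]
  · obtain ⟨j, hj⟩ := Function.ne_iff.1 h
    rw [if_neg h]
    exact Finset.prod_eq_zero (Finset.mem_univ j) (by simp [hj])

theorem tensorOp_conjTranspose (A : Fin N → Matrix Bool Bool ℂ) :
    (tensorOp A)ᴴ = tensorOp fun j => (A j)ᴴ := by
  ext x y
  simp [tensorOp, Matrix.conjTranspose_apply]

theorem trace_tensorOp (A : Fin N → Matrix Bool Bool ℂ) :
    (tensorOp A).trace = ∏ j, (A j).trace := by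
  simp only [tensorOp, Matrix.trace, Matrix.diag, Matrix.of_apply, Finset.prod_univ_sum,
    Fintype.piFinset_univ]

end tensorOp

/-! ### Signed Paulis, their Hermitian product and the symplectic form. -/

namespace Pauli

variable {N : ℕ}

@[ext] theorem ext' {P Q : Pauli N} (h : P.neg = Q.neg) (h' : P.letter = Q.letter) : P = Q := by
  cases P; cases Q; simp_all

/-- The power of `i` in the product of the unsigned Paulis. -/
def phase (P Q : Pauli N) : ZMod 4 := ∑ j, (P.letter j).phase (Q.letter j)

/-- The symplectic form: `1` for anticommuting and `0` for commuting Paulis. -/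
def sym (P Q : Pauli N) : ZMod 2 := ∑ j, (P.letter j).sym (Q.letter j)

/-- The Hermitian product: `PQ` for commuting and `iPQ` for anticommuting Paulis. -/
def mul (P Q : Pauli N) : Pauli N where
  neg := xor (xor P.neg Q.neg) (decide (phase P Q = 1) || decide (phase P Q = 2))
  letter j := (P.letter j).mul (Q.letter j)

/-- Multiplication by `(-1)^b`. -/
def flip (P : Pauli N) (b : Bool) : Pauli N := ⟨xor P.neg b, P.letter⟩

/-- The unsigned Pauli. -/
def abs (P : Pauli N) : Pauli N := ⟨false, P.letter⟩

/-- A Pauli acting on one line. -/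
def single (i : Fin N) (a : Letter) : Pauli N := ⟨false, Function.update (fun _ => .I) i a⟩

/-- The phase of a product is an odd power of `i` exactly for anticommuting factors. -/
theorem castHom_phase (P Q : Pauli N) :
    ZMod.castHom (by norm_num : 2 ∣ 4) (ZMod 2) (phase P Q) = sym P Q := by
  rw [phase, map_sum]; rfl

theorem sym_eq_one {P Q : Pauli N} : sym P Q = 1 ↔ sym P Q ≠ 0 := by
  generalize sym P Q = x; revert x; decide

theorem sym_mul_left (P P' Q : Pauli N) : sym (mul P P') Q = sym P Q + sym P' Q := by
  simp only [sym, mul, Letter.sym_mul, Finset.sum_add_distrib]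

theorem sym_comm (P Q : Pauli N) : sym P Q = sym Q P := by
  simp only [sym]
  exact Finset.sum_congr rfl fun j _ => Letter.sym_comm _ _

theorem sym_self (P : Pauli N) : sym P P = 0 := by simp [sym, Letter.sym_self]

@[simp] theorem sym_flip_left (P Q : Pauli N) (b : Bool) : sym (P.flip b) Q = sym P Q := rfl

@[simp] theorem sym_flip_right (P Q : Pauli N) (b : Bool) : sym P (Q.flip b) = sym P Q := rfl

@[simp] theorem letter_flip (P : Pauli N) (b : Bool) : (P.flip b).letter = P.letter := rfl

theorem sym_congr {P P' Q Q' : Pauli N} (h : P.letter = P'.letter) (h' : Q.letter = Q'.letter) :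
    sym P Q = sym P' Q' := by simp only [sym, h, h']

theorem sym_single (P : Pauli N) (i : Fin N) (a : Letter) :
    sym P (single i a) = (P.letter i).sym a := by
  rw [sym, Finset.sum_eq_single i]
  · simp [single]
  · intro j _ hj
    simp only [single, Function.update_of_ne hj]
    generalize P.letter j = b; revert b; decide
  · simp

theorem op_flip (P : Pauli N) (b : Bool) : (P.flip b).op = (if b then -1 else 1 : ℂ) • P.op := by
  cases b <;> cases h : P.neg <;> simp [flip, op, h]

/-- An even power `i ^ e` is a sign, and an odd one becomes a sign after multiplication by `i`. The
sign is `-1` exactly for `e = 1` and `e = 2`, the two cases in the definition of `mul`. -/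
theorem op_mul (P Q : Pauli N) :
    (mul P Q).op = (if sym P Q = 0 then 1 else Complex.I) • (P.op * Q.op) := by
  have hp := castHom_phase P Q
  have h1 : P.op * Q.op = ((if P.neg then -1 else 1 : ℂ) * (if Q.neg then -1 else 1 : ℂ) *
      iPow (phase P Q)) • tensorOp fun j => ((P.letter j).mul (Q.letter j)).mat := by
    simp only [op, Matrix.smul_mul, Matrix.mul_smul, tensorOp_mul, Letter.mat_mul, tensorOp_smul,
      smul_smul, phase, iPow_sum]
    ring_nf
  rw [h1, op, smul_smul, ← hp]
  congr 1
  simp only [mul]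
  have k1 : (1 : ZMod 4).val = 1 := rfl
  have k2 : (2 : ZMod 4).val = 2 := rfl
  have k3 : (3 : ZMod 4).val = 3 := rfl
  have c2 : (ZMod.cast (2 : ZMod 4) : ZMod 2) = 0 := by decide
  have c3 : ¬ (ZMod.cast (3 : ZMod 4) : ZMod 2) = 0 := by decide
  have d1 : ¬ (0 : ZMod 4) = 1 := by decide
  have d2 : ¬ (0 : ZMod 4) = 2 := by decide
  have d3 : ¬ (2 : ZMod 4) = 1 := by decide
  have d4 : ¬ (3 : ZMod 4) = 1 := by decide
  have d5 : ¬ (3 : ZMod 4) = 2 := by decide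
  have he : ∀ e : ZMod 4, e = 0 ∨ e = 1 ∨ e = 2 ∨ e = 3 := by decide
  have key : ∀ (a b : Bool) (e : ZMod 4),
      (if xor (xor a b) (decide (e = 1) || decide (e = 2)) then -1 else 1 : ℂ) =
      (if ZMod.castHom (by norm_num : 2 ∣ 4) (ZMod 2) e = 0 then 1 else Complex.I) *
        ((if a then -1 else 1) * (if b then -1 else 1) * iPow e) := by
    intro a b e
    rcases he e with rfl | rfl | rfl | rfl
    · cases a <;> cases b <;> simp [iPow_zero, d1, d2]
    · cases a <;> cases b <;> simp [iPow, k1]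
    · cases a <;> cases b <;> simp [iPow, k2, c2]
    · cases a <;> cases b <;> simp [iPow, k3, c3, d4, d5, Complex.I_pow_three]
  exact key _ _ _

theorem op_mul_self (P : Pauli N) : P.op * P.op = 1 := by
  have h : ∀ a : Letter, a.mat * a.mat = 1 := by
    intro a; rw [Letter.mat_mul]; cases a <;> simp [Letter.phase, Letter.mul, iPow_zero, Letter.mat]
  simp only [op, Matrix.smul_mul, Matrix.mul_smul, tensorOp_mul, h, tensorOp_one, smul_smul]
  cases P.neg <;> simp

theorem op_conjTranspose (P : Pauli N) : P.opᴴ = P.op := by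
  simp only [op, Matrix.conjTranspose_smul, tensorOp_conjTranspose, Letter.mat_conjTranspose]
  cases P.neg <;> simp

/-- Take adjoints in `op_mul`: its left side is Hermitian, so either `PQ = QP` or `iPQ = -iQP`. -/
theorem op_mul_comm (P Q : Pauli N) :
    P.op * Q.op = (if sym P Q = 0 then 1 else -1 : ℂ) • (Q.op * P.op) := by
  have h := op_conjTranspose (mul P Q)
  rw [op_mul, Matrix.conjTranspose_smul, Matrix.conjTranspose_mul, op_conjTranspose,
    op_conjTranspose] at h
  split_ifs at h ⊢ with hs
  · simpa using h.symm
  · have := congrArg (fun A => (-Complex.I) • A) h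
    simp only [smul_smul] at this
    simpa using this.symm

theorem op_commute {P Q : Pauli N} (h : sym P Q = 0) : P.op * Q.op = Q.op * P.op := by
  rw [op_mul_comm, if_pos h, one_smul]

theorem op_anticommute {P Q : Pauli N} (h : sym P Q ≠ 0) : P.op * Q.op = -(Q.op * P.op) := by
  rw [op_mul_comm, if_neg h, neg_one_smul]

theorem op_mul_of_commute {P Q : Pauli N} (h : sym P Q = 0) : (mul P Q).op = P.op * Q.op := by
  rw [op_mul, if_pos h, one_smul]

theorem op_single (i : Fin N) (a : Letter) : (single i a).op = onLine i a.mat := by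
  simp only [op, single, onLine, Bool.false_eq_true, if_false, one_smul]
  congr 1
  ext j x y
  by_cases h : j = i
  · subst h; simp
  · simp [Function.update_of_ne h, Letter.mat]

theorem op_one {P : Pauli N} (h : ∀ j, P.letter j = .I) :
    P.op = (if P.neg then -1 else 1 : ℂ) • 1 := by
  simp only [op, h, Letter.mat, tensorOp_one]

end Pauli

/-! ### Composite systems -/

section tensorState

variable {n t : ℕ}

theorem tensorState_eq (σ : Op n) (ρ : Op t) :
    tensorState σ ρ = (Matrix.kroneckerMap (· * ·) σ ρ).submatrix
      (Fin.appendEquiv n t).symm (Fin.appendEquiv n t).symm := rfl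

theorem tensorState_mul (σ σ' : Op n) (ρ ρ' : Op t) :
    tensorState σ ρ * tensorState σ' ρ' = tensorState (σ * σ') (ρ * ρ') := by
  simp only [tensorState_eq, Matrix.submatrix_mul_equiv]
  rw [← Matrix.mul_kronecker_mul]

theorem trace_tensorState (σ : Op n) (ρ : Op t) :
    (tensorState σ ρ).trace = σ.trace * ρ.trace := by
  rw [← Matrix.trace_kronecker, tensorState_eq]
  exact Equiv.sum_comp (Fin.appendEquiv n t).symm
    fun i => Matrix.diag (Matrix.kroneckerMap (· * ·) σ ρ) i

theorem tensorState_smul_left (c : ℂ) (σ : Op n) (ρ : Op t) :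
    tensorState (c • σ) ρ = c • tensorState σ ρ := by
  ext; simp [tensorState, mul_assoc]

theorem tensorState_smul_right (c : ℂ) (σ : Op n) (ρ : Op t) :
    tensorState σ (c • ρ) = c • tensorState σ ρ := by
  ext; simp [tensorState]; ring

theorem tensorState_one : tensorState (1 : Op n) (1 : Op t) = 1 := by
  rw [tensorState_eq, Matrix.kroneckerMap_one_one _ (by simp) (by simp) (by simp)]
  simp

theorem tensorState_add_left (σ σ' : Op n) (ρ : Op t) :
    tensorState (σ + σ') ρ = tensorState σ ρ + tensorState σ' ρ := by
  ext; simp [tensorState, add_mul]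

theorem tensorOp_eq_tensorState (A : Fin (n + t) → Matrix Bool Bool ℂ) :
    tensorOp A = tensorState (tensorOp fun i => A (Fin.castAdd t i))
      (tensorOp fun j => A (Fin.natAdd n j)) := by
  ext x y
  simp [tensorOp, tensorState, Fin.prod_univ_add]

end tensorState

/-! ### Restriction of Paulis to the first and to the last lines. -/

namespace Pauli

variable {n t : ℕ}

/-- The part of a Pauli on the first lines, without sign. -/
def head (P : Pauli (n + t)) : Pauli n := ⟨false, fun i => P.letter (Fin.castAdd t i)⟩

/-- The part of a Pauli on the last lines, with its sign. -/
def tail (P : Pauli (n + t)) : Pauli t := ⟨P.neg, fun j => P.letter (Fin.natAdd n j)⟩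

/-- Trivial action on the first lines. -/
def HeadTrivial (P : Pauli (n + t)) : Prop := ∀ i : Fin n, P.letter (Fin.castAdd t i) = .I

/-- Trivial action on the last lines. -/
def TailTrivial (P : Pauli (n + t)) : Prop := ∀ j : Fin t, P.letter (Fin.natAdd n j) = .I

/-- A Pauli on the first lines as an operator on all lines. -/
def extend (t : ℕ) (P : Pauli n) : Pauli (n + t) := ⟨P.neg, Fin.append P.letter fun _ => .I⟩

theorem op_eq_tensorState (P : Pauli (n + t)) : P.op = tensorState P.head.op P.tail.op := by
  simp only [op, head, tail, tensorOp_eq_tensorState (n := n) (t := t), tensorState_smul_right,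
    Bool.false_eq_true, if_false, one_smul]
  rfl

theorem op_extend (P : Pauli n) : (P.extend t).op = tensorState P.op 1 := by
  simp only [op, extend, tensorOp_eq_tensorState (n := n) (t := t), Fin.append_left,
    Fin.append_right, tensorState_smul_left]
  congr 2
  exact tensorOp_one

theorem sym_eq_head_add_tail (P Q : Pauli (n + t)) :
    sym P Q = sym P.head Q.head + sym P.tail Q.tail := by
  simp only [sym, head, tail, Fin.sum_univ_add]

theorem sym_head_eq_zero {P Q : Pauli (n + t)} (h : P.HeadTrivial) : sym P.head Q.head = 0 := by
  refine Finset.sum_eq_zero fun i _ => ?_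
  simp only [head, h i]
  generalize Q.letter _ = b; revert b; decide

theorem sym_tail_eq_zero {P Q : Pauli (n + t)} (h : P.TailTrivial) : sym P.tail Q.tail = 0 := by
  refine Finset.sum_eq_zero fun i _ => ?_
  simp only [tail, h i]
  generalize Q.letter _ = b; revert b; decide

theorem sym_of_headTrivial {P Q : Pauli (n + t)} (h : P.HeadTrivial) :
    sym P Q = sym P.tail Q.tail := by
  rw [sym_eq_head_add_tail, sym_head_eq_zero h, zero_add]

theorem sym_of_tailTrivial {P Q : Pauli (n + t)} (h : P.TailTrivial) :
    sym P Q = sym P.head Q.head := by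
  rw [sym_eq_head_add_tail, sym_tail_eq_zero h, add_zero]

theorem sym_head_tail {P Q : Pauli (n + t)} (h : P.TailTrivial) (h' : Q.HeadTrivial) :
    sym P Q = 0 := by
  rw [sym_of_tailTrivial h, sym_comm, sym_head_eq_zero h']

theorem TailTrivial.mul {P Q : Pauli (n + t)} (h : P.TailTrivial) (h' : Q.TailTrivial) :
    (Pauli.mul P Q).TailTrivial := fun i => by simp [Pauli.mul, h i, h' i, Letter.mul]

theorem letter_mul_eq_I {a b : Letter} : a.mul b = .I ↔ a = b := by revert a b; decide

theorem headTrivial_mul_iff {P Q : Pauli (n + t)} (h' : Q.HeadTrivial) :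
    (Pauli.mul P Q).HeadTrivial ↔ P.HeadTrivial := by
  simp only [HeadTrivial, Pauli.mul, letter_mul_eq_I]
  exact forall_congr' fun i => by rw [h' i]

theorem tail_mul {P Q : Pauli (n + t)} (h : Q.HeadTrivial) :
    (Pauli.mul P Q).tail = Pauli.mul P.tail Q.tail := by
  have hph : phase P Q = phase P.tail Q.tail := by
    simp only [phase, Fin.sum_univ_add, tail]
    rw [Finset.sum_eq_zero, zero_add]
    intro i _
    rw [h i]
    generalize P.letter _ = b; revert b; decide
  refine Pauli.ext' ?_ rfl
  simp only [Pauli.mul, ← hph]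
  rfl

theorem op_of_headTrivial {P : Pauli (n + t)} (h : P.HeadTrivial) :
    P.op = tensorState 1 P.tail.op := by
  rw [op_eq_tensorState, op_one (P := P.head) (by exact h)]
  simp [head]

@[simp] theorem tail_flip (P : Pauli (n + t)) (b : Bool) : (P.flip b).tail = P.tail.flip b := rfl

end Pauli

end CliffordPBC
end

noncomputable section
namespace CliffordPBC

/-! ## Processes -/

/-! ### Total mass of a distribution. -/

section mass

theorem mass_add (D D' : Dist) : mass (D + D') = mass D + mass D' :=
  Finsupp.sum_add_index' (by simp) (by simp)

theorem mass_smul (c : ℝ) (D : Dist) : mass (c • D) = c * mass D := by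
  rw [mass, Finsupp.sum_smul_index (by simp), mass, Finsupp.mul_sum]

theorem mass_single (o : List Bool) (p : ℝ) : mass (Finsupp.single o p) = p :=
  Finsupp.sum_single_index rfl

theorem mass_mapDomain (f : List Bool → List Bool) (D : Dist) :
    mass (D.mapDomain f) = mass D :=
  Finsupp.sum_mapDomain_index (by simp) (by simp)

end mass

/-! ### Projective measurement of an involution. -/

section collapse

variable {N : ℕ} {M A : Op N}

/-- The projector onto outcome `b` of a measurement of `M`. -/
def eigenproj (M : Op N) (b : Bool) : Op N :=
  (1 / 2 : ℂ) • (1 + (if b then -1 else 1 : ℂ) • M)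

theorem collapse_eq (M : Op N) (b : Bool) (A : Op N) :
    collapse M b A = eigenproj M b * A * eigenproj M b := rfl

theorem eigenproj_conjTranspose (h : Mᴴ = M) (b : Bool) : (eigenproj M b)ᴴ = eigenproj M b := by
  cases b <;> simp [eigenproj, Matrix.conjTranspose_smul, h]

theorem eigenproj_mul_self (h : M * M = 1) (b : Bool) :
    eigenproj M b * eigenproj M b = eigenproj M b := by
  cases b <;>
  · simp only [eigenproj, Matrix.smul_mul, Matrix.mul_smul, add_mul, mul_add, one_mul, mul_one, h,
      if_true, Bool.false_eq_true, if_false, smul_smul, smul_add]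
    module

theorem collapse_smul (c : ℂ) (b : Bool) : collapse M b (c • A) = c • collapse M b A := by
  simp [collapse_eq]

theorem collapse_posSemidef (h : Mᴴ = M) (hA : A.PosSemidef) (b : Bool) :
    (collapse M b A).PosSemidef := by
  rw [collapse_eq]
  nth_rw 2 [← eigenproj_conjTranspose h b]
  exact hA.mul_mul_conjTranspose_same _

theorem trace_collapse (h : M * M = 1) (b : Bool) :
    (collapse M b A).trace = (1 / 2) * (A.trace + (if b then -1 else 1) * (M * A).trace) := by
  rw [collapse_eq, Matrix.trace_mul_comm, ← mul_assoc, eigenproj_mul_self h]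
  cases b <;> simp [eigenproj, add_mul] <;> ring

theorem trace_collapse_add (h : M * M = 1) :
    (collapse M false A).trace + (collapse M true A).trace = A.trace := by
  rw [trace_collapse h, trace_collapse h]
  simp only [if_true, Bool.false_eq_true, if_false]
  ring

theorem trace_eq_re (hA : A.PosSemidef) : A.trace = (A.trace.re : ℂ) := by
  have := hA.trace_nonneg
  rw [Complex.le_def] at this
  exact Complex.ext rfl (by simpa using this.2.symm)

theorem trace_re_nonneg (hA : A.PosSemidef) : 0 ≤ A.trace.re := by
  have := hA.trace_nonneg
  rw [Complex.le_def] at this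
  simpa using this.1

theorem eq_zero_of_trace_re (hA : A.PosSemidef) (h : A.trace.re = 0) : A = 0 :=
  hA.trace_eq_zero_iff.1 (by rw [trace_eq_re hA, h]; simp)

theorem smul_posSemidef (hA : A.PosSemidef) {c : ℝ} (hc : 0 ≤ c) : ((c : ℂ) • A).PosSemidef :=
  hA.smul (by exact_mod_cast hc)

/-- The renormalised state after postselection onto outcome `+1`. -/
theorem renormalize_eq (h : Mᴴ = M) (hA : A.PosSemidef) :
    (A.trace / (collapse M false A).trace) • collapse M false A =
      ((A.trace.re / (collapse M false A).trace.re : ℝ) : ℂ) • collapse M false A := by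
  rw [trace_eq_re hA, trace_eq_re (collapse_posSemidef h hA false)]
  push_cast
  simp

end collapse

/-! ### Linearity, loss of mass and postselection in processes. -/

section process

variable {N : ℕ}

/-- All gates are unitary and all observables are Hermitian with square `1`. -/
def Action.Proper : Action N → Prop
  | .gate U => Uᴴ * U = 1
  | .measure M _ => Mᴴ = M ∧ M * M = 1
  | .halt => True

/-- The quotient of traces in a renormalisation does not change when the state is scaled; for `c =
0` both sides vanish. -/
theorem runStepwise_smul (act : ℕ → List Bool → Action N) (f k : ℕ) (o : List Bool) (c : ℝ)
    (A : Op N) :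
    runStepwise act f k o ((c : ℂ) • A) = c • runStepwise act f k o A := by
  induction f generalizing k o A c with
  | zero => simp [runStepwise]
  | succ f ih =>
    simp only [runStepwise]
    rcases act k o with U | ⟨M, _ | _⟩ | _
    · simp only [Matrix.mul_smul, Matrix.smul_mul, ih]
    · simp only [Bool.false_eq_true, if_false, collapse_smul, ih, smul_add]
    · simp only [if_true, collapse_smul, Matrix.trace_smul]
      rw [← ih]
      congr 1
      by_cases hc : (c : ℂ) = 0
      · simp [hc]
      · rw [smul_smul, smul_smul, smul_eq_mul, smul_eq_mul, mul_div_mul_left _ _ hc, mul_comm]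
    · simp

theorem run_smul (act : ℕ → List Bool → Action N) (f k : ℕ) (o : List Bool) (c : ℝ)
    (A : Op N) :
    run act f k o ((c : ℂ) • A) = c • run act f k o A := by
  induction f generalizing k o A c with
  | zero => simp [run]
  | succ f ih =>
    simp only [run]
    rcases act k o with U | ⟨M, _ | _⟩ | _
    · simp only [Matrix.mul_smul, Matrix.smul_mul, ih]
    · simp only [Bool.false_eq_true, if_false, collapse_smul, ih, smul_add]
    · simp only [if_true, collapse_smul, ih, add_zero]
    · simp

theorem runStepwise_zero (act : ℕ → List Bool → Action N) (f k : ℕ) (o : List Bool) :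
    runStepwise act f k o 0 = 0 := by
  simpa using runStepwise_smul act f k o 0 0

theorem run_zero (act : ℕ → List Bool → Action N) (f k : ℕ) (o : List Bool) :
    run act f k o 0 = 0 := by
  simpa using run_smul act f k o 0 0

/-- The record enters the dynamics only through `act`, so a common prefix can be absorbed into
`act`. This splits a PBC run after its first outcome. -/
theorem runStepwise_append (act : ℕ → List Bool → Action N) (f k : ℕ) (o o' : List Bool)
    (A : Op N) :
    runStepwise act f k (o ++ o') A =
      (runStepwise (fun k x => act k (o ++ x)) f k o' A).mapDomain (o ++ ·) := by
  induction f generalizing k o' A with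
  | zero => simp [runStepwise]
  | succ f ih =>
    simp only [runStepwise]
    rcases act k (o ++ o') with U | ⟨M, _ | _⟩ | _
    · simp only [ih]
    · simp only [Bool.false_eq_true, if_false, List.append_assoc, ih, Finsupp.mapDomain_add]
    · simp only [if_true, List.append_assoc, ih]
    · simp

theorem runStepwise_congr_step (g : List Bool → Action N) (f k k' : ℕ) (o : List Bool)
    (A : Op N) :
    runStepwise (fun _ => g) f k o A = runStepwise (fun _ => g) f k' o A := by
  induction f generalizing k k' o A with
  | zero => rfl
  | succ f ih =>
    simp only [runStepwise]
    rcases g o with U | ⟨M, _ | _⟩ | _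
    · simp only [ih (k + 1) (k' + 1)]
    · simp only [ih (k + 1) (k' + 1)]
    · simp only [ih (k + 1) (k' + 1)]
    · rfl

variable {act : ℕ → List Bool → Action N} (hact : ∀ k o, (act k o).Proper)

include hact

omit hact in
theorem trace_gate {U : Op N} (hU : (Action.gate U).Proper) (A : Op N) :
    (U * A * Uᴴ).trace = A.trace := by
  rw [Matrix.trace_mul_comm, ← mul_assoc, (show Uᴴ * U = 1 from hU), one_mul]

/-- Mass is lost only at a postselected outcome of trace zero, where the renormalising factor is `0`
by the convention for division by zero. -/
theorem mass_runStepwise_le (f k : ℕ) (o : List Bool) {A : Op N} (hA : A.PosSemidef) :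
    mass (runStepwise act f k o A) ≤ A.trace.re := by
  induction f generalizing k o A with
  | zero => simp [runStepwise, mass_single]
  | succ f ih =>
    have hp := hact k o
    simp only [runStepwise]
    rcases h : act k o with U | ⟨M, _ | _⟩ | _ <;> rw [h] at hp
    · refine (ih _ _ (hA.mul_mul_conjTranspose_same U)).trans ?_
      rw [trace_gate hp]
    · have h0 := ih (k + 1) (o ++ [false]) (collapse_posSemidef hp.1 hA false)
      have h1 := ih (k + 1) (o ++ [true]) (collapse_posSemidef hp.1 hA true)
      have := congrArg Complex.re (trace_collapse_add (A := A) hp.2)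
      simp only [Bool.false_eq_true, if_false, mass_add, Complex.add_re] at *
      linarith
    · have hA' := collapse_posSemidef hp.1 hA false
      simp only [if_true, renormalize_eq hp.1 hA, runStepwise_smul, mass_smul]
      have h0 := trace_re_nonneg hA
      rcases (trace_re_nonneg hA').eq_or_lt with h' | h'
      · rw [← h', div_zero, zero_mul]; exact h0
      · refine (mul_le_mul_of_nonneg_left (ih _ _ hA') (div_nonneg h0 h'.le)).trans ?_
        rw [div_mul_cancel₀ _ h'.ne']
    · simp [mass_single]

/-- Without postselection both kinds of dynamics agree and preserve the trace. -/
theorem run_of_no_post (f k : ℕ) (o : List Bool) (A : Op N)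
    (hpost : ∀ k' o' M, k ≤ k' → o <+: o' → act k' o' ≠ .measure M true) :
    runStepwise act f k o A = run act f k o A ∧ mass (run act f k o A) = A.trace.re := by
  induction f generalizing k o A with
  | zero => simp [runStepwise, run, mass_single]
  | succ f ih =>
    have hp := hact k o
    simp only [runStepwise, run]
    rcases h : act k o with U | ⟨M, _ | _⟩ | _ <;> rw [h] at hp
    · obtain ⟨h1, h2⟩ := ih (k + 1) o (U * A * Uᴴ)
        fun k' o' M hk ho => hpost k' o' M (by omega) ho
      exact ⟨h1, by rw [h2, trace_gate hp]⟩
    · have hb := fun b => ih (k + 1) (o ++ [b]) (collapse M b A)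
        fun k' o' M hk ho => hpost k' o' M (by omega) ((List.prefix_append _ _).trans ho)
      have := congrArg Complex.re (trace_collapse_add (A := A) hp.2)
      simp only [Bool.false_eq_true, if_false, mass_add, (hb _).1, (hb _).2, Complex.add_re] at *
      exact ⟨trivial, this⟩
    · exact absurd h (hpost k o M le_rfl (List.prefix_refl _))
    · simp [mass_single]

omit hact in
/-- No postselected measurement is made after one that is not postselected. -/
def PostFirst (act : ℕ → List Bool → Action N) : Prop :=
  ∀ k o M, act k o = .measure M false →
    ∀ k' o' M', k < k' → o <+: o' → act k' o' ≠ .measure M' true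

/-- While measurements are postselected, both dynamics follow a single branch and differ by a
scalar; afterwards both are linear and lose nothing. The total mass then fixes the scalar. -/
theorem runStepwise_of_postFirst (hpf : PostFirst act) (f k : ℕ) (o : List Bool) {A : Op N}
    (hA : A.PosSemidef) :
    runStepwise act f k o A =
      (A.trace.re / mass (run act f k o A)) • run act f k o A := by
  -- For trace zero the quotient is not `1`, but then `D` vanishes as well.
  have triv : ∀ {D : Dist} {A : Op N}, (A.trace.re = 0 → D = 0) → mass D = A.trace.re →
      D = (A.trace.re / mass D) • D := by
    intro D A h0 hm
    by_cases h : A.trace.re = 0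
    · rw [h0 h, smul_zero]
    · rw [hm, div_self h, one_smul]
  have base : ∀ (o : List Bool) {A : Op N},
      (Finsupp.single o A.trace.re : Dist) =
      (A.trace.re / mass (Finsupp.single o A.trace.re)) • Finsupp.single o A.trace.re :=
    fun o A => triv (fun h => by simp [h]) (mass_single _ _)
  induction f generalizing k o A with
  | zero => exact base o
  | succ f ih =>
    have hp := hact k o
    simp only [runStepwise, run]
    rcases h : act k o with U | ⟨M, _ | _⟩ | _ <;> rw [h] at hp
    · simp only
      rw [ih _ _ (hA.mul_mul_conjTranspose_same U), trace_gate hp]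
    · have hb := fun b => run_of_no_post hact f (k + 1) (o ++ [b]) (collapse M b A)
        fun k' o' M' hk ho => hpf k o M h k' o' M' (by omega) ((List.prefix_append _ _).trans ho)
      have := congrArg Complex.re (trace_collapse_add (A := A) hp.2)
      simp only [Bool.false_eq_true, if_false, (hb _).1]
      refine triv (fun h0 => ?_) ?_
      · have hz := eq_zero_of_trace_re hA h0
        simp [hz, collapse_eq, run_zero]
      · rw [mass_add, (hb _).2, (hb _).2, ← Complex.add_re, this]
    · have hA' := collapse_posSemidef hp.1 hA false
      simp only [if_true, renormalize_eq hp.1 hA, runStepwise_smul, add_zero]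
      rcases (trace_re_nonneg hA').eq_or_lt with h' | h'
      · rw [eq_zero_of_trace_re hA' h'.symm, run_zero, runStepwise_zero, smul_zero, smul_zero]
      · rw [ih _ _ hA', smul_smul, div_mul_div_cancel₀ h'.ne']
    · exact base o

end process

end CliffordPBC
end

noncomputable section
namespace CliffordPBC

/-! ## Clifford rotations -/

section rotations

variable {N : ℕ}

/-- The Clifford unitary `(1 + iP)/√2`. -/
def rot (P : Pauli N) : Op N := (1 / (Real.sqrt 2 : ℂ)) • (1 + Complex.I • P.op)

theorem sqrt_two_mul_self : ((Real.sqrt 2 : ℝ) : ℂ) * (Real.sqrt 2 : ℝ) = 2 := by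
  rw [← Complex.ofReal_mul, Real.mul_self_sqrt (by norm_num)]; simp

theorem sqrt_two_ne_zero : ((Real.sqrt 2 : ℝ) : ℂ) ≠ 0 := by
  intro h
  have := sqrt_two_mul_self
  rw [h] at this
  norm_num at this

theorem inv_sqrt_two_mul_self : (1 / ((Real.sqrt 2 : ℝ) : ℂ)) * (1 / (Real.sqrt 2 : ℝ)) = 1 / 2 := by
  rw [div_mul_div_comm, sqrt_two_mul_self, one_mul]

theorem rot_conjTranspose (P : Pauli N) :
    (rot P)ᴴ = (1 / (Real.sqrt 2 : ℂ)) • (1 - Complex.I • P.op) := by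
  simp [rot, Matrix.conjTranspose_smul, Pauli.op_conjTranspose, sub_eq_add_neg]

theorem rot_star_mul (P : Pauli N) : (rot P)ᴴ * rot P = 1 := by
  rw [rot_conjTranspose, rot, smul_mul_smul_comm, inv_sqrt_two_mul_self]
  simp only [Matrix.smul_mul, Matrix.mul_smul, smul_smul, sub_mul, mul_add,
    one_mul, mul_one, Pauli.op_mul_self, Complex.I_mul_I]
  module

/-- Conjugation of a Pauli by a rotation. -/
def Pauli.conj (M P : Pauli N) : Pauli N := if M.sym P = 1 then M.mul P else M

/-- The product is `(M + iMP - iPM + PMP)/2`. If `M` and `P` anticommute, the outer terms cancel and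
`iMP` remains; if they commute, the inner ones cancel and `M` remains. -/
theorem rot_conj (M P : Pauli N) : (rot P)ᴴ * M.op * rot P = (M.conj P).op := by
  rw [rot_conjTranspose, rot, Pauli.conj, Matrix.smul_mul, smul_mul_smul_comm,
    inv_sqrt_two_mul_self]
  split_ifs with h
  · rw [Pauli.sym_eq_one] at h
    have h' := Pauli.op_anticommute h
    have h3 : P.op * M.op = -(M.op * P.op) := by rw [h', neg_neg]
    have h2 : M.op * P.op * P.op = M.op := by rw [mul_assoc, Pauli.op_mul_self, mul_one]
    rw [Pauli.op_mul, if_neg h]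
    simp only [Matrix.smul_mul, Matrix.mul_smul, smul_smul, sub_mul, mul_add,
      one_mul, mul_one, h3, neg_mul, h2, Complex.I_mul_I, smul_neg]
    module
  · have h0 : M.sym P = 0 := by
      by_contra h0; exact h (Pauli.sym_eq_one.2 h0)
    have h' := Pauli.op_commute h0
    have h2 : P.op * M.op * P.op = M.op := by
      rw [mul_assoc, h', ← mul_assoc, Pauli.op_mul_self, one_mul]
    simp only [Matrix.smul_mul, Matrix.mul_smul, smul_smul, sub_mul, mul_add,
      one_mul, mul_one, h2, h', Complex.I_mul_I]
    module

/-- The product of a list of rotations. -/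
def frameOp (l : List (Pauli N)) : Op N := (l.map rot).prod

/-- A Pauli conjugated by a product of rotations. -/
def pull (l : List (Pauli N)) (M : Pauli N) : Pauli N := l.foldl Pauli.conj M

theorem frameOp_append (l l' : List (Pauli N)) : frameOp (l ++ l') = frameOp l * frameOp l' := by
  simp [frameOp]

theorem frameOp_star_mul (l : List (Pauli N)) : (frameOp l)ᴴ * frameOp l = 1 := by
  induction l with
  | nil => simp [frameOp]
  | cons h l ih =>
    have : frameOp (h :: l) = rot h * frameOp l := by simp [frameOp]
    rw [this, Matrix.conjTranspose_mul, mul_assoc, ← mul_assoc _ (rot h), rot_star_mul, one_mul, ih]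

theorem frameOp_mul_star (l : List (Pauli N)) : frameOp l * (frameOp l)ᴴ = 1 :=
  mul_eq_one_comm.1 (frameOp_star_mul l)

theorem frameOp_conj (l : List (Pauli N)) (M : Pauli N) :
    (frameOp l)ᴴ * M.op * frameOp l = (pull l M).op := by
  induction l generalizing M with
  | nil => simp [frameOp, pull]
  | cons h l ih =>
    have : frameOp (h :: l) = rot h * frameOp l := by simp [frameOp]
    rw [this, Matrix.conjTranspose_mul, pull, List.foldl_cons, ← pull, ← ih, ← rot_conj]
    simp only [mul_assoc]

end rotations

/-! ### Clifford gates as products of rotations -/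

section gates

variable {N : ℕ}

theorem onLine_apply (i : Fin N) (A : Matrix Bool Bool ℂ) (x y : Fin N → Bool) :
    onLine i A x y = if ∀ j, j ≠ i → x j = y j then A (x i) (y i) else 0 := by
  simp only [onLine, tensorOp, Matrix.of_apply]
  rw [← Finset.mul_prod_erase _ _ (Finset.mem_univ i), Function.update_self]
  split_ifs with h
  · rw [Finset.prod_eq_one, mul_one]
    intro j hj
    have hj := Finset.ne_of_mem_erase hj
    rw [Function.update_of_ne hj, h j hj, Matrix.one_apply_eq]
  · push Not at h
    obtain ⟨j, hj, hxy⟩ := h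
    rw [Finset.prod_eq_zero (i := j) (by simp [hj]), mul_zero]
    rw [Function.update_of_ne hj, Matrix.one_apply_ne hxy]

theorem onLine_add (i : Fin N) (A B : Matrix Bool Bool ℂ) :
    onLine i (A + B) = onLine i A + onLine i B := by
  ext x y
  simp only [onLine_apply, Matrix.add_apply]
  split_ifs <;> simp

theorem onLine_smul (i : Fin N) (c : ℂ) (A : Matrix Bool Bool ℂ) :
    onLine i (c • A) = c • onLine i A := by
  ext x y
  simp only [onLine_apply, Matrix.smul_apply]
  split_ifs <;> simp

theorem onLine_one (i : Fin N) : onLine i 1 = 1 := by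
  rw [onLine, Function.update_eq_self_iff.2 rfl, tensorOp_one]

theorem onLine_mul (i : Fin N) (A B : Matrix Bool Bool ℂ) :
    onLine i A * onLine i B = onLine i (A * B) := by
  rw [onLine, onLine, tensorOp_mul, onLine]
  congr 1
  ext1 j
  by_cases h : j = i
  · subst h; simp
  · simp [Function.update_of_ne h]

theorem rot_single (i : Fin N) (a : Letter) :
    rot (.single i a) =
      onLine i ((1 / (Real.sqrt 2 : ℂ)) • (1 + Complex.I • a.mat)) := by
  rw [rot, Pauli.op_single, onLine_smul, onLine_add, onLine_smul, onLine_one]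

theorem op_single_Z_apply (i : Fin N) (x y : Fin N → Bool) :
    (Pauli.single i .Z).op x y = if x = y then (if x i then -1 else 1) else 0 := by
  rw [Pauli.op_single, onLine_apply]
  by_cases h : x = y
  · subst h; simp [Letter.mat]
  · rw [if_neg h]
    split_ifs with h'
    · have : x i ≠ y i := fun hi => h (funext fun j => by
        by_cases hj : j = i
        · rw [hj, hi]
        · exact h' j hj)
      simp [Letter.mat, this]
    · rfl

theorem op_single_X_apply (i : Fin N) (x y : Fin N → Bool) :
    (Pauli.single i .X).op x y = if x = Function.update y i (!y i) then 1 else 0 := by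
  rw [Pauli.op_single, onLine_apply]
  by_cases h : x = Function.update y i (!y i)
  · rw [if_pos h, if_pos fun j hj => by rw [h, Function.update_of_ne hj]]
    simp [Letter.mat, h]
  · rw [if_neg h]
    split_ifs with h'
    · have : x i = y i := by
        by_contra hi
        refine h (funext fun j => ?_)
        by_cases hj : j = i
        · subst hj; rw [Function.update_self]; cases h1 : x j <;> cases h2 : y j <;> simp_all
        · rw [Function.update_of_ne hj, h' j hj]
      simp [Letter.mat, this]
    · rfl

/-- A list of rotations whose product is the gate of a step up to phase. -/
def Step.frame : Step N → List (Pauli N)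
  -- The square of the rotation about `Z` is `iZ`, and `iZY = X`; so the product is `i(Z + X)/√2`.
  | .H i => [.single i .Z, .single i .Z, .single i .Y]
  | .S i => [(Pauli.single i .Z).flip true]
  | .CX c d _ => [(Pauli.single c .Z).flip true, (Pauli.single d .X).flip true,
      (Pauli.single c .Z).mul (.single d .X)]
  | _ => []

/-- Split by the value of the control: `(1 + Z)/2 + ((1 - Z)/2) X`. -/
theorem cnot_eq {c d : Fin N} (h : c ≠ d) :
    cnot c d = (1 / 2 : ℂ) • (1 + (Pauli.single c .Z).op + (Pauli.single d .X).op
      - (Pauli.single c .Z).op * (Pauli.single d .X).op) := by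
  ext x y
  have hmul : ((Pauli.single c .Z).op * (Pauli.single d .X).op) x y =
      (if x c then -1 else 1) * (Pauli.single d .X).op x y := by
    rw [Matrix.mul_apply, Finset.sum_eq_single x]
    · rw [op_single_Z_apply, if_pos rfl]
    · intro z _ hz
      rw [op_single_Z_apply, if_neg hz.symm, zero_mul]
    · simp
  simp only [Matrix.smul_apply, Matrix.sub_apply, Matrix.add_apply, hmul, op_single_Z_apply,
    op_single_X_apply, Matrix.one_apply, cnot, Matrix.of_apply, smul_eq_mul]
  by_cases hy : y c
  · simp only [hy, Bool.xor_true]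
    by_cases hx : x = y
    · subst hx
      have : x ≠ Function.update x d (!x d) := fun e => by
        have := congrFun e d; simp at this
      simp [this, hy]
    · by_cases hx' : x = Function.update y d (!y d)
      · have hc : x c = true := by rw [hx', Function.update_of_ne h, hy]
        simp only [if_neg hx, if_pos hx', hc]; norm_num
      · simp [hx, hx']
  · simp only [Bool.not_eq_true] at hy
    simp only [hy, Bool.xor_false, Function.update_eq_self]
    by_cases hx : x = y
    · subst hx
      have : x ≠ Function.update x d (!x d) := fun e => by
        have := congrFun e d; simp at this
      simp only [if_neg this, hy]; norm_num
    · by_cases hx' : x = Function.update y d (!y d)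
      · have hc : x c = false := by rw [hx', Function.update_of_ne h, hy]
        simp only [if_neg hx, if_pos hx', hc]; norm_num
      · simp [hx, hx']

/-- The phase `φ` cancels in `U A Uᴴ`, so gates can be treated as products of rotations. It is `-i`
for `H` and the eighth root of unity `(1 + i)/√2` for `S` and `CX`. -/
theorem Step.gate_eq {s : Step N} {U : Op N} (h : s.action = .gate U) :
    ∃ φ : ℂ, φ * star φ = 1 ∧ U = φ • frameOp s.frame := by
  have hw : ((1 + Complex.I) / (Real.sqrt 2 : ℝ)) * star ((1 + Complex.I) / (Real.sqrt 2 : ℝ)) = 1 := by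
    simp only [Complex.star_def, map_div₀, map_add, map_one, Complex.conj_I, Complex.conj_ofReal]
    rw [div_mul_div_comm, sqrt_two_mul_self]
    ring_nf
    rw [Complex.I_sq]
    norm_num
  cases s with
  | skip =>
    simp only [Step.action, Action.gate.injEq] at h
    exact ⟨1, by simp, by simp [frameOp, Step.frame, h]⟩
  | H i =>
    simp only [Step.action, Action.gate.injEq] at h
    refine ⟨-Complex.I, by simp, ?_⟩
    subst h
    simp only [frameOp, Step.frame, List.map_cons, List.map_nil, List.prod_cons, List.prod_nil,
      rot_single, mul_one, onLine_mul, ← onLine_smul]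
    congr 1
    have h2 := inv_sqrt_two_mul_self
    have hs := sqrt_two_mul_self
    have hne := sqrt_two_ne_zero
    ext x y
    cases x <;> cases y <;>
    · simp [hadamard, Letter.mat, Matrix.mul_apply]
      field_simp
      try ring_nf
      try simp [Complex.I_sq]
      rw [sq, hs]
  | S i =>
    simp only [Step.action, Action.gate.injEq] at h
    refine ⟨(1 + Complex.I) / (Real.sqrt 2 : ℝ), hw, ?_⟩
    subst h
    simp only [frameOp, Step.frame, List.map_cons, List.map_nil, List.prod_cons, List.prod_nil,
      mul_one, rot, Pauli.op_flip, Pauli.op_single, if_true]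
    rw [← onLine_smul, ← onLine_smul, ← onLine_one i, ← onLine_add, ← onLine_smul, ← onLine_smul]
    congr 1
    have hne := sqrt_two_ne_zero
    have hs := sqrt_two_mul_self
    rw [smul_smul, div_mul_div_comm, mul_one, hs]
    ext x y
    cases x <;> cases y <;> simp [phaseGate, Letter.mat] <;> field_simp <;> (ring_nf; try (simp [Complex.I_sq]; try ring_nf))
  | CX c d hcd =>
    simp only [Step.action, Action.gate.injEq] at h
    refine ⟨(1 + Complex.I) / (Real.sqrt 2 : ℝ), hw, ?_⟩
    subst h
    have hsym : (Pauli.single c .Z).sym (.single d .X) = 0 := by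
      rw [Pauli.sym_single]
      simp only [Pauli.single, Function.update_of_ne hcd.symm]
      rfl
    rw [cnot_eq hcd]
    simp only [frameOp, Step.frame, List.map_cons, List.map_nil, List.prod_cons, List.prod_nil,
      mul_one, rot, Pauli.op_flip, if_true, Pauli.op_mul_of_commute hsym]
    have hab := Pauli.op_commute hsym
    have haa := Pauli.op_mul_self (Pauli.single c .Z)
    have hbb := Pauli.op_mul_self (Pauli.single d .X)
    generalize (Pauli.single c Letter.Z).op = a at *
    generalize (Pauli.single d Letter.X).op = b at *
    have e1 : a * (a * b) = b := by rw [← mul_assoc, haa, one_mul]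
    have e2 : b * (a * b) = a := by rw [hab, ← mul_assoc, hbb, one_mul]
    simp only [smul_mul_smul_comm, smul_smul]
    have hc : (1 + Complex.I) / ((Real.sqrt 2 : ℝ) : ℂ) * (1 / (Real.sqrt 2 : ℝ) *
        (1 / (Real.sqrt 2 : ℝ) * (1 / (Real.sqrt 2 : ℝ)))) = (1 / 4 : ℂ) * (1 + Complex.I) := by
      rw [inv_sqrt_two_mul_self, div_eq_mul_one_div (1 + Complex.I)]
      linear_combination (1 + Complex.I) / 2 * inv_sqrt_two_mul_self
    rw [hc]
    have key1 : (1 + (Complex.I * -1) • b) * (1 + Complex.I • (a * b)) =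
        1 + (Complex.I * -1) • b + Complex.I • (a * b) + a := by
      simp only [add_mul, mul_add, one_mul, mul_one, Matrix.smul_mul, Matrix.mul_smul, smul_smul,
        e2]
      match_scalars <;> ring_nf
      all_goals simp
    -- The factor `1 - i` combines with `(1 + i)/4` to the `1/2` of `cnot_eq`.
    have key : (1 + (Complex.I * -1) • a) *
        ((1 + (Complex.I * -1) • b) * (1 + Complex.I • (a * b))) =
        (1 - Complex.I) • (1 + a + b - a * b) := by
      rw [key1]
      simp only [add_mul, mul_add, one_mul, mul_one, Matrix.smul_mul, Matrix.mul_smul, smul_smul,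
        e1, haa]
      match_scalars <;> ring_nf <;> simp <;> ring_nf
    rw [key, smul_smul]
    congr 1
    ring_nf
    rw [Complex.I_sq]
    norm_num
  | measure i p => simp [Step.action] at h

end gates

end CliffordPBC
end

noncomputable section
namespace CliffordPBC

/-! ## Tableaux -/

/-- Pairs of Paulis `(Q, D)`. In a valid tableau the `Q` commute pairwise and `D` anticommutes with
its partner `Q` and commutes with all the others. -/
abbrev Tableau (N : ℕ) := List (Pauli N × Pauli N)

/-! ### Sweeping a Pauli against a tableau. -/

section sweep

variable {N : ℕ}

/-- Multiply `M` by some of the `Q` of a tableau such that it commutes with all `D`. -/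
def sweep (l : Tableau N) (M : Pauli N) : Pauli N :=
  l.foldl (fun M g => if M.sym g.2 = 1 then M.mul g.1 else M) M

theorem sweep_cons (g : Pauli N × Pauli N) (l : Tableau N) (M : Pauli N) :
    sweep (g :: l) M = sweep l (if M.sym g.2 = 1 then M.mul g.1 else M) := rfl

theorem sweep_induction {l : Tableau N} {M : Pauli N} (p : Pauli N → Prop) (hM : p M)
    (h : ∀ M, ∀ g ∈ l, p M → M.sym g.2 = 1 → p (M.mul g.1)) : p (sweep l M) := by
  induction l generalizing M with
  | nil => exact hM
  | cons g l ih =>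
    rw [sweep_cons]
    refine ih ?_ fun M g' hg' => h M g' (by simp [hg'])
    split_ifs with hs
    · exact h M g (by simp) hM hs
    · exact hM

theorem sym_sweep {l : Tableau N} {M P : Pauli N} (h : ∀ g ∈ l, g.1.sym P = 0) :
    (sweep l M).sym P = M.sym P :=
  sweep_induction (fun M' => M'.sym P = M.sym P) rfl fun M' g hg hM' _ => by
    rw [Pauli.sym_mul_left, h g hg, hM', add_zero]

/-- The turn of a pair repairs the commutation with its own `D`. Later turns do not disturb it,
because the later `Q` commute with this `D`. -/
theorem sym_sweep_dual {l : Tableau N} (M : Pauli N)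
    (hp : l.Pairwise fun g h => h.1.sym g.2 = 0) (hd : ∀ g ∈ l, g.1.sym g.2 = 1) :
    ∀ g ∈ l, (sweep l M).sym g.2 = 0 := by
  induction l generalizing M with
  | nil => simp
  | cons g l ih =>
    rw [List.pairwise_cons] at hp
    intro g' hg'
    rw [sweep_cons]
    rcases List.mem_cons.1 hg' with rfl | hg'
    · rw [sym_sweep fun g hg => hp.1 g hg]
      split_ifs with hs
      · rw [Pauli.sym_mul_left, hs, hd _ (by simp)]; rfl
      · by_contra h0; exact hs (Pauli.sym_eq_one.2 h0)
    · exact ih _ hp.2 (fun g hg => hd g (by simp [hg])) g' hg'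

end sweep

variable {n t : ℕ}

instance (P : Pauli (n + t)) : Decidable P.HeadTrivial :=
  inferInstanceAs (Decidable (∀ _, _))

/-- The relations between the members of a tableau. -/
structure Tableau.Valid (l : Tableau (n + t)) : Prop where
  pairwise : l.Pairwise fun g h => g.1.sym h.1 = 0 ∧ g.1.sym h.2 = 0 ∧ g.2.sym h.1 = 0
  diag : ∀ g ∈ l, g.1.sym g.2 = 1
  -- The first alternative is that of input stabilisers and coin flips, the second that of
  -- measurements of the last lines.
  type : ∀ g ∈ l, g.2.TailTrivial ∨ g.1.HeadTrivial

/-- Extend a tableau by `(M, D)`, where `D` is the product of `R` with some old `D`. -/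
def Tableau.addPair {N : ℕ} (l : Tableau N) (M R : Pauli N) : Tableau N :=
  l ++ [(M, sweep (l.map Prod.swap) R)]

theorem Tableau.Valid.sym_mem {l : Tableau (n + t)} (h : l.Valid) {g g' : Pauli (n + t) × _}
    (hg : g ∈ l) (hg' : g' ∈ l) : g.1.sym g'.1 = 0 := by
  have hp : l.Pairwise fun g g' => g.1.sym g'.1 = 0 := h.pairwise.imp fun hab => hab.1
  exact hp.forall_of_forall_of_flip (fun a _ => Pauli.sym_self _)
    (hp.imp fun {a b} hab => (Pauli.sym_comm b.1 a.1).trans hab) hg hg'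

theorem Tableau.Valid.sweep_dual {l : Tableau (n + t)} (h : l.Valid) (M : Pauli (n + t)) :
    ∀ g ∈ l, (sweep l M).sym g.2 = 0 :=
  sym_sweep_dual M (h.pairwise.imp fun h => by rw [Pauli.sym_comm]; exact h.2.2) h.diag

theorem Tableau.Valid.sym_sweep {l : Tableau (n + t)} (h : l.Valid) {M : Pauli (n + t)}
    (hM : ∀ g ∈ l, M.sym g.1 = 0) : ∀ g ∈ l, (sweep l M).sym g.1 = 0 := fun g hg => by
  rw [CliffordPBC.sym_sweep fun g' hg' => h.sym_mem hg' hg, hM g hg]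

/-- Sweeping `R` with the roles of `Q` and `D` exchanged makes it commute with all old `Q`. As `M`
commutes with all old `D`, it still anticommutes with the result. If `R` acts on the first lines
only, so does the result: a pair with `Q` trivial there never enters, since its `Q` already commutes
with such operators. The `D` need not commute with one another. -/
theorem Tableau.Valid.addPair {l : Tableau (n + t)} (h : l.Valid) {M R : Pauli (n + t)}
    (hM : ∀ g ∈ l, M.sym g.1 = 0 ∧ M.sym g.2 = 0) (hR : M.sym R = 1)
    (ht : R.TailTrivial ∨ M.HeadTrivial) : (l.addPair M R).Valid := by
  have hswap : (l.map Prod.swap).Pairwise fun g h => h.1.sym g.2 = 0 := by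
    rw [List.pairwise_map]
    exact h.pairwise.imp fun h => by rw [Pauli.sym_comm]; exact h.2.1
  have hD : ∀ g ∈ l, (sweep (l.map Prod.swap) R).sym g.1 = 0 := fun g hg =>
    sym_sweep_dual R hswap (by
      simp only [List.mem_map]
      rintro _ ⟨g, hg, rfl⟩
      rw [Pauli.sym_comm]; exact h.diag g hg) g.swap (List.mem_map_of_mem hg)
  refine ⟨?_, ?_, ?_⟩
  · rw [Tableau.addPair, List.pairwise_append]
    refine ⟨h.pairwise, by simp, ?_⟩
    simp only [List.mem_singleton, forall_eq]
    exact fun g hg => ⟨by rw [Pauli.sym_comm]; exact (hM g hg).1,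
      by rw [Pauli.sym_comm]; exact hD g hg, by rw [Pauli.sym_comm]; exact (hM g hg).2⟩
  · simp only [Tableau.addPair, List.mem_append, List.mem_singleton]
    rintro g (hg | rfl)
    · exact h.diag g hg
    · dsimp only
      rw [Pauli.sym_comm, CliffordPBC.sym_sweep, Pauli.sym_comm, hR]
      simp only [List.mem_map]
      rintro _ ⟨g, hg, rfl⟩
      rw [Pauli.sym_comm]; exact (hM g hg).2
  · simp only [Tableau.addPair, List.mem_append, List.mem_singleton]
    rintro g (hg | rfl)
    · exact h.type g hg
    · refine ht.imp_left fun hR => ?_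
      refine sweep_induction (fun D => D.TailTrivial) hR ?_
      simp only [List.mem_map]
      rintro D _ ⟨g, hg, rfl⟩ hD hs
      rcases h.type g hg with h' | h'
      · exact hD.mul h'
      · rw [Prod.snd_swap, Pauli.sym_head_tail hD h'] at hs
        exact absurd hs (by decide)

/-! ### Candidates for partners -/

/-- The one-qubit Paulis `X` and `Z` on the first lines. -/
def headCands (n t : ℕ) : List (Pauli (n + t)) :=
  (List.finRange n).flatMap fun i =>
    [.single (Fin.castAdd t i) .X, .single (Fin.castAdd t i) .Z]

/-- The one-qubit Paulis `X` and `Z` on the last lines. -/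
def tailCands (n t : ℕ) : List (Pauli (n + t)) :=
  (List.finRange t).flatMap fun j =>
    [.single (Fin.natAdd n j) .X, .single (Fin.natAdd n j) .Z]

/-- The members of a list of Paulis that anticommute with `M`. -/
def anticommuting {N : ℕ} (M : Pauli N) (l : List (Pauli N)) : List (Pauli N) :=
  l.filter fun R => decide (M.sym R = 1)

theorem sym_eq_zero_of_anticommuting {N : ℕ} {M : Pauli N} {l : List (Pauli N)}
    (h : anticommuting M l = []) {R : Pauli N} (hR : R ∈ l) : M.sym R = 0 := by
  rw [anticommuting, List.filter_eq_nil_iff] at h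
  have := h R hR
  rw [decide_eq_true_eq, Pauli.sym_eq_one, not_not] at this
  exact this

theorem mem_of_anticommuting {N : ℕ} {M R : Pauli N} {l m : List (Pauli N)}
    (h : anticommuting M l = R :: m) : R ∈ l ∧ M.sym R = 1 := by
  have : R ∈ anticommuting M l := by simp [h]
  simpa [anticommuting] using this

theorem headTrivial_of_cands {M : Pauli (n + t)} (h : anticommuting M (headCands n t) = []) :
    M.HeadTrivial := fun i => by
  have h' := fun a (ha : Pauli.single (Fin.castAdd t i) a ∈ headCands n t) =>
    sym_eq_zero_of_anticommuting h ha
  refine Letter.eq_I_of_sym ?_ ?_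
  · rw [← Pauli.sym_single]; exact h' _ (by simp [headCands]; exact ⟨i, .inl rfl⟩)
  · rw [← Pauli.sym_single]; exact h' _ (by simp [headCands]; exact ⟨i, .inr rfl⟩)

theorem tailTrivial_of_cands {M : Pauli (n + t)} (h : anticommuting M (tailCands n t) = []) :
    M.TailTrivial := fun i => by
  have h' := fun a (ha : Pauli.single (Fin.natAdd n i) a ∈ tailCands n t) =>
    sym_eq_zero_of_anticommuting h ha
  refine Letter.eq_I_of_sym ?_ ?_
  · rw [← Pauli.sym_single]; exact h' _ (by simp [tailCands]; exact ⟨i, .inl rfl⟩)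
  · rw [← Pauli.sym_single]; exact h' _ (by simp [tailCands]; exact ⟨i, .inr rfl⟩)

theorem tailTrivial_of_mem_headCands {R : Pauli (n + t)} (h : R ∈ headCands n t) :
    R.TailTrivial := by
  simp only [headCands, List.mem_flatMap, List.mem_cons, List.not_mem_nil, or_false] at h
  obtain ⟨i, -, rfl | rfl⟩ := h <;>
  · intro j
    simp only [Pauli.single]
    rw [Function.update_of_ne]
    intro e
    have := congrArg Fin.val e
    simp only [Fin.val_natAdd, Fin.val_castAdd] at this
    omega

theorem not_headTrivial_of_sym {M R : Pauli (n + t)} (hR : R.TailTrivial) (h : M.sym R = 1) :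
    ¬ M.HeadTrivial := fun hM => by
  rw [Pauli.sym_comm, Pauli.sym_head_tail hR hM] at h
  exact absurd h (by decide)

/-! ### States described by a tableau -/

/-- The operator `B` on all lines is stabilised by the `Q` of the tableau, and restricted to Paulis
that commute with the tableau its expectation values are those of the operator `R` on the last
lines and the completely mixed state on the first lines. -/
structure Tracks (l : Tableau (n + t)) (B : Op (n + t)) (R : Op t) : Prop where
  stab : ∀ g ∈ l, g.1.op * B = B ∧ B * g.1.op = B
  exp : ∀ P : Pauli (n + t), (∀ g ∈ l, P.sym g.1 = 0 ∧ P.sym g.2 = 0) →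
    (P.op * B).trace = if P.HeadTrivial then (P.tail.op * R).trace else 0

theorem op_eq_one_of_trivial {P : Pauli (n + t)} (h : P.HeadTrivial) (h' : P.TailTrivial) :
    P.op = (if P.neg then -1 else 1 : ℂ) • 1 :=
  Pauli.op_one fun j => by
    refine Fin.addCases (fun i => h i) (fun i => h' i) j

theorem one_letter_commutes {N : ℕ} (Q : Pauli N) : (⟨false, fun _ => .I⟩ : Pauli N).sym Q = 0 := by
  refine Finset.sum_eq_zero fun i _ => ?_
  have : ∀ b : Letter, Letter.I.sym b = 0 := by decide
  exact this _

/-- The identity is among the Paulis to which `exp` applies. -/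
theorem Tracks.trace_eq {l : Tableau (n + t)} {B : Op (n + t)} {R : Op t} (h : Tracks l B R) :
    B.trace = R.trace := by
  have := h.exp ⟨false, fun _ => .I⟩ fun g _ => ⟨one_letter_commutes _, one_letter_commutes _⟩
  rw [if_pos (show Pauli.HeadTrivial _ from fun i => rfl), Pauli.op_one fun _ => rfl,
    Pauli.op_one fun _ => rfl] at this
  simpa [Pauli.tail] using this

/-- A factor `Q` with `QB = B = BQ` is absorbed by `B` on either side. So measuring the swept Pauli
on `B` is the same as measuring `M`. -/
theorem Tracks.sweep {l : Tableau (n + t)} {B : Op (n + t)} {R : Op t} (hl : l.Valid)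
    (h : Tracks l B R) {M : Pauli (n + t)} (hM : ∀ g ∈ l, M.sym g.1 = 0) :
    (CliffordPBC.sweep l M).op * B = M.op * B ∧ B * (CliffordPBC.sweep l M).op = B * M.op := by
  refine (sweep_induction (fun M' => (∀ g ∈ l, M'.sym g.1 = 0) ∧ M'.op * B = M.op * B ∧
    B * M'.op = B * M.op) ⟨hM, rfl, rfl⟩ ?_).2
  rintro M' g hg ⟨hM', h1, h2⟩ -
  refine ⟨fun g' hg' => ?_, ?_, ?_⟩
  · rw [Pauli.sym_mul_left, hM' g' hg', hl.sym_mem hg hg', add_zero]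
  · rw [Pauli.op_mul_of_commute (hM' g hg), mul_assoc, (h.stab g hg).1, h1]
  · rw [Pauli.op_mul_of_commute (hM' g hg), Pauli.op_commute (hM' g hg), ← mul_assoc,
      (h.stab g hg).2, h2]

theorem eigenproj_flip {N : ℕ} (M : Pauli N) (b : Bool) :
    eigenproj M.op b = (1 / 2 : ℂ) • (1 + (M.flip b).op) := by
  rw [eigenproj, Pauli.op_flip]

/-- The projector commutes with `P`, so by cyclicity of the trace its two copies merge into one.
Expectations after the measurement thus reduce to expectations before it. -/
theorem trace_mul_collapse {N : ℕ} {P M : Pauli N} (h : P.sym M = 0) (b : Bool) (B : Op N) :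
    (P.op * collapse M.op b B).trace =
      (1 / 2 : ℂ) * ((P.op * B).trace + ((P.mul (M.flip b)).op * B).trace) := by
  have hE := eigenproj_mul_self (Pauli.op_mul_self M) b
  have hc : eigenproj M.op b * P.op = P.op * eigenproj M.op b := by
    rw [eigenproj_flip]
    simp only [Matrix.smul_mul, Matrix.mul_smul, add_mul, mul_add, one_mul, mul_one]
    rw [Pauli.op_commute (P := P) (Q := M.flip b) (by simpa using h)]
  rw [collapse_eq, ← mul_assoc, Matrix.trace_mul_comm, ← mul_assoc, ← mul_assoc, hc, mul_assoc P.op,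
    hE, eigenproj_flip, Pauli.op_mul_of_commute (by simpa using h)]
  simp [add_mul, mul_add]

theorem stab_collapse {N : ℕ} (M : Pauli N) (b : Bool) (B : Op N) :
    (M.flip b).op * collapse M.op b B = collapse M.op b B ∧
      collapse M.op b B * (M.flip b).op = collapse M.op b B := by
  have h1 : (M.flip b).op * eigenproj M.op b = eigenproj M.op b := by
    rw [eigenproj_flip]
    simp only [Matrix.mul_smul, mul_add, mul_one, Pauli.op_mul_self]
    rw [add_comm]
  have h2 : eigenproj M.op b * (M.flip b).op = eigenproj M.op b := by
    rw [eigenproj_flip]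
    simp only [Matrix.smul_mul, add_mul, one_mul, Pauli.op_mul_self]
    rw [add_comm]
  rw [collapse_eq]
  exact ⟨by rw [← mul_assoc, ← mul_assoc, h1], by rw [mul_assoc, h2]⟩

theorem stab_collapse_of_commute {N : ℕ} {Q M : Pauli N} (h : Q.sym M = 0) (b : Bool) {B : Op N}
    (hB : Q.op * B = B ∧ B * Q.op = B) :
    Q.op * collapse M.op b B = collapse M.op b B ∧
      collapse M.op b B * Q.op = collapse M.op b B := by
  have hc : eigenproj M.op b * Q.op = Q.op * eigenproj M.op b := by
    rw [eigenproj_flip]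
    simp only [Matrix.smul_mul, Matrix.mul_smul, add_mul, mul_add, one_mul, mul_one]
    rw [Pauli.op_commute (P := Q) (Q := M.flip b) (by simpa using h)]
  rw [collapse_eq]
  constructor
  · rw [← mul_assoc, ← mul_assoc, ← hc, mul_assoc _ _ B, hB.1]
  · rw [mul_assoc, hc, ← mul_assoc, mul_assoc _ B, hB.2]

theorem Tracks.stab_addPair {l : Tableau (n + t)} {B : Op (n + t)} {R : Op t} (h : Tracks l B R)
    {M : Pauli (n + t)} (hM : ∀ g ∈ l, M.sym g.1 = 0) (K : Pauli (n + t)) (b : Bool) :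
    ∀ g ∈ l.addPair (M.flip b) K, g.1.op * collapse M.op b B = collapse M.op b B ∧
      collapse M.op b B * g.1.op = collapse M.op b B := by
  simp only [Tableau.addPair, List.mem_append, List.mem_singleton]
  rintro g (hg | rfl)
  · exact stab_collapse_of_commute (by rw [Pauli.sym_comm]; exact hM g hg) b (h.stab g hg)
  · exact stab_collapse M b B

/-- Measurement of a Pauli that commutes with the tableau and acts nontrivially on the first
lines. -/
theorem Tracks.addPair_head {l : Tableau (n + t)} {B : Op (n + t)} {R : Op t} (hl : l.Valid)
    (h : Tracks l B R) {M K : Pauli (n + t)} (hM : ∀ g ∈ l, M.sym g.1 = 0 ∧ M.sym g.2 = 0)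
    (hK : M.sym K = 1) (hKt : K.TailTrivial) (b : Bool) :
    Tracks (l.addPair (M.flip b) K) ((2 : ℂ) • collapse M.op b B) R := by
  have hv : (l.addPair (M.flip b) K).Valid :=
    hl.addPair (M := M.flip b) (by simpa using hM) (by simpa using hK) (.inl hKt)
  have hmem : (M.flip b, CliffordPBC.sweep (l.map Prod.swap) K) ∈ l.addPair (M.flip b) K := by
    simp [Tableau.addPair]
  have hMh : ¬ M.HeadTrivial := not_headTrivial_of_sym hKt hK
  refine ⟨fun g hg => ?_, fun P hP => ?_⟩
  · simp [h.stab_addPair (fun g hg => (hM g hg).1) K b g hg]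
  · have hPl : ∀ g ∈ l, P.sym g.1 = 0 ∧ P.sym g.2 = 0 := fun g hg =>
      hP g (by simp [Tableau.addPair, hg])
    obtain ⟨hPM, hPD⟩ := hP _ hmem
    simp only [Pauli.sym_flip_right] at hPM
    have hPMl : ∀ g ∈ l, (P.mul (M.flip b)).sym g.1 = 0 ∧ (P.mul (M.flip b)).sym g.2 = 0 := by
      intro g hg
      simp [Pauli.sym_mul_left, hPl g hg, hM g hg]
    -- If `P` and `M` had the same letters on the first lines, then the new `D`, which acts only
    -- there, would anticommute with `P` as it does with `M`. So the cross term has expectation zero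
    -- and only half of the old one is left, which the factor `2` compensates.
    have hzero : ¬ (P.mul (M.flip b)).HeadTrivial := by
      intro hh
      have hheads : ∀ i : Fin n, P.letter (Fin.castAdd t i) = M.letter (Fin.castAdd t i) := by
        intro i; exact Pauli.letter_mul_eq_I.1 (hh i)
      have hD : (CliffordPBC.sweep (l.map Prod.swap) K).TailTrivial := by
        rcases hv.type _ hmem with h' | h'
        · exact h'
        · exact absurd h' hMh
      have e1 := hv.diag _ hmem
      simp only [Pauli.sym_flip_left] at e1
      rw [Pauli.sym_comm, Pauli.sym_of_tailTrivial hD] at hPD e1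
      have : P.head = M.head := Pauli.ext' rfl (funext hheads)
      rw [this, e1] at hPD
      exact absurd hPD (by decide)
    rw [Matrix.mul_smul, Matrix.trace_smul, trace_mul_collapse hPM, h.exp P hPl, h.exp _ hPMl,
      if_neg hzero]
    split_ifs <;> simp

/-- Measurement of a Pauli that commutes with the tableau and acts on the last lines only. -/
theorem Tracks.addPair_tail {l : Tableau (n + t)} {B : Op (n + t)} {R : Op t}
    (h : Tracks l B R) {M : Pauli (n + t)} (K : Pauli (n + t))
    (hM : ∀ g ∈ l, M.sym g.1 = 0 ∧ M.sym g.2 = 0) (hMh : M.HeadTrivial) (b : Bool) :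
    Tracks (l.addPair (M.flip b) K) (collapse M.op b B) (collapse M.tail.op b R) := by
  have hmem : (M.flip b, CliffordPBC.sweep (l.map Prod.swap) K) ∈ l.addPair (M.flip b) K := by
    simp [Tableau.addPair]
  refine ⟨fun g hg => h.stab_addPair (fun g hg => (hM g hg).1) K b g hg, fun P hP => ?_⟩
  have hPl : ∀ g ∈ l, P.sym g.1 = 0 ∧ P.sym g.2 = 0 := fun g hg =>
    hP g (by simp [Tableau.addPair, hg])
  have hPM := (hP _ hmem).1
  simp only [Pauli.sym_flip_right] at hPM
  have hPMl : ∀ g ∈ l, (P.mul (M.flip b)).sym g.1 = 0 ∧ (P.mul (M.flip b)).sym g.2 = 0 := by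
    intro g hg
    simp [Pauli.sym_mul_left, hPl g hg, hM g hg]
  have hMf : (M.flip b).HeadTrivial := hMh
  have hPMt : P.tail.sym M.tail = 0 := by
    rw [Pauli.sym_comm, ← Pauli.sym_of_headTrivial hMh, Pauli.sym_comm, hPM]
  rw [trace_mul_collapse hPM, h.exp P hPl, h.exp _ hPMl, Pauli.tail_mul hMf,
    Pauli.tail_flip, trace_mul_collapse hPMt]
  simp only [Pauli.headTrivial_mul_iff hMf]
  split_ifs <;> simp

/-- A measurement of a Pauli that anticommutes with a stabilising Pauli is a random rotation. -/
theorem collapse_of_anticommute {N : ℕ} {M Q : Pauli N} (hs : M.sym Q = 1) {B : Op N}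
    (hB : Q.op * B = B ∧ B * Q.op = B) (b : Bool) :
    (2 : ℂ) • collapse M.op b B =
      rot ((M.mul Q).flip (!b)) * B * (rot ((M.mul Q).flip (!b)))ᴴ := by
  have hs' : M.sym Q ≠ 0 := Pauli.sym_eq_one.1 hs
  -- `M.mul Q` is `iMQ`, and `Q` is absorbed by `B`. The sign `!b` is chosen such that the rotation
  -- acts on `B` as `√2` times the projector onto outcome `b`.
  have h1 : ((M.mul Q).flip (!b)).op * B =
      ((if b then 1 else -1 : ℂ) * Complex.I) • (M.op * B) := by
    rw [Pauli.op_flip, Pauli.op_mul, if_neg hs']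
    simp only [Matrix.smul_mul, smul_smul, mul_assoc M.op, hB.1]
    cases b <;> simp
  have h2 : B * ((M.mul Q).flip (!b)).op =
      (-(if b then 1 else -1 : ℂ) * Complex.I) • (B * M.op) := by
    rw [Pauli.op_flip, Pauli.op_mul, if_neg hs', Pauli.op_anticommute hs']
    simp only [Matrix.mul_smul, smul_smul, mul_neg, ← mul_assoc B, hB.2]
    cases b <;> simp
  have e1 : rot ((M.mul Q).flip (!b)) * B =
      (1 / (Real.sqrt 2 : ℂ)) • ((1 + (if b then -1 else 1 : ℂ) • M.op) * B) := by
    rw [rot, Matrix.smul_mul, add_mul, add_mul, Matrix.smul_mul, Matrix.smul_mul, h1, smul_smul]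
    cases b <;> simp
  rw [e1, rot_conjTranspose, smul_mul_smul_comm, inv_sqrt_two_mul_self, mul_assoc, mul_sub,
    Matrix.mul_smul, h2, smul_smul, collapse_eq, eigenproj]
  simp only [Matrix.smul_mul, Matrix.mul_smul, smul_smul, mul_assoc, mul_add, mul_one]
  cases b
  · simp [sub_eq_add_neg, mul_add]
  · simp [sub_eq_add_neg, mul_add]

end CliffordPBC
end

noncomputable section
namespace CliffordPBC

/-! ## The simulation -/

/-- The classical record of a simulated circuit: its outcomes, its state in terms of rotations
applied to the input, and the tableau of stabilising Paulis. -/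
structure SimState (n t : ℕ) where
  out : List Bool
  frame : List (Pauli (n + t))
  tab : Tableau (n + t)

/-- How to simulate a measurement. -/
inductive Verdict (n t : ℕ) where
  /-- the outcome is a fair coin -/
  | coin (s : Bool → SimState n t)
  /-- the outcome is that of a measurement on the last lines -/
  | ask (P : Pauli t) (s : Bool → SimState n t)
  /-- the outcome is determined -/
  | fixed (b : Bool)

variable {n t : ℕ}

namespace SimState

/-- The state after outcome `b` of a Pauli `M` that anticommutes with the stabilising `Q`. -/
def rotate (st : SimState n t) (M Q : Pauli (n + t)) (b : Bool) : SimState n t :=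
  ⟨st.out ++ [b], st.frame ++ [(M.mul Q).flip (!b)], st.tab⟩

/-- The state after outcome `b` of a Pauli `M` that becomes a new stabilising Pauli. -/
def extend (st : SimState n t) (M R : Pauli (n + t)) (b : Bool) : SimState n t :=
  ⟨st.out ++ [b], st.frame, st.tab.addPair (M.flip b) R⟩

/-- The simulation of a measurement of the Pauli `M`. -/
def measure (st : SimState n t) (M : Pauli (n + t)) : Verdict n t :=
  match anticommuting (pull st.frame M) (st.tab.map Prod.fst) with
  | Q :: _ => .coin (st.rotate (pull st.frame M) Q)
  | [] =>
    match anticommuting (sweep st.tab (pull st.frame M)) (headCands n t) with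
    | R :: _ => .coin (st.extend (sweep st.tab (pull st.frame M)) R)
    | [] =>
      match anticommuting (sweep st.tab (pull st.frame M)) (tailCands n t) with
      | R :: _ => .ask (sweep st.tab (pull st.frame M)).tail
          (st.extend (sweep st.tab (pull st.frame M)) R)
      | [] => .fixed (sweep st.tab (pull st.frame M)).neg

/-- The record describes the state `A` of the circuit, given the state `R` of the last lines. -/
def Describes (st : SimState n t) (A : Op (n + t)) (R : Op t) : Prop :=
  ∃ B, A = frameOp st.frame * B * (frameOp st.frame)ᴴ ∧ Tracks st.tab B R

theorem Describes.trace_eq {st : SimState n t} {A : Op (n + t)} {R : Op t}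
    (h : st.Describes A R) : A.trace = R.trace := by
  obtain ⟨B, rfl, h⟩ := h
  rw [Matrix.trace_mul_comm, ← mul_assoc, frameOp_star_mul, one_mul, h.trace_eq]

end SimState

theorem collapse_conj {N : ℕ} {U M B : Op N} (hU : U * Uᴴ = 1) (b : Bool) :
    collapse M b (U * B * Uᴴ) = U * collapse (Uᴴ * M * U) b B * Uᴴ := by
  have hU' : Uᴴ * U = 1 := mul_eq_one_comm.1 hU
  have h1 : eigenproj M b * U = U * eigenproj (Uᴴ * M * U) b := by
    simp only [eigenproj, Matrix.smul_mul, Matrix.mul_smul, add_mul, mul_add, one_mul, mul_one,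
      ← mul_assoc, hU]
  have h2 : Uᴴ * eigenproj M b = eigenproj (Uᴴ * M * U) b * Uᴴ := by
    simp only [eigenproj, Matrix.smul_mul, Matrix.mul_smul, add_mul, mul_add, one_mul, mul_one,
      mul_assoc, hU]
  rw [collapse_eq, collapse_eq, mul_assoc, mul_assoc (U * B), h2, ← mul_assoc, ← mul_assoc,
    ← mul_assoc, h1]
  simp only [mul_assoc]

theorem collapse_of_stab {N : ℕ} {M B : Op N} {b : Bool}
    (h : M * B = (if b then -1 else 1 : ℂ) • B ∧ B * M = (if b then -1 else 1 : ℂ) • B) :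
    collapse M b B = B ∧ collapse M (!b) B = 0 := by
  have h1 : eigenproj M b * B = B := by
    rw [eigenproj, Matrix.smul_mul, add_mul, Matrix.smul_mul, h.1]
    cases b <;> simp <;> module
  have h2 : B * eigenproj M b = B := by
    rw [eigenproj, Matrix.mul_smul, mul_add, Matrix.mul_smul, h.2]
    cases b <;> simp <;> module
  have h3 : eigenproj M (!b) * B = 0 := by
    rw [eigenproj, Matrix.smul_mul, add_mul, Matrix.smul_mul, h.1]
    cases b <;> simp
  rw [collapse_eq, collapse_eq, h1, h2, h3, zero_mul]
  exact ⟨rfl, rfl⟩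

theorem pull_anticommuting {N : ℕ} {M : Pauli N} {l : Tableau N}
    (h : anticommuting M (l.map Prod.fst) = []) : ∀ g ∈ l, M.sym g.1 = 0 := fun _ hg =>
  sym_eq_zero_of_anticommuting h (List.mem_map_of_mem (f := Prod.fst) hg)

/-- For a coin each outcome has probability `1/2`, and the doubled branch is described with the same
`R`. For a query the branch of the circuit and the branch of the last lines collapse together.
Rotations that arise from measurements act directly on `B`, so they stand at the right end of the
frame, whereas gates enter at its left end. -/
theorem SimState.measure_spec {st : SimState n t} {A : Op (n + t)} {R : Op t}
    (hv : st.tab.Valid) (h : st.Describes A R) (M : Pauli (n + t)) :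
    match st.measure M with
    | .coin s => ∀ b, (s b).out = st.out ++ [b] ∧
        (s b).Describes ((2 : ℂ) • collapse M.op b A) R
    | .ask P s => ∀ b, (s b).out = st.out ++ [b] ∧
        (s b).Describes (collapse M.op b A) (collapse P.op b R)
    | .fixed b => collapse M.op b A = A ∧ collapse M.op (!b) A = 0 := by
  obtain ⟨B, rfl, hB⟩ := h
  have hcol : ∀ b, collapse M.op b (frameOp st.frame * B * (frameOp st.frame)ᴴ) =
      frameOp st.frame * collapse (pull st.frame M).op b B * (frameOp st.frame)ᴴ := fun b => by
    rw [collapse_conj (frameOp_mul_star _), frameOp_conj]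
  simp only [hcol, measure]
  generalize pull st.frame M = M' at *
  rcases h1 : anticommuting M' (st.tab.map Prod.fst) with _ | ⟨Q, m⟩
  · have hM := pull_anticommuting h1
    have hM' := fun g (hg : g ∈ st.tab) =>
      And.intro (hv.sym_sweep hM g hg) (hv.sweep_dual M' g hg)
    have hop := hB.sweep hv hM
    have hcol' : ∀ b, collapse M'.op b B = collapse (sweep st.tab M').op b B := by
      intro b
      have e1 : eigenproj M'.op b * B = eigenproj (sweep st.tab M').op b * B := by
        simp only [eigenproj, Matrix.smul_mul, add_mul, hop.1]
      have e2 : B * eigenproj M'.op b = B * eigenproj (sweep st.tab M').op b := by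
        simp only [eigenproj, Matrix.mul_smul, mul_add, hop.2]
      rw [collapse_eq, collapse_eq, e1, mul_assoc, e2, mul_assoc]
    simp only [hcol']
    generalize sweep st.tab M' = M'' at *
    rcases h2 : anticommuting M'' (headCands n t) with _ | ⟨K, m⟩
    · have hh := headTrivial_of_cands h2
      rcases h3 : anticommuting M'' (tailCands n t) with _ | ⟨K, m⟩
      -- No candidate anticommutes with the swept Pauli, hence it is `±1` and its sign is the
      -- outcome.
      · have ht := tailTrivial_of_cands h3
        simp only
        have := collapse_of_stab (M := M''.op) (B := B) (b := M''.neg)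
          (by rw [op_eq_one_of_trivial hh ht]; simp)
        rw [this.1, this.2]
        simp
      · exact fun b => ⟨rfl, _, rfl, hB.addPair_tail K hM' hh b⟩
    · obtain ⟨hK, hs⟩ := mem_of_anticommuting h2
      refine fun b => ⟨rfl, (2 : ℂ) • collapse M''.op b B, ?_,
        hB.addPair_head hv hM' hs (tailTrivial_of_mem_headCands hK) b⟩
      simp [extend]
  -- `M` anticommutes with a stabilising Pauli: `B` and the tableau stay, and only the frame grows.
  · obtain ⟨hQ, hs⟩ := mem_of_anticommuting h1
    simp only [List.mem_map] at hQ
    obtain ⟨g, hg, rfl⟩ := hQ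
    refine fun b => ⟨rfl, B, ?_, hB⟩
    have := collapse_of_anticommute hs (hB.stab g hg) b
    rw [rotate, frameOp_append]
    simp only [frameOp, List.map_cons, List.map_nil, List.prod_cons, List.prod_nil, mul_one,
      Matrix.conjTranspose_mul, mul_assoc] at *
    rw [← Matrix.mul_smul, ← Matrix.smul_mul, this]
    simp only [mul_assoc]

/-! ### Measured Paulis -/

/-- The pairs of a tableau that come from measurements of the last lines. -/
def Tableau.measuredPart (l : Tableau (n + t)) : Tableau t :=
  (l.filter fun g => decide g.1.HeadTrivial).map fun g => (g.1.tail, g.2.tail)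

/-- Commuting Paulis with partners. -/
structure Tableau.Dual (l : Tableau t) : Prop where
  pairwise : l.Pairwise fun g h => g.1.sym h.1 = 0 ∧ g.1.sym h.2 = 0 ∧ g.2.sym h.1 = 0
  diag : ∀ g ∈ l, g.1.sym g.2 = 1

/-- For `Q` trivial on the first lines the symplectic form sees the last lines only, so `D` may be
replaced by its tail. -/
theorem Tableau.Valid.dual {l : Tableau (n + t)} (h : l.Valid) : l.measuredPart.Dual := by
  constructor
  · rw [measuredPart, List.pairwise_map]
    have := h.pairwise.sublist (List.filter_sublist (p := fun g => decide g.1.HeadTrivial))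
    refine this.imp_of_mem fun {a b} ha hb hab => ?_
    have ha' : a.1.HeadTrivial := by simpa using (List.mem_filter.1 ha).2
    have hb' : b.1.HeadTrivial := by simpa using (List.mem_filter.1 hb).2
    refine ⟨?_, ?_, ?_⟩
    · rw [← Pauli.sym_of_headTrivial ha']; exact hab.1
    · rw [← Pauli.sym_of_headTrivial ha']; exact hab.2.1
    · rw [Pauli.sym_comm, ← Pauli.sym_of_headTrivial hb', Pauli.sym_comm]; exact hab.2.2
  · simp only [measuredPart, List.mem_map, List.mem_filter, decide_eq_true_eq]
    rintro _ ⟨g, ⟨hg, hg'⟩, rfl⟩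
    rw [← Pauli.sym_of_headTrivial hg']; exact h.diag g hg

/-- `measuredPart` grows exactly at queries, by the queried Pauli up to sign: a new `Q` from a coin
flip acts on the first lines and is filtered out. -/
theorem SimState.measure_valid {st : SimState n t} (hv : st.tab.Valid) (M : Pauli (n + t)) :
    match st.measure M with
    | .coin s => ∀ b, (s b).tab.Valid ∧ (s b).tab.measuredPart = st.tab.measuredPart
    | .ask P s => ∃ D, ∀ b, (s b).tab.Valid ∧
        (s b).tab.measuredPart = st.tab.measuredPart ++ [(P.flip b, D)]
    | .fixed _ => True := by
  simp only [measure]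
  generalize pull st.frame M = M' at *
  rcases h1 : anticommuting M' (st.tab.map Prod.fst) with _ | ⟨Q, m⟩
  · have hM := pull_anticommuting h1
    have hM' := fun g (hg : g ∈ st.tab) =>
      And.intro (hv.sym_sweep hM g hg) (hv.sweep_dual M' g hg)
    simp only
    generalize sweep st.tab M' = M'' at *
    rcases h2 : anticommuting M'' (headCands n t) with _ | ⟨K, m⟩
    · have hh := headTrivial_of_cands h2
      rcases h3 : anticommuting M'' (tailCands n t) with _ | ⟨K, m⟩
      · trivial
      · obtain ⟨hK, hs⟩ := mem_of_anticommuting h3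
        refine ⟨(sweep (st.tab.map Prod.swap) K).tail, fun b => ⟨hv.addPair (by simpa using hM') (by simpa using hs) (.inr hh), ?_⟩⟩
        have : (M''.flip b).HeadTrivial := hh
        simp only [extend, Tableau.addPair, Tableau.measuredPart, List.filter_append,
          List.map_append]
        rw [List.filter_cons_of_pos (by simpa using this)]
        rfl
    · obtain ⟨hK, hs⟩ := mem_of_anticommuting h2
      have hKt := tailTrivial_of_mem_headCands hK
      refine fun b => ⟨hv.addPair (by simpa using hM') (by simpa using hs) (.inl hKt), ?_⟩
      have : ¬ (M''.flip b).HeadTrivial := not_headTrivial_of_sym hKt hs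
      simp only [extend, Tableau.addPair, Tableau.measuredPart, List.filter_append]
      rw [List.filter_cons_of_neg (by simpa using this)]
      simp
  · exact fun b => ⟨hv, rfl⟩

/-- The `Q` and `D` together are linearly independent in a space of dimension `2t` over `ZMod 2`.
Pairing a relation with `Q_j` isolates the coefficient of `D_j`. Once all these vanish, pairing with
`D_j` isolates the coefficient of `Q_j`; this order is needed since the `D` may anticommute with
each other. -/
theorem Tableau.Dual.length_le {l : Tableau t} (h : l.Dual) : l.length ≤ t := by
  let vec : Pauli t → (Fin t → ZMod 2 × ZMod 2) := fun P j =>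
    ((P.letter j).sym .X, (P.letter j).sym .Z)
  let form : Pauli t → (Fin t → ZMod 2 × ZMod 2) →ₗ[ZMod 2] ZMod 2 := fun Q =>
    ∑ j, ((Q.letter j).sym .Z • LinearMap.fst (ZMod 2) (ZMod 2) (ZMod 2) +
      (Q.letter j).sym .X • LinearMap.snd (ZMod 2) (ZMod 2) (ZMod 2)) ∘ₗ LinearMap.proj j
  have hform : ∀ P Q, form Q (vec P) = P.sym Q := by
    intro P Q
    have hl : ∀ a b : Letter, b.sym .Z * a.sym .X + b.sym .X * a.sym .Z = a.sym b := by decide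
    simp only [form, vec, LinearMap.sum_apply, LinearMap.comp_apply, LinearMap.proj_apply,
      LinearMap.add_apply, LinearMap.smul_apply, LinearMap.fst_apply, LinearMap.snd_apply,
      smul_eq_mul, hl, Pauli.sym]
  have hne : ∀ i j : Fin l.length, i ≠ j →
      (l.get i).1.sym (l.get j).1 = 0 ∧ (l.get i).1.sym (l.get j).2 = 0 ∧
        (l.get i).2.sym (l.get j).1 = 0 := by
    have := List.pairwise_iff_get.1 h.pairwise
    intro i j hij
    rcases lt_or_gt_of_ne hij with hlt | hlt
    · exact this i j hlt
    · obtain ⟨a, b, c⟩ := this j i hlt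
      exact ⟨by rw [Pauli.sym_comm]; exact a, by rw [Pauli.sym_comm]; exact c,
        by rw [Pauli.sym_comm]; exact b⟩
  have hd : ∀ i : Fin l.length, (l.get i).1.sym (l.get i).2 = 1 := fun i =>
    h.diag _ (List.get_mem l i)
  have li : LinearIndependent (ZMod 2) (fun i : Fin l.length ⊕ Fin l.length =>
      Sum.elim (fun i => vec (l.get i).1) (fun i => vec (l.get i).2) i) := by
    rw [Fintype.linearIndependent_iff]
    intro g hg
    have hr : ∀ j, g (.inr j) = 0 := by
      intro j
      have := congrArg (form (l.get j).1) hg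
      simp only [map_add, map_sum, map_smul, Fintype.sum_sum_type, Sum.elim_inl, Sum.elim_inr, hform,
        map_zero, smul_eq_mul] at this
      rw [Finset.sum_eq_zero, zero_add, Finset.sum_eq_single j] at this
      · rwa [Pauli.sym_comm, hd, mul_one] at this
      · intro i _ hij; rw [(hne i j hij).2.2, mul_zero]
      · simp
      · intro i _
        by_cases hij : i = j
        · rw [hij, Pauli.sym_self, mul_zero]
        · rw [(hne i j hij).1, mul_zero]
    rintro (j | j)
    · have := congrArg (form (l.get j).2) hg
      simp only [map_add, map_sum, map_smul, Fintype.sum_sum_type, Sum.elim_inl, Sum.elim_inr, hform,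
        map_zero, smul_eq_mul, hr, zero_mul, Finset.sum_const_zero, add_zero] at this
      rw [Finset.sum_eq_single j] at this
      · rwa [hd, mul_one] at this
      · intro i _ hij; rw [(hne i j hij).2.1, mul_zero]
      · simp
    · exact hr j
  have := li.fintype_card_le_finrank
  simp only [Fintype.card_sum, Fintype.card_fin, Module.finrank_pi_fintype, Module.finrank_prod,
    Module.finrank_self, Finset.sum_const, Finset.card_univ, smul_eq_mul] at this
  omega

end CliffordPBC
end

noncomputable section
namespace CliffordPBC

variable {n t : ℕ}

/-! ### The simulation loop -/

/-- The configuration of a simulation: the number of the next step, the record of the state, the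
available outcomes of measurements on the last lines, and the next such measurement if its outcome
is not available. -/
structure Config (n t : ℕ) where
  pos : ℕ
  st : SimState n t
  input : List Bool
  query : Option (Pauli t × Bool)

/-- Simulation of a measurement with a given verdict. -/
def Config.resolve (c : Config n t) (post coin : Bool) : Verdict n t → Config n t
  -- A postselected measurement takes the branch of outcome `+1`, whatever the coin.
  | .coin s => ⟨c.pos + 1, s (coin && !post), c.input, none⟩
  | .fixed b => ⟨c.pos + 1, ⟨c.st.out ++ [b && !post], c.st.frame, c.st.tab⟩, c.input, none⟩
  | .ask P s =>
    match c.input with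
    -- Without postselection the sign is left out of the query and put back into the outcome below.
    -- So the query does not depend on signs produced by earlier outcomes.
    | [] => ⟨c.pos, c.st, [], some (if post then P else P.abs, post)⟩
    | b :: m => ⟨c.pos + 1, s (!post && xor b P.neg), m, none⟩

/-- Simulation of one step of a circuit. -/
def Config.advanceStep (c : Config n t) (coin : Bool) (g : Step (n + t)) : Config n t :=
  match g with
  | .measure i post => c.resolve post coin (c.st.measure (.single i .Z))
  | g => ⟨c.pos + 1, ⟨c.st.out, g.frame ++ c.st.frame, c.st.tab⟩, c.input, none⟩

/-- Simulation of the next step unless the outcome of a measurement is awaited. -/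
def advance (steps : ℕ → List Bool → Step (n + t)) (c : Config n t) (coin : Bool) : Config n t :=
  if c.query.isSome then c else c.advanceStep coin (steps c.pos c.st.out)

def simulate (steps : ℕ → List Bool → Step (n + t)) (c : Config n t) (coins : List Bool) :
    Config n t := coins.foldl (advance steps) c

variable {steps : ℕ → List Bool → Step (n + t)}

theorem simulate_cons (c : Config n t) (b : Bool) (s : List Bool) :
    simulate steps c (b :: s) = simulate steps (advance steps c b) s := rfl

theorem simulate_of_query {c : Config n t} (h : c.query.isSome) (s : List Bool) :
    simulate steps c s = c := by
  induction s with
  | nil => rfl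
  | cons b s ih => rw [simulate_cons, advance, if_pos h, ih]

theorem advance_none (k : ℕ) (st : SimState n t) (m : List Bool) (b : Bool) :
    advance steps ⟨k, st, m, none⟩ b =
      Config.advanceStep ⟨k, st, m, none⟩ b (steps k st.out) := rfl

/-! ### Averages over coins -/

/-- The recursive form of `coinAverage`, adapted to a loop that takes one coin per step from the
front. -/
def coinAvg : ℕ → (List Bool → Dist) → Dist
  | 0, F => F []
  | f + 1, F => (1 / 2 : ℝ) • (coinAvg f (fun s => F (false :: s)) + coinAvg f fun s => F (true :: s))

theorem coinAvg_add (f : ℕ) (F G : List Bool → Dist) :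
    coinAvg f (fun s => F s + G s) = coinAvg f F + coinAvg f G := by
  induction f generalizing F G with
  | zero => rfl
  | succ f ih => simp only [coinAvg, ih]; module

theorem coinAvg_smul (f : ℕ) (c : ℝ) (F : List Bool → Dist) :
    coinAvg f (fun s => c • F s) = c • coinAvg f F := by
  induction f generalizing F with
  | zero => rfl
  | succ f ih => simp only [coinAvg, ih]; module

theorem coinAvg_zero (f : ℕ) : coinAvg f (fun _ => 0) = 0 := by
  induction f with
  | zero => rfl
  | succ f ih => simp [coinAvg, ih]

/-- For steps that ignore their coin. The coin is drawn all the same, so the number of coins does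
not depend on the branch. -/
theorem coinAvg_succ_of_eq {f : ℕ} {F G : List Bool → Dist} (h : ∀ b s, F (b :: s) = G s) :
    coinAvg (f + 1) F = coinAvg f G := by
  simp only [coinAvg, h]; module

theorem coinAverage_ofFn (m : ℕ) (F : List Bool → Dist) :
    coinAverage (fun r : Fin m → Bool => F (List.ofFn r)) = coinAvg m F := by
  induction m generalizing F with
  | zero => simp [coinAverage, coinAvg]
  | succ m ih =>
    rw [coinAvg, ← ih, ← ih, coinAverage, coinAverage, coinAverage]
    rw [← (Fin.consEquiv fun _ => Bool).sum_comp, Fintype.sum_prod_type, Fintype.sum_bool]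
    have e : ∀ (b : Bool) (y : Fin m → Bool),
        List.ofFn ((Fin.consEquiv fun _ => Bool) (b, y)) = b :: List.ofFn y :=
      fun b y => List.ofFn_cons b y
    simp only [e]
    rw [pow_succ, mul_inv, add_comm]
    module

/-! ### Correctness of the simulation -/

theorem Step.action_proper {N : ℕ} (s : Step N) : s.action.Proper := by
  rcases h : s.action with U | ⟨M, p⟩ | _
  · obtain ⟨φ, hφ, rfl⟩ := s.gate_eq h
    simp only [Action.Proper, Matrix.conjTranspose_smul, Matrix.smul_mul, Matrix.mul_smul,
      smul_smul, frameOp_star_mul]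
    rw [hφ, one_smul]
  · cases s with
    | measure i p =>
      simp only [Step.action, Action.measure.injEq] at h
      rw [← h.1, ← Pauli.op_single]
      exact ⟨Pauli.op_conjTranspose _, Pauli.op_mul_self _⟩
    | _ => simp [Step.action] at h
  · trivial

theorem pbcAction_proper {N : ℕ} (x : Option (Pauli N × Bool)) : (pbcAction x).Proper := by
  rcases x with _ | ⟨P, p⟩
  · trivial
  · exact ⟨Pauli.op_conjTranspose _, Pauli.op_mul_self _⟩

theorem runStepwise_halt {N : ℕ} (f k : ℕ) (o : List Bool) (A : Op N)
    {act : ℕ → List Bool → Action N} (h : ∀ k o, act k o = .halt) :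
    runStepwise act f k o A = Finsupp.single o A.trace.re := by
  cases f <;> simp [runStepwise, h]

theorem collapse_abs {N : ℕ} (P : Pauli N) (c : Bool) (R : Op N) :
    collapse P.abs.op c R = collapse P.op (xor c P.neg) R := by
  have : P = P.abs.flip P.neg := Pauli.ext' (by simp [Pauli.flip, Pauli.abs]) rfl
  have h : P.op = (if P.neg then -1 else 1 : ℂ) • P.abs.op := by
    conv_lhs => rw [this, Pauli.op_flip]
  have e : eigenproj P.abs.op c = eigenproj P.op (xor c P.neg) := by
    rw [eigenproj, eigenproj, h]
    cases c <;> cases P.neg <;> simp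
  rw [collapse_eq, collapse_eq, e]

/-- The output distribution of a simulation, as a function of the coins. -/
def simDist (steps : ℕ → List Bool → Step (n + t)) (k : ℕ) (st : SimState n t) (fuel : ℕ) (R : Op t)
    (s : List Bool) : Dist :=
  (runStepwise (fun _ m => pbcAction (simulate steps ⟨k, st, m, none⟩ s).query) fuel 0 [] R).mapDomain
    fun m => (simulate steps ⟨k, st, m, none⟩ s).st.out

theorem simDist_zero (k : ℕ) (st : SimState n t) (fuel : ℕ) (s : List Bool) :
    simDist steps k st fuel 0 s = 0 := by
  rw [simDist, runStepwise_zero, Finsupp.mapDomain_zero]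

theorem simDist_smul (k : ℕ) (st : SimState n t) (fuel : ℕ) (s : List Bool) (c : ℝ) (R : Op t) :
    simDist steps k st fuel ((c : ℂ) • R) s = c • simDist steps k st fuel R s := by
  rw [simDist, runStepwise_smul, Finsupp.mapDomain_smul]; rfl

theorem simDist_cons {k : ℕ} {st st' : SimState n t} {b : Bool}
    (h : ∀ m, advance steps ⟨k, st, m, none⟩ b = ⟨k + 1, st', m, none⟩) (fuel : ℕ) (R : Op t)
    (s : List Bool) :
    simDist steps k st fuel R (b :: s) = simDist steps (k + 1) st' fuel R s := by
  simp only [simDist, simulate_cons, h]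

/-- Each query restarts the simulation on a longer string of outcomes. If the present step consumes
the first outcome `c`, then on strings `c :: m` this restart is the simulation from the next step on
`m`. -/
theorem simDist_branch {k : ℕ} {st st' : SimState n t} {b c : Bool}
    (h : ∀ m, advance steps ⟨k, st, c :: m, none⟩ b = ⟨k + 1, st', m, none⟩) (fuel : ℕ) (R : Op t)
    (s : List Bool) :
    (runStepwise (fun _ m => pbcAction (simulate steps ⟨k, st, m, none⟩ (b :: s)).query) fuel 1 [c]
      R).mapDomain (fun m => (simulate steps ⟨k, st, m, none⟩ (b :: s)).st.out) =
      simDist steps (k + 1) st' fuel R s := by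
  rw [show ([c] : List Bool) = [c] ++ [] from rfl, runStepwise_append, ← Finsupp.mapDomain_comp,
    simDist, runStepwise_congr_step _ fuel 1 0]
  have e : ∀ m, simulate steps ⟨k, st, [c] ++ m, none⟩ (b :: s) =
      simulate steps ⟨k + 1, st', m, none⟩ s := by
    intro m; rw [List.singleton_append, simulate_cons, h]
  simp only [e]
  congr 1
  funext m
  rw [Function.comp_apply, e]

/-- Induction on the number of remaining steps. `hmass` says that no mass of the circuit is lost,
and it is inherited by every branch that is followed. `hfuel` says that the queries still allowed
and those already made add up to `t`. -/
theorem simulate_correct (f k : ℕ) (st : SimState n t) (A : Op (n + t)) (R : Op t) (fuel : ℕ)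
    (hv : st.tab.Valid) (hd : st.Describes A R) (hA : A.PosSemidef) (hR : R.PosSemidef)
    (hfuel : fuel + st.tab.measuredPart.length = t)
    (hmass : mass (runStepwise (fun k o => (steps k o).action) f k st.out A) = A.trace.re) :
    runStepwise (fun k o => (steps k o).action) f k st.out A =
      coinAvg f (simDist steps k st fuel R) := by
  have hact : ∀ k o, (steps k o).action.Proper := fun k o => (steps k o).action_proper
  induction f generalizing k st A R fuel with
  | zero =>
    rw [runStepwise, coinAvg, simDist,
      runStepwise_halt (act := fun _ m => pbcAction (simulate steps ⟨k, st, m, none⟩ []).query) _ _ _ _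
        fun _ _ => rfl,
      Finsupp.mapDomain_single, hd.trace_eq]
    rfl
  | succ f ih =>
    -- A branch of probability zero is treated separately; otherwise a postselected outcome of trace
    -- zero would lose positive mass, against `hmass`.
    by_cases h0 : A.trace.re = 0
    · have hR0 : R = 0 := eq_zero_of_trace_re hR (by rw [← hd.trace_eq, h0])
      rw [eq_zero_of_trace_re hA h0, hR0, runStepwise_zero]
      rw [funext (simDist_zero k st fuel), coinAvg_zero]
    · simp only [runStepwise] at hmass ⊢
      rcases hs : (steps k st.out).action with U | ⟨M, post⟩ | _
      · obtain ⟨φ, hφ, hU⟩ := (steps k st.out).gate_eq hs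
        have hp := hact k st.out
        rw [hs] at hmass hp
        simp only at hmass ⊢
        have hadv : ∀ b m, advance steps ⟨k, st, m, none⟩ b =
            ⟨k + 1, ⟨st.out, (steps k st.out).frame ++ st.frame, st.tab⟩, m, none⟩ := by
          intro b m
          rw [advance_none]
          cases hst : steps k st.out <;> first | rfl | simp [hst, Step.action] at hs
        rw [coinAvg_succ_of_eq fun b s => simDist_cons (hadv b) fuel R s]
        refine ih (k + 1) ⟨st.out, (steps k st.out).frame ++ st.frame, st.tab⟩ _ R fuel hv ?_ (hA.mul_mul_conjTranspose_same U) hR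
          hfuel (by rw [trace_gate hp]; exact hmass)
        obtain ⟨B, rfl, hB⟩ := hd
        refine ⟨B, ?_, hB⟩
        rw [hU, frameOp_append]
        simp only [Matrix.conjTranspose_smul, Matrix.conjTranspose_mul, Matrix.smul_mul,
          Matrix.mul_smul, smul_smul]
        rw [mul_comm, hφ, one_smul]
        simp only [mul_assoc]
      · obtain ⟨i, hst⟩ : ∃ i, steps k st.out = .measure i post := by
          cases hst : steps k st.out <;> simp [hst, Step.action] at hs
          exact ⟨_, by rw [hs.2]⟩
        obtain rfl : M = (Pauli.single i .Z).op := by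
          rw [hst] at hs
          simp only [Step.action, Action.measure.injEq] at hs
          rw [← hs.1, Pauli.op_single]
        rw [hs] at hmass
        have hadv : ∀ b m, advance steps ⟨k, st, m, none⟩ b =
            Config.resolve ⟨k, st, m, none⟩ post b (st.measure (.single i .Z)) := by
          intro b m
          rw [advance_none, hst]; rfl
        have spec := SimState.measure_spec hv hd (.single i .Z)
        have valid := SimState.measure_valid hv (.single i .Z)
        have hMH := Pauli.op_conjTranspose (Pauli.single i .Z)
        have hMM := Pauli.op_mul_self (Pauli.single i .Z)
        generalize Pauli.single i .Z = M at *
        have hAb := fun b => collapse_posSemidef hMH hA b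
        simp only [renormalize_eq hMH hA, runStepwise_smul] at hmass ⊢
        -- no mass is lost in the branches
        have hbranch : post = false → ∀ b,
            mass (runStepwise (fun k o => (steps k o).action) f (k + 1) (st.out ++ [b])
              (collapse M.op b A)) = (collapse M.op b A).trace.re := by
          rintro rfl
          have h1 := fun b => mass_runStepwise_le hact f (k + 1) (st.out ++ [b]) (hAb b)
          have h2 := congrArg Complex.re (trace_collapse_add (A := A) hMM)
          have h3 := h1 false
          have h4 := h1 true
          simp only [Bool.false_eq_true, if_false, mass_add, Complex.add_re] at hmass h2
          rintro (_ | _) <;> linarith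
        -- If the trace were zero, the renormalising factor would be `0` and the mass `tr A ≠ 0`
        -- would be lost.
        have hpost : post = true → (collapse M.op false A).trace.re ≠ 0 ∧
            mass (runStepwise (fun k o => (steps k o).action) f (k + 1) (st.out ++ [false])
              (collapse M.op false A)) = (collapse M.op false A).trace.re := by
          rintro rfl
          simp only [if_true, mass_smul] at hmass
          have h1 : (collapse M.op false A).trace.re ≠ 0 := by
            intro h; rw [h, div_zero, zero_mul] at hmass; exact h0 hmass.symm
          refine ⟨h1, ?_⟩
          field_simp at hmass
          exact hmass
        cases hver : st.measure M with
        | coin s =>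
          rw [hver] at spec valid hadv
          simp only at spec valid
          -- The new record describes the doubled branch; linearity turns this into the weight `1/2`
          -- of the coin.
          have key : ∀ b, mass (runStepwise (fun k o => (steps k o).action) f (k + 1)
              (st.out ++ [b]) (collapse M.op b A)) = (collapse M.op b A).trace.re →
              runStepwise (fun k o => (steps k o).action) f (k + 1) (st.out ++ [b])
                (collapse M.op b A) = (1 / 2 : ℝ) • coinAvg f (simDist steps (k + 1) (s b) fuel R) := by
            intro b hb
            have e : (2 : ℂ) = ((2 : ℝ) : ℂ) := by norm_num
            rw [← ih (k + 1) (s b) ((2 : ℂ) • collapse M.op b A) R fuel (valid b).1 (spec b).2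
              (by rw [e]; exact smul_posSemidef (hAb b) (by norm_num)) hR
              (by rw [(valid b).2]; exact hfuel)
              (by rw [(spec b).1, e, runStepwise_smul, mass_smul, hb, Matrix.trace_smul,
                    smul_eq_mul, Complex.re_ofReal_mul]),
              (spec b).1, e, runStepwise_smul, smul_smul]
            norm_num
          cases post with
          | false =>
            simp only [Bool.false_eq_true, if_false]
            rw [key false (hbranch rfl false), key true (hbranch rfl true), ← smul_add, coinAvg]
            simp only [simDist_cons (b := false) (st' := s false) (fun m => by rw [hadv]; rfl),
              simDist_cons (b := true) (st' := s true) (fun m => by rw [hadv]; rfl)]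
          | true =>
            obtain ⟨h1, h2⟩ := hpost rfl
            simp only [if_true]
            rw [key false h2, smul_smul, coinAvg_succ_of_eq (G := simDist steps (k + 1) (s false)
              fuel R) fun b s' => simDist_cons (fun m => by rw [hadv]; cases b <;> rfl) _ _ _]
            -- The doubled branch and `A` both have the trace of `R`, so renormalisation contributes
            -- a factor `2`, which cancels the `1/2`.
            have h3 := congrArg Complex.re ((spec false).2.trace_eq.trans hd.trace_eq.symm)
            rw [Matrix.trace_smul, smul_eq_mul, show (2 : ℂ) = ((2 : ℝ) : ℂ) by norm_num,
              Complex.re_ofReal_mul] at h3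
            rw [← h3]
            field_simp
            simp
        | fixed b =>
          rw [hver] at spec hadv
          simp only at spec
          have hstep : ∀ b', (fun m => advance steps ⟨k, st, m, none⟩ b') = fun m =>
              ⟨k + 1, ⟨st.out ++ [b && !post], st.frame, st.tab⟩, m, none⟩ := by
            intro b'; funext m; rw [hadv]; rfl
          rw [coinAvg_succ_of_eq fun b' s' => simDist_cons (congrFun (hstep b')) fuel R s']
          have key : mass (runStepwise (fun k o => (steps k o).action) f (k + 1)
              (st.out ++ [b && !post]) A) = A.trace.re →
              runStepwise (fun k o => (steps k o).action) f (k + 1) (st.out ++ [b && !post]) A =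
              coinAvg f (simDist steps (k + 1) ⟨st.out ++ [b && !post], st.frame, st.tab⟩ fuel R) :=
            fun hm => ih (k + 1) ⟨st.out ++ [b && !post], st.frame, st.tab⟩ A R fuel hv hd hA hR
              hfuel hm
          cases post with
          | false =>
            simp only [Bool.not_false, Bool.and_true, Bool.false_eq_true, if_false] at key ⊢
            have hb := hbranch rfl b
            rw [spec.1] at hb
            rw [← key hb]
            cases b
            · rw [spec.1, show true = !false from rfl, spec.2, runStepwise_zero, add_zero]
            · rw [spec.1, show false = !true from rfl, spec.2, runStepwise_zero, zero_add]
          | true =>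
            obtain ⟨h1, h2⟩ := hpost rfl
            cases b with
            -- A determined outcome `-1` has no branch `+1` to postselect.
            | true =>
              have := spec.2
              simp only [Bool.not_true] at this
              rw [this] at h1
              simp at h1
            | false =>
              rw [spec.1] at h1 h2 ⊢
              simp only [Bool.not_true, Bool.and_false, if_true] at key ⊢
              rw [← key h2, div_self h1, one_smul]
        | ask P s =>
          rw [hver] at spec valid hadv
          simp only at spec valid
          obtain ⟨D, valid⟩ := valid
          have hlen : ∀ b, (s b).tab.measuredPart.length = st.tab.measuredPart.length + 1 := by
            intro b; rw [(valid b).2]; simp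
          -- The tableau after this query has one more measured pair, and at most `t` of them are
          -- possible; so a query is still allowed.
          obtain ⟨fuel, rfl⟩ : ∃ g, fuel = g + 1 := by
            have := (valid false).1.dual.length_le
            rw [hlen] at this
            exact ⟨fuel - 1, by omega⟩
          have hPH := Pauli.op_conjTranspose P
          have key : ∀ b, mass (runStepwise (fun k o => (steps k o).action) f (k + 1)
              (st.out ++ [b]) (collapse M.op b A)) = (collapse M.op b A).trace.re →
              runStepwise (fun k o => (steps k o).action) f (k + 1) (st.out ++ [b])
                (collapse M.op b A) =
              coinAvg f (simDist steps (k + 1) (s b) fuel (collapse P.op b R)) := by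
            intro b hb
            have := ih (k + 1) (s b) (collapse M.op b A) (collapse P.op b R) fuel (valid b).1
              (spec b).2 (hAb b) (collapse_posSemidef hPH hR b) (by rw [hlen]; omega)
              (by rw [(spec b).1, hb])
            rw [(spec b).1] at this
            exact this
          have hq : ∀ b s', (simulate steps ⟨k, st, [], none⟩ (b :: s')).query =
              some (if post then P else P.abs, post) := by
            intro b s'
            rw [simulate_cons, hadv, simulate_of_query (by rfl)]
            rfl
          cases post with
          | false =>
            simp only [Bool.false_eq_true, if_false] at hq ⊢
            rw [key false (hbranch rfl false), key true (hbranch rfl true)]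
            have hbr := fun (b c : Bool) (R : Op t) (s' : List Bool) =>
              simDist_branch (steps := steps) (k := k) (st := st) (st' := s (xor c P.neg)) (b := b)
                (c := c) (fun m => by rw [hadv]; rfl) fuel R s'
            rw [coinAvg_succ_of_eq (G := fun s' =>
              simDist steps (k + 1) (s false) fuel (collapse P.op false R) s' +
                simDist steps (k + 1) (s true) fuel (collapse P.op true R) s'), coinAvg_add]
            intro b s'
            rw [simDist, runStepwise, hq]
            rw [show pbcAction (some (P.abs, false)) = .measure P.abs.op false from rfl]
            simp only [Bool.false_eq_true, if_false, List.nil_append, zero_add,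
              Finsupp.mapDomain_add, hbr, collapse_abs]
            cases P.neg <;> simp [add_comm]
          | true =>
            obtain ⟨h1, h2⟩ := hpost rfl
            simp only [if_true] at hq ⊢
            have hbr := fun (b : Bool) (R : Op t) (s' : List Bool) =>
              simDist_branch (steps := steps) (k := k) (st := st) (st' := s false) (b := b)
                (c := false) (fun m => by rw [hadv]; rfl) fuel R s'
            rw [key false h2, ← coinAvg_smul]
            refine (coinAvg_succ_of_eq ?_).symm
            intro b s'
            rw [simDist, runStepwise, hq]
            rw [show pbcAction (some (P, true)) = .measure P.op true from rfl]
            simp only [if_true, List.nil_append, zero_add, hbr]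
            -- Both renormalising factors agree, because the record preserves traces before and
            -- after the collapse.
            rw [renormalize_eq hPH hR, simDist_smul, hd.trace_eq, (spec false).2.trace_eq]
      · cases hst : steps k st.out <;> simp [hst, Step.action] at hs

end CliffordPBC
end

noncomputable section
namespace CliffordPBC

variable {n t : ℕ}

/-! ### The initial tableau -/

/-- Add a Pauli on the first lines to a tableau. -/
def addGen (l : Tableau (n + t)) (P : Pauli (n + t)) : Tableau (n + t) :=
  match anticommuting (sweep l P) (headCands n t) with
  | [] => l
  | R :: _ => l.addPair (sweep l P) R

/-- The tableau of a stabiliser state of the first lines. -/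
def initTab (t : ℕ) (S : List (Pauli n)) : Tableau (n + t) :=
  S.foldl (fun l P => addGen l (P.extend t)) []

/-- `± Q₁^{a₁} ⋯ Q_K^{a_K}` for some exponents `a_i ∈ {0,1}`. -/
def InSpan {N : ℕ} (Q : List (Pauli N)) (A : Op N) : Prop :=
  ∃ Q' : List (Pauli N), Q'.Sublist Q ∧
    (A = (Q'.map Pauli.op).prod ∨ A = -(Q'.map Pauli.op).prod)

namespace InSpan

variable {N : ℕ} {Q : List (Pauli N)} {A B : Op N}

theorem mono {Q' : List (Pauli N)} (h : InSpan Q A) (hQ : Q.Sublist Q') : InSpan Q' A := by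
  obtain ⟨L, hL, h⟩ := h
  exact ⟨L, hL.trans hQ, h⟩

theorem neg (h : InSpan Q A) : InSpan Q (-A) := by
  obtain ⟨L, hL, rfl | rfl⟩ := h
  · exact ⟨L, hL, .inr rfl⟩
  · exact ⟨L, hL, .inl (neg_neg _)⟩

theorem one : InSpan Q 1 := ⟨[], List.nil_sublist _, .inl rfl⟩

theorem cons_iff {P : Pauli N} :
    InSpan (P :: Q) A ↔ InSpan Q A ∨ ∃ A', InSpan Q A' ∧ A = P.op * A' := by
  constructor
  · rintro ⟨L, hL, h⟩
    rcases List.sublist_cons_iff.1 hL with hL | ⟨L, rfl, hL'⟩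
    · exact .inl ⟨L, hL, h⟩
    · simp only [List.map_cons, List.prod_cons] at h
      rcases h with rfl | rfl
      · exact .inr ⟨_, ⟨L, hL', .inl rfl⟩, rfl⟩
      · exact .inr ⟨_, ⟨L, hL', .inr rfl⟩, by rw [mul_neg]⟩
  · rintro (⟨L, hL, h⟩ | ⟨_, ⟨L, hL, rfl | rfl⟩, rfl⟩)
    · exact ⟨L, hL.cons _, h⟩
    · exact ⟨P :: L, hL.cons_cons _, .inl (by simp)⟩
    · exact ⟨P :: L, hL.cons_cons _, .inr (by simp)⟩

theorem commute {P : Op N} (hP : ∀ R ∈ Q, Commute P R.op) (h : InSpan Q A) : Commute P A := by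
  obtain ⟨L, hL, h⟩ := h
  have : Commute P (L.map Pauli.op).prod := by
    refine Commute.list_prod_right _ _ fun x hx => ?_
    obtain ⟨R, hR, rfl⟩ := List.mem_map.1 hx
    exact hP R (hL.subset hR)
  rcases h with rfl | rfl
  · exact this
  · exact this.neg_right

/-- Exponents add modulo `2`, as the members commute and have square `1`. -/
theorem mul (hQ : PairwiseCommuting Q) (hA : InSpan Q A) (hB : InSpan Q B) :
    InSpan Q (A * B) := by
  induction Q generalizing A B with
  | nil =>
    obtain ⟨L, hL, hA⟩ := hA
    obtain ⟨L', hL', hB⟩ := hB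
    rw [List.sublist_nil] at hL hL'
    subst hL hL'
    simp only [List.map_nil, List.prod_nil] at hA hB
    rcases hA with rfl | rfl <;> rcases hB with rfl | rfl <;> simp [one, neg]
  | cons P Q ih =>
    rw [PairwiseCommuting, List.pairwise_cons] at hQ
    have hc : ∀ {C}, InSpan Q C → P.op * C = C * P.op := fun h => h.commute hQ.1
    rw [cons_iff] at hA hB ⊢
    rcases hA with hA | ⟨A, hA, rfl⟩ <;> rcases hB with hB | ⟨B, hB, rfl⟩
    · exact .inl (ih hQ.2 hA hB)
    · exact .inr ⟨A * B, ih hQ.2 hA hB, by rw [← mul_assoc, ← hc hA, mul_assoc]⟩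
    · exact .inr ⟨A * B, ih hQ.2 hA hB, by rw [mul_assoc]⟩
    · refine .inl ?_
      rw [mul_assoc, ← mul_assoc A, ← hc hA, ← mul_assoc, ← mul_assoc, Pauli.op_mul_self, one_mul]
      exact ih hQ.2 hA hB

theorem of_mem {P : Pauli N} (h : P ∈ Q) : InSpan Q P.op :=
  ⟨[P], List.singleton_sublist.2 h, .inl (by simp)⟩

end InSpan

theorem tensorState_one_injective {A A' : Op n}
    (h : tensorState A (1 : Op t) = tensorState A' 1) : A = A' := by
  ext x y
  have := congrFun (congrFun h (Fin.append x fun _ => false)) (Fin.append y fun _ => false)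
  have e : ∀ z : Fin n → Bool, (fun j => Fin.append z (fun _ : Fin t => false) (Fin.natAdd n j)) =
      fun _ => false := fun z => funext fun j => Fin.append_right _ _ _
  have e' : ∀ z : Fin n → Bool, (fun i => Fin.append z (fun _ : Fin t => false) (Fin.castAdd t i)) =
      z := fun z => funext fun i => Fin.append_left _ _ _
  simp only [tensorState, Matrix.of_apply, e'] at this
  have h1 : (1 : Op t) (fun j => Fin.append x (fun _ : Fin t => false) (Fin.natAdd n j))
      (fun j => Fin.append y (fun _ : Fin t => false) (Fin.natAdd n j)) = 1 := by
    rw [e x, e y, Matrix.one_apply_eq]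
  rwa [h1, mul_one, mul_one] at this

theorem Pauli.trace_op_head (P : Pauli (n + t)) :
    P.head.op.trace = if P.HeadTrivial then 2 ^ n else 0 := by
  have hl : ∀ a : Letter, a.mat.trace = if a = .I then 2 else 0 := by
    intro a; cases a <;> simp [Letter.mat, Matrix.trace]
  simp only [Pauli.op, head, Bool.false_eq_true, if_false, one_smul, trace_tensorOp, hl]
  split_ifs with h
  · rw [Finset.prod_congr rfl fun i _ => if_pos (h i)]
    simp
  · simp only [HeadTrivial, not_forall] at h
    obtain ⟨i, hi⟩ := h
    exact Finset.prod_eq_zero (Finset.mem_univ i) (if_neg hi)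

/-- The completely mixed state of the first lines gives expectation zero to every Pauli that acts on
them. -/
theorem tracks_nil (ρ : Op t) : Tracks [] (tensorState ((1 / 2 ^ n : ℂ) • (1 : Op n)) ρ) ρ := by
  refine ⟨by simp, fun P _ => ?_⟩
  rw [Pauli.op_eq_tensorState, tensorState_mul, trace_tensorState, mul_smul_comm, mul_one,
    Matrix.trace_smul, Pauli.trace_op_head]
  split_ifs <;> simp

theorem tensorState_posSemidef {σ : Op n} {ρ : Op t} (hσ : σ.PosSemidef) (hρ : ρ.PosSemidef) :
    (tensorState σ ρ).PosSemidef := by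
  rw [tensorState_eq]
  exact (hσ.kronecker hρ).submatrix _

/-- A further generator has the effect of a measurement with outcome `+1` and probability `1/2`.
Thus the input can be built with `Tracks.addPair_head`. -/
theorem stabiliserState_append (L : List (Pauli n)) (S : Pauli n)
    (h : ∀ P ∈ L, Commute P.op S.op) :
    stabiliserState (L ++ [S]) = (2 : ℂ) • collapse S.op false (stabiliserState L) := by
  have hE : eigenproj S.op false = (1 / 2 : ℂ) • (1 + S.op) := by simp [eigenproj]
  have hc : Commute (eigenproj S.op false) (L.map fun P => (1 / 2 : ℂ) • (1 + P.op)).prod := by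
    refine Commute.list_prod_right _ _ fun x hx => ?_
    obtain ⟨P, hP, rfl⟩ := List.mem_map.1 hx
    rw [hE]
    exact ((((Commute.one_left _).add_left ((Commute.one_right _).add_right (h P hP).symm)).smul_left
      _).smul_right _)
  have h2 := eigenproj_mul_self (Pauli.op_mul_self S) false
  rw [collapse_eq, stabiliserState, stabiliserState, Matrix.mul_smul, hc.eq, Matrix.smul_mul,
    mul_assoc, h2, hE]
  simp only [List.map_append, List.map_cons, List.map_nil, List.prod_append, List.prod_cons,
    List.prod_nil, mul_one, List.length_append, List.length_singleton, smul_smul, pow_succ]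
  congr 1
  ring

theorem collapse_extend (S : Pauli n) (σ : Op n) (ρ : Op t) (b : Bool) :
    collapse (S.extend t).op b (tensorState σ ρ) = tensorState (collapse S.op b σ) ρ := by
  have : eigenproj (S.extend t).op b = tensorState (eigenproj S.op b) 1 := by
    rw [eigenproj, eigenproj, Pauli.op_extend, tensorState_smul_left, tensorState_add_left,
      tensorState_smul_left, tensorState_one]
  rw [collapse_eq, collapse_eq, this, tensorState_mul, tensorState_mul, one_mul, mul_one]

theorem tailTrivial_extend (S : Pauli n) : (S.extend t).TailTrivial := fun j => by
  simp [Pauli.extend]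

theorem sym_eq_zero_of_commute {N : ℕ} {P Q : Pauli N} (h : Commute P.op Q.op) :
    P.sym Q = 0 := by
  by_contra h0
  have h1 := Pauli.op_anticommute h0
  rw [h.eq] at h1
  have h2 : Q.op * P.op = 0 := by
    have : (2 : ℂ) • (Q.op * P.op) = 0 := by rw [two_smul]; nth_rw 1 [h1]; simp
    simpa using this
  have h3 : (1 : Op N) = 0 := by
    rw [← Pauli.op_mul_self Q, ← mul_one Q.op, ← Pauli.op_mul_self P, ← mul_assoc Q.op P.op, h2]
    simp
  exact one_ne_zero h3

theorem commute_of_sym {N : ℕ} {P Q : Pauli N} (h : P.sym Q = 0) : Commute P.op Q.op :=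
  Pauli.op_commute h

theorem sym_extend (P Q : Pauli n) : (P.extend t).sym (Q.extend t) = P.sym Q := by
  rw [Pauli.sym_of_tailTrivial (tailTrivial_extend P)]
  exact Pauli.sym_congr (by ext i; simp [Pauli.head, Pauli.extend])
    (by ext i; simp [Pauli.head, Pauli.extend])

/-- Induction on the generators, starting from the completely mixed state. Every swept generator
acts on the first lines only and, by independence, is not `±1`; so it has a partner and `addGen`
does extend the tableau. The conjuncts about the span of the generators and about commutation with
them serve the induction. -/
theorem initTab_spec {S : List (Pauli n)} (hc : PairwiseCommuting S)
    (hi : ∀ L P, L ++ [P] <+: S → ¬ InSpan L P.op) :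
    (initTab t S).Valid ∧ (initTab t S).measuredPart = [] ∧
      (∀ g ∈ initTab t S, ∃ A, InSpan S A ∧ g.1.op = tensorState A 1) ∧
      (∀ P : Pauli (n + t), (∀ Q ∈ S, P.sym (Q.extend t) = 0) →
        ∀ g ∈ initTab t S, P.sym g.1 = 0) ∧
      ∀ ρ : Op t, Tracks (initTab t S) (tensorState (stabiliserState S) ρ) ρ ∧
        (ρ.PosSemidef → (tensorState (stabiliserState S) ρ).PosSemidef) := by
  induction S using List.reverseRecOn with
  | nil =>
    refine ⟨⟨.nil, by simp [initTab], by simp [initTab]⟩, rfl, by simp [initTab],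
      by simp [initTab], fun ρ => ?_⟩
    have : stabiliserState ([] : List (Pauli n)) = (1 / 2 ^ n : ℂ) • 1 := by
      simp [stabiliserState]
    rw [this]
    refine ⟨tracks_nil ρ, fun hρ => ?_⟩
    refine tensorState_posSemidef ?_ hρ
    have e : (1 / 2 ^ n : ℂ) = ((1 / 2 ^ n : ℝ) : ℂ) := by push_cast; rfl
    rw [e]
    exact smul_posSemidef Matrix.PosSemidef.one (by positivity)
  | append_singleton L P ih =>
    have hcL : PairwiseCommuting L := hc.sublist (List.sublist_append_left _ _)
    have hcP : ∀ Q ∈ L, Commute Q.op P.op := fun Q hQ =>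
      (List.pairwise_append.1 hc).2.2 Q hQ P (by simp)
    obtain ⟨hv, hm, hg, hs, hB⟩ := ih hcL fun L' P' h => hi L' P' (h.trans (List.prefix_append _ _))
    have hPL : ∀ Q ∈ L, (P.extend t).sym (Q.extend t) = 0 := fun Q hQ => by
      rw [sym_extend, Pauli.sym_comm]; exact sym_eq_zero_of_commute (hcP Q hQ)
    have hM := hs _ hPL
    have hinit : initTab t (L ++ [P]) = addGen (initTab t L) (P.extend t) := by
      simp [initTab]
    -- the new element
    have hM' : (∀ g ∈ initTab t L, (sweep (initTab t L) (P.extend t)).sym g.1 = 0 ∧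
        (sweep (initTab t L) (P.extend t)).sym g.2 = 0) :=
      fun g hg => ⟨hv.sym_sweep hM g hg, hv.sweep_dual _ g hg⟩
    have hop : ∃ A, InSpan L A ∧
        (sweep (initTab t L) (P.extend t)).op = tensorState (P.op * A) 1 := by
      refine (sweep_induction (l := initTab t L) (M := P.extend t)
        (fun M => (∀ g ∈ initTab t L, M.sym g.1 = 0) ∧
          ∃ A, InSpan L A ∧ M.op = tensorState (P.op * A) 1)
        ⟨hM, 1, .one, by rw [mul_one, Pauli.op_extend]⟩ ?_).2
      rintro M g hgl ⟨hMs, A, hA, hMo⟩ -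
      refine ⟨fun g' hg' => by rw [Pauli.sym_mul_left, hMs g' hg', hv.sym_mem hgl hg', add_zero], ?_⟩
      obtain ⟨A', hA', hgo⟩ := hg g hgl
      exact ⟨A * A', hA.mul hcL hA', by
        rw [Pauli.op_mul_of_commute (hMs g hgl), hMo, hgo, tensorState_mul, mul_one, mul_assoc]⟩
    -- If the swept generator were `±1`, then `P` would be, up to sign, a product of earlier
    -- generators.
    have htt : (sweep (initTab t L) (P.extend t)).TailTrivial →
        anticommuting (sweep (initTab t L) (P.extend t)) (headCands n t) ≠ [] := by
      intro htt he
      obtain ⟨A, hA, hop⟩ := hop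
      rw [op_eq_one_of_trivial (headTrivial_of_cands he) htt, ← tensorState_one,
        ← tensorState_smul_left] at hop
      have h1 := tensorState_one_injective hop
      refine hi L P List.prefix_rfl ?_
      have h2 : A = (if (sweep (initTab t L) (P.extend t)).neg then -1 else 1 : ℂ) • P.op := by
        rw [← one_mul A, ← Pauli.op_mul_self P, mul_assoc, ← h1, Matrix.mul_smul, mul_one]
      split_ifs at h2
      · rw [neg_one_smul] at h2
        have := hA.neg
        rwa [h2, neg_neg] at this
      · rw [one_smul] at h2; rwa [← h2]
    have hswp := fun ρ => (hB ρ).1.sweep hv hM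
    have hsymP : ∀ K : Pauli (n + t), (∀ g ∈ initTab t L, K.sym g.1 = 0) →
        K.sym (P.extend t) = 0 → K.sym (sweep (initTab t L) (P.extend t)) = 0 := by
      intro K hK hKP
      rw [Pauli.sym_comm, sym_sweep fun g hg => by rw [Pauli.sym_comm]; exact hK g hg,
        Pauli.sym_comm, hKP]
    -- As an operator it is the identity on the last lines, so it commutes with every Pauli on a
    -- single one of them, and these detect all letters.
    have htail : (sweep (initTab t L) (P.extend t)).TailTrivial := by
      intro j
      have : ∀ a, (sweep (initTab t L) (P.extend t)).sym (.single (Fin.natAdd n j) a) = 0 := by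
        intro a
        obtain ⟨A, -, hA⟩ := hop
        refine sym_eq_zero_of_commute ?_
        have hht : (Pauli.single (Fin.natAdd n j) a : Pauli (n + t)).HeadTrivial := by
          intro i
          simp only [Pauli.single]
          rw [Function.update_of_ne]
          intro e
          have := congrArg Fin.val e
          simp only [Fin.val_natAdd, Fin.val_castAdd] at this
          omega
        rw [hA, Pauli.op_of_headTrivial hht]
        simp [Commute, SemiconjBy, tensorState_mul]
      exact Letter.eq_I_of_sym (by rw [← Pauli.sym_single]; exact this _)
        (by rw [← Pauli.sym_single]; exact this _)
    rcases hcand : anticommuting (sweep (initTab t L) (P.extend t)) (headCands n t) with _ | ⟨R, m⟩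
    · exact absurd hcand (htt htail)
    obtain ⟨hR, hRs⟩ := mem_of_anticommuting hcand
    have hRt := tailTrivial_of_mem_headCands hR
    have htab : initTab t (L ++ [P]) =
        (initTab t L).addPair (sweep (initTab t L) (P.extend t)) R := by
      rw [hinit, addGen, hcand]
    rw [htab]
    generalize sweep (initTab t L) (P.extend t) = M' at *
    have hflip : M'.flip false = M' := Pauli.ext' (by simp [Pauli.flip]) rfl
    refine ⟨hv.addPair hM' hRs (.inl hRt), ?_, ?_, ?_, fun ρ => ?_⟩
    · simp only [Tableau.measuredPart, Tableau.addPair, List.filter_append, List.map_append] at hm ⊢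
      rw [hm, List.filter_cons_of_neg (by simpa using not_headTrivial_of_sym hRt hRs)]
      rfl
    · simp only [Tableau.addPair, List.mem_append, List.mem_singleton]
      rintro g (hgl | rfl)
      · obtain ⟨A, hA, h⟩ := hg g hgl
        exact ⟨A, hA.mono (List.sublist_append_left _ _), h⟩
      · obtain ⟨A, hA, h⟩ := hop
        exact ⟨P.op * A, (InSpan.of_mem (by simp)).mul hc (hA.mono (List.sublist_append_left _ _)), h⟩
    · intro K hK
      have hKL := hs K fun Q hQ => hK Q (by simp [hQ])
      simp only [Tableau.addPair, List.mem_append, List.mem_singleton]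
      rintro g (hgl | rfl)
      · exact hKL g hgl
      · exact hsymP K hKL (hK P (by simp))
    · have hst : tensorState (stabiliserState (L ++ [P])) ρ =
          (2 : ℂ) • collapse (P.extend t).op false (tensorState (stabiliserState L) ρ) := by
        rw [stabiliserState_append L P hcP, tensorState_smul_left, collapse_extend]
      constructor
      · have := (hB ρ).1.addPair_head hv hM' hRs hRt false
        rw [hflip] at this
        convert this using 1
        rw [hst]
        congr 1
        have e1 : eigenproj (P.extend t).op false * tensorState (stabiliserState L) ρ =
            eigenproj M'.op false * tensorState (stabiliserState L) ρ := by
          simp only [eigenproj, Matrix.smul_mul, add_mul, (hswp ρ).1]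
        have e2 : tensorState (stabiliserState L) ρ * eigenproj (P.extend t).op false =
            tensorState (stabiliserState L) ρ * eigenproj M'.op false := by
          simp only [eigenproj, Matrix.mul_smul, mul_add, (hswp ρ).2]
        rw [collapse_eq, collapse_eq, e1, mul_assoc, e2, mul_assoc]
      · intro hρ
        rw [hst, show (2 : ℂ) = ((2 : ℝ) : ℂ) by norm_num]
        exact smul_posSemidef (collapse_posSemidef (Pauli.op_conjTranspose _) ((hB ρ).2 hρ) _)
          (by norm_num)

theorem Independent.not_inSpan {S : List (Pauli n)} (h : Independent S) (L : List (Pauli n))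
    (P : Pauli n) (hL : L ++ [P] <+: S) : ¬ InSpan L P.op := by
  obtain ⟨L', rfl⟩ := hL
  intro hP
  refine h ⟨L.length, by simp⟩ ?_
  have e1 : (L ++ [P] ++ L').eraseIdx L.length = L ++ L' := by
    rw [List.append_assoc, List.eraseIdx_append_of_length_le le_rfl]; simp
  have e2 : (L ++ [P] ++ L').get ⟨L.length, by simp⟩ = P := by simp
  rw [DependentOn, e2, e1]
  exact hP.mono (List.sublist_append_left _ _)

end CliffordPBC
end

noncomputable section
namespace CliffordPBC

variable {n t : ℕ} {steps : ℕ → List Bool → Step (n + t)}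

/-! ### The measurements of the simulation -/

/-- A simulation step either makes no use of the available outcomes, or it measures a Pauli on the
last lines. -/
theorem advance_cases (k : ℕ) {st : SimState n t} (hv : st.tab.Valid) (b : Bool) :
    (∃ st' : SimState n t, st'.tab.Valid ∧ st'.tab.measuredPart = st.tab.measuredPart ∧
      ∀ m, advance steps ⟨k, st, m, none⟩ b = ⟨k + 1, st', m, none⟩) ∨
    ∃ (i : Fin (n + t)) (post : Bool) (P : Pauli t) (D : Pauli t) (st' : Bool → SimState n t),
      steps k st.out = .measure i post ∧
      advance steps ⟨k, st, [], none⟩ b = ⟨k, st, [], some (P, post)⟩ ∧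
      ∀ c, (st' c).tab.Valid ∧
        (∃ P' : Pauli t, P'.letter = P.letter ∧
          (st' c).tab.measuredPart = st.tab.measuredPart ++ [(P', D)]) ∧
        ∀ m, advance steps ⟨k, st, c :: m, none⟩ b = ⟨k + 1, st' c, m, none⟩ := by
  by_cases hst : ∃ i post, steps k st.out = .measure i post
  · obtain ⟨i, post, hst⟩ := hst
    have hadv : ∀ m, advance steps ⟨k, st, m, none⟩ b =
        Config.resolve ⟨k, st, m, none⟩ post b (st.measure (.single i .Z)) := by
      intro m
      rw [advance_none, hst]; rfl
    have valid := SimState.measure_valid hv (.single i .Z)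
    cases hver : st.measure (.single i .Z) with
    | coin s =>
      rw [hver] at valid hadv
      exact .inl ⟨_, (valid _).1, (valid _).2, hadv⟩
    | fixed c =>
      rw [hver] at hadv
      exact .inl ⟨⟨st.out ++ [c && !post], st.frame, st.tab⟩, hv, rfl, hadv⟩
    | ask P s =>
      rw [hver] at valid hadv
      obtain ⟨D, valid⟩ := valid
      refine .inr ⟨i, post, if post then P else P.abs, D, fun c => s (!post && xor c P.neg), hst,
        hadv [], fun c => ⟨(valid _).1, ⟨_, ?_, (valid _).2⟩, fun m => hadv (c :: m)⟩⟩
      cases post <;> rfl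
  · refine .inl ⟨⟨st.out, (steps k st.out).frame ++ st.frame, st.tab⟩, hv, rfl, fun m => ?_⟩
    rw [advance_none]
    cases h : steps k st.out with
    | measure i post => exact absurd ⟨i, post, h⟩ hst
    | _ => rfl

/-- The measurements of a simulation, as a function of the outcomes. -/
def simNext (steps : ℕ → List Bool → Step (n + t)) (k : ℕ) (st : SimState n t) (s m : List Bool) :
    Option (Pauli t × Bool) :=
  (simulate steps ⟨k, st, m, none⟩ s).query

theorem simNext_cons_of_advance {k : ℕ} {st st' : SimState n t} {b : Bool} {m m' : List Bool}
    (h : advance steps ⟨k, st, m, none⟩ b = ⟨k + 1, st', m', none⟩) (s : List Bool) :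
    simNext steps k st (b :: s) m = simNext steps (k + 1) st' s m' := by
  rw [simNext, simulate_cons, h]; rfl

theorem simNext_cons_of_query {k : ℕ} {st : SimState n t} {b : Bool} {x : Pauli t × Bool}
    (h : advance steps ⟨k, st, [], none⟩ b = ⟨k, st, [], some x⟩) (s : List Bool) :
    simNext steps k st (b :: s) [] = some x := by
  rw [simNext, simulate_cons, h, simulate_of_query (by rfl)]

theorem measured_cons {N : ℕ} {next : List Bool → Option (Pauli N × Bool)} {x : Pauli N × Bool}
    (h : next [] = some x) (b : Bool) (o : List Bool) :
    measured next (b :: o) = x.1 :: measured (fun m => next (b :: m)) o := by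
  rw [measured, List.length_cons, List.range_succ_eq_map, List.filterMap_cons]
  simp [h, measured, List.filterMap_map, Function.comp_def]

theorem Reachable.tail {N : ℕ} {next : List Bool → Option (Pauli N × Bool)} {b : Bool}
    {o : List Bool} (h : Reachable next (b :: o)) : Reachable (fun m => next (b :: m)) o :=
  fun k hk => h (k + 1) (by simpa using hk)

/-- Along a branch every query adds itself, up to sign, with a partner to the measured part, which
remains a dual system. Comparing letters suffices, since signs matter neither for commutation nor
for independence. -/
theorem simNext_dual (s : List Bool) (k : ℕ) {st : SimState n t} (hv : st.tab.Valid) (o : List Bool)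
    (ho : Reachable (simNext steps k st s) o) :
    ∃ l : Tableau t, (st.tab.measuredPart ++ l).Dual ∧ l.length = o.length ∧
      l.map (fun g => g.1.letter) = (measured (simNext steps k st s) o).map Pauli.letter := by
  rcases o with _ | ⟨c, o⟩
  · exact ⟨[], by simpa using hv.dual, rfl, rfl⟩
  induction s generalizing k st c o with
  | nil => exact absurd (ho 0 (by simp)) (by simp [simNext, simulate])
  | cons b s ih =>
    rcases advance_cases (steps := steps) k hv b with ⟨st', hv', hm, h⟩ | ⟨i, post, P, D, st', -, h0, h⟩
    · rw [show simNext steps k st (b :: s) = simNext steps (k + 1) st' s from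
        funext fun m => simNext_cons_of_advance (h m) s] at ho ⊢
      rw [← hm]
      exact ih _ hv' _ _ ho
    · rw [measured_cons (simNext_cons_of_query h0 s)]
      have ho' := ho.tail
      obtain ⟨hv', ⟨P', hP', hm⟩, hadv⟩ := h c
      rw [show (fun m => simNext steps k st (b :: s) (c :: m)) = simNext steps (k + 1) (st' c) s from
        funext fun m => simNext_cons_of_advance (hadv m) s] at ho' ⊢
      have key : ∃ l : Tableau t, ((st' c).tab.measuredPart ++ l).Dual ∧ l.length = o.length ∧
          l.map (fun g => g.1.letter) =
            (measured (simNext steps (k + 1) (st' c) s) o).map Pauli.letter := by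
        rcases o with _ | ⟨c', o⟩
        · exact ⟨[], by simpa using hv'.dual, rfl, rfl⟩
        · exact ih _ hv' _ _ ho'
      obtain ⟨l, hl, hlen, hlet⟩ := key
      rw [hm, List.append_assoc] at hl
      exact ⟨(P', D) :: l, hl, by simp [hlen], by simp [hP', hlet]⟩

theorem Tableau.Dual.sublist {l l' : Tableau t} (h : l.Dual) (hl : l'.Sublist l) : l'.Dual :=
  ⟨h.pairwise.sublist hl, fun g hg => h.diag g (hl.subset hg)⟩

theorem Tableau.Dual.sym_of_ne {l : Tableau t} (h : l.Dual) {i j : ℕ} (hi : i < l.length)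
    (hj : j < l.length) (hij : i ≠ j) : l[i].1.sym l[j].1 = 0 ∧ l[i].1.sym l[j].2 = 0 := by
  have := List.pairwise_iff_getElem.1 h.pairwise
  rcases lt_or_gt_of_ne hij with hlt | hlt
  · exact ⟨(this i j hi hj hlt).1, (this i j hi hj hlt).2.1⟩
  · obtain ⟨a, b, c⟩ := this j i hj hi hlt
    exact ⟨by rw [Pauli.sym_comm]; exact a, by rw [Pauli.sym_comm]; exact c⟩

/-- Paulis with partners commute and are independent. -/
theorem Tableau.Dual.independent {l : Tableau t} (h : l.Dual) {Q : List (Pauli t)}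
    (hQ : l.map (fun g => g.1.letter) = Q.map Pauli.letter) :
    PairwiseCommuting Q ∧ Independent Q := by
  have hlen : l.length = Q.length := by simpa using congrArg List.length hQ
  have hget : ∀ i (hi : i < Q.length), Q[i].letter = (l[i]'(by omega)).1.letter := fun i hi => by
    have := List.getElem_of_eq hQ (i := i) (by simpa [hlen] using hi)
    simpa using this.symm
  constructor
  · rw [PairwiseCommuting, List.pairwise_iff_getElem]
    intro i j hi hj hij
    refine commute_of_sym ?_
    rw [Pauli.sym_congr (hget i hi) (hget j hj)]
    exact (h.sym_of_ne (by omega) (by omega) hij.ne).1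
  · intro i hdep
    have hi : i.1 < l.length := by omega
    -- The partner commutes with all other members, hence with their span, but it anticommutes with
    -- the member itself.
    have hc : ∀ R ∈ Q.eraseIdx i, Commute (l[i.1]).2.op R.op := by
      intro R hR
      obtain ⟨j, hj, hji, rfl⟩ := List.mem_eraseIdx_iff_getElem.1 hR
      have hj' : j < l.length := by omega
      refine commute_of_sym ?_
      rw [Pauli.sym_comm, Pauli.sym_congr (hget j hj) rfl]
      exact (h.sym_of_ne hj' hi hji).2
    have h0 := sym_eq_zero_of_commute (InSpan.commute hc hdep)
    rw [Pauli.sym_comm, List.get_eq_getElem, Pauli.sym_congr (hget i i.2) rfl,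
      h.diag _ (List.getElem_mem _)] at h0
    exact absurd h0 (by decide)

theorem simNext_isPBC (s : List Bool) (k : ℕ) {st : SimState n t} (hv : st.tab.Valid) :
    IsPBC (simNext steps k st s) := fun o ho => by
  obtain ⟨l, hl, hlen, hlet⟩ := simNext_dual s k hv o ho
  have hl' := hl.sublist (List.sublist_append_right _ l)
  obtain ⟨h1, h2⟩ := hl'.independent hlet
  exact ⟨h1, h2, hlen ▸ hl'.length_le⟩

/-! ### Postselection -/

/-- From step `K` on there is no postselection. -/
def NoPostFrom (steps : ℕ → List Bool → Step (n + t)) (K : ℕ) : Prop :=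
  ∀ k ≥ K, ∀ o i, steps k o ≠ .measure i true

/-- Before step `K` all measurements are postselected. -/
def PostUntil (steps : ℕ → List Bool → Step (n + t)) (K : ℕ) : Prop :=
  ∀ k < K, ∀ o i, steps k o ≠ .measure i false

theorem simNext_noPost {K : ℕ} (hK : NoPostFrom steps K) (s : List Bool) {k : ℕ} (hk : K ≤ k)
    {st : SimState n t} (hv : st.tab.Valid) (m : List Bool) (P : Pauli t) :
    simNext steps k st s m ≠ some (P, true) := by
  induction s generalizing k st m with
  | nil => simp [simNext, simulate]
  | cons b s ih =>
    rcases advance_cases (steps := steps) k hv b with ⟨st', hv', -, h⟩ |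
      ⟨i, post, P', D, st', hst, h0, h⟩
    · rw [simNext_cons_of_advance (h m)]
      exact ih (by omega) hv' m
    · rcases m with _ | ⟨c, m⟩
      · rw [simNext_cons_of_query h0]
        intro e
        simp only [Option.some.injEq, Prod.mk.injEq] at e
        exact hK k hk _ i (e.2 ▸ hst)
      · rw [simNext_cons_of_advance ((h c).2.2 m)]
        exact ih (by omega) (h c).1 m

/-- A query without postselection comes from a step at or after `K`; with more outcomes the
simulation only moves on from there, and no postselection is left. -/
theorem simNext_postFirst {K : ℕ} (hK : NoPostFrom steps K) (hK' : PostUntil steps K)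
    (s : List Bool) (k : ℕ) {st : SimState n t} (hv : st.tab.Valid) (m m' : List Bool)
    (P P' : Pauli t) (h : simNext steps k st s m = some (P, false)) :
    simNext steps k st s (m ++ m') ≠ some (P', true) := by
  induction s generalizing k st m with
  | nil => simp [simNext, simulate]
  | cons b s ih =>
    rcases advance_cases (steps := steps) k hv b with ⟨st', hv', -, ha⟩ |
      ⟨i, post, P₁, D, st', hst, h0, ha⟩
    · rw [simNext_cons_of_advance (ha m)] at h
      rw [simNext_cons_of_advance (ha _)]
      exact ih _ hv' m h
    · rcases m with _ | ⟨c, m⟩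
      · have h' := h
        rw [simNext_cons_of_query h0] at h'
        simp only [Option.some.injEq, Prod.mk.injEq] at h'
        have hk : K ≤ k := not_lt.1 fun hk => hK' k hk _ i (h'.2 ▸ hst)
        exact simNext_noPost hK _ hk hv _ _
      · rw [simNext_cons_of_advance ((ha c).2.2 m)] at h
        rw [List.cons_append, simNext_cons_of_advance ((ha c).2.2 _)]
        exact ih _ (ha c).1 m h

theorem postFirst_of_simNext {K : ℕ} (hK : NoPostFrom steps K) (hK' : PostUntil steps K)
    (s : List Bool) (k : ℕ) {st : SimState n t} (hv : st.tab.Valid) :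
    PostFirst fun _ o => pbcAction (simNext steps k st s o) := by
  rintro _ o M h _ o' M' - ⟨m', rfl⟩ h'
  rcases e : simNext steps k st s o with _ | ⟨P, p⟩ <;>
    simp only [e, pbcAction, Action.measure.injEq, reduceCtorEq] at h
  rcases e' : simNext steps k st s (o ++ m') with _ | ⟨P', p'⟩ <;>
    simp only [e', pbcAction, Action.measure.injEq, reduceCtorEq] at h'
  rw [h.2] at e
  rw [h'.2] at e'
  exact simNext_postFirst hK hK' s k hv o m' P P' e e'

theorem postFirst_of_steps {K : ℕ} (hK : NoPostFrom steps K) (hK' : PostUntil steps K) :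
    PostFirst fun k o => (steps k o).action := by
  intro k o M h k' o' M' hkk' _ h'
  have h1 : ∃ i, steps k o = .measure i false := by
    cases hs : steps k o <;> simp [hs, Step.action] at h
    exact ⟨_, by rw [h.2]⟩
  have h2 : ∃ i, steps k' o' = .measure i true := by
    cases hs : steps k' o' <;> simp [hs, Step.action] at h'
    exact ⟨_, by rw [h'.2]⟩
  obtain ⟨i, h1⟩ := h1
  obtain ⟨i', h2⟩ := h2
  rcases lt_or_ge k K with hk | hk
  · exact hK' k hk o i h1
  · exact hK k' (by omega) o' i' h2

/-! ### Simulation of non-adaptive circuits -/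

/-! ### Independence of signs. -/

section letters

variable {N : ℕ}

/-- Equality up to sign. -/
def Pauli.Like (P Q : Pauli N) : Prop := P.letter = Q.letter

/-- Equality of tableaux up to signs. -/
def Tableau.Like (l l' : Tableau N) : Prop :=
  List.Forall₂ (fun g h => g.1.Like h.1 ∧ g.2.Like h.2) l l'

theorem Pauli.Like.refl (P : Pauli N) : P.Like P := rfl

theorem Pauli.Like.sym_eq {P P' Q Q' : Pauli N} (h : P.Like P') (h' : Q.Like Q') :
    P.sym Q = P'.sym Q' := Pauli.sym_congr h h'

theorem Pauli.Like.mul {P P' Q Q' : Pauli N} (h : P.Like P') (h' : Q.Like Q') :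
    (P.mul Q).Like (P'.mul Q') := by
  simp only [Like, Pauli.mul] at *
  rw [h, h']

/-- All case distinctions are decided by `sym`, which does not see signs; so inputs that agree up to
sign are treated in the same way. -/
theorem pull_like {l l' : List (Pauli N)} (hl : List.Forall₂ Pauli.Like l l') {M M' : Pauli N}
    (h : M.Like M') : (pull l M).Like (pull l' M') := by
  induction hl generalizing M M' with
  | nil => exact h
  | cons hP _ ih =>
    refine ih ?_
    rw [Pauli.conj, Pauli.conj, h.sym_eq hP]
    split_ifs
    · exact h.mul hP
    · exact h

theorem sweep_like {l l' : Tableau N} (hl : l.Like l') {M M' : Pauli N}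
    (h : M.Like M') : (sweep l M).Like (sweep l' M') := by
  induction hl generalizing M M' with
  | nil => exact h
  | cons hP _ ih =>
    rw [sweep_cons, sweep_cons]
    refine ih ?_
    rw [h.sym_eq hP.2]
    split_ifs
    · exact h.mul hP.1
    · exact h

theorem anticommuting_like {l l' : List (Pauli N)} (hl : List.Forall₂ Pauli.Like l l')
    {M M' : Pauli N} (h : M.Like M') :
    List.Forall₂ Pauli.Like (anticommuting M l) (anticommuting M' l') := by
  induction hl with
  | nil => exact .nil
  | @cons P P' l l' hP hl ih =>
    simp only [anticommuting, List.filter_cons, h.sym_eq hP] at ih ⊢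
    split_ifs
    · exact .cons hP ih
    · exact ih

theorem forall₂_like_refl (l : List (Pauli N)) : List.Forall₂ Pauli.Like l l :=
  List.forall₂_same.2 fun P _ => Pauli.Like.refl P

theorem Tableau.Like.addPair {l l' : Tableau N} (hl : l.Like l') {M M' R R' : Pauli N}
    (h : M.Like M') (h' : R.Like R') : (l.addPair M R).Like (l'.addPair M' R') := by
  refine List.rel_append hl (.cons ⟨h, sweep_like ?_ h'⟩ .nil)
  rw [Tableau.Like, List.forall₂_map_left_iff, List.forall₂_map_right_iff]
  exact hl.imp fun _ _ h => h.symm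

end letters

/-- Records that differ only in signs and the values of outcomes. -/
structure SimState.Like (st st' : SimState n t) : Prop where
  out : st.out.length = st'.out.length
  frame : List.Forall₂ Pauli.Like st.frame st'.frame
  tab : st.tab.Like st'.tab

/-- Verdicts that differ only in signs. -/
inductive Verdict.Like : Verdict n t → Verdict n t → Prop
  | coin {s s' : Bool → SimState n t} (h : ∀ b b', (s b).Like (s' b')) : Like (.coin s) (.coin s')
  | ask {P P' : Pauli t} {s s' : Bool → SimState n t} (hP : P.Like P')
      (h : ∀ b b', (s b).Like (s' b')) : Like (.ask P s) (.ask P' s')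
  | fixed (b b' : Bool) : Like (.fixed b) (.fixed b')

theorem SimState.Like.refl (st : SimState n t) : st.Like st :=
  ⟨rfl, forall₂_like_refl _, List.forall₂_same.2 fun _ _ => ⟨rfl, rfl⟩⟩

/-- The lists of anticommuting candidates agree up to sign, hence are empty simultaneously and start
with the same Pauli up to sign. So the verdicts are of the same kind. -/
theorem SimState.Like.measure {st st' : SimState n t} (h : st.Like st') (M : Pauli (n + t)) :
    Verdict.Like (st.measure M) (st'.measure M) := by
  have hp := pull_like h.frame (.refl M)
  have hs := sweep_like h.tab hp
  simp only [SimState.measure]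
  generalize pull st.frame M = M₁ at *
  generalize pull st'.frame M = M₂ at *
  have hext : ∀ {K K' : Pauli (n + t)}, K.Like K' → ∀ b b',
      (st.extend (sweep st.tab M₁) K b).Like (st'.extend (sweep st'.tab M₂) K' b') :=
    fun hK b b' => ⟨by simp [extend, h.out], h.frame, h.tab.addPair hs hK⟩
  have htab : List.Forall₂ Pauli.Like (st.tab.map Prod.fst) (st'.tab.map Prod.fst) := by
    rw [List.forall₂_map_left_iff, List.forall₂_map_right_iff]
    exact h.tab.imp fun _ _ h => h.1
  have h1 := anticommuting_like htab hp
  rcases e1 : anticommuting M₁ (st.tab.map Prod.fst) with _ | ⟨Q, m⟩ <;>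
    rcases e1' : anticommuting M₂ (st'.tab.map Prod.fst) with _ | ⟨Q', m'⟩ <;>
    rw [e1, e1'] at h1
  · have h2 := anticommuting_like (forall₂_like_refl (headCands n t)) hs
    rcases e2 : anticommuting (sweep st.tab M₁) (headCands n t) with _ | ⟨R, m⟩ <;>
      rcases e2' : anticommuting (sweep st'.tab M₂) (headCands n t) with _ | ⟨R', m'⟩ <;>
      rw [e2, e2'] at h2
    · have h3 := anticommuting_like (forall₂_like_refl (tailCands n t)) hs
      rcases e3 : anticommuting (sweep st.tab M₁) (tailCands n t) with _ | ⟨R, m⟩ <;>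
        rcases e3' : anticommuting (sweep st'.tab M₂) (tailCands n t) with _ | ⟨R', m'⟩ <;>
        rw [e3, e3'] at h3
      · exact .fixed _ _
      · cases h3
      · cases h3
      · cases h3 with
        | cons h3 _ =>
          refine .ask ?_ (hext h3)
          simp only [Pauli.Like, Pauli.tail] at *
          rw [hs]
    · cases h2
    · cases h2
    · cases h2 with
      | cons h2 _ => exact .coin (hext h2)
  · cases h1
  · cases h1
  · cases h1 with
    | cons h1 _ =>
      exact .coin fun b b' => ⟨by simp [rotate, h.out],
        List.rel_append h.frame (.cons (hp.mul h1) .nil), h.tab⟩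

/-- Configurations that differ only in signs and the values of outcomes, and before step `K` only
in the values of available outcomes. -/
structure Config.Like (K : ℕ) (c c' : Config n t) : Prop where
  pos : c.pos = c'.pos
  st : c.st.Like c'.st
  input : c.input.length = c'.input.length
  query : c.query = c'.query
  st_eq : c.pos < K → c.st = c'.st

/-- Before step `K` all measurements are postselected and their outcomes are recorded as `+1`
whatever the available values are; so the records remain equal and signed queries agree. From `K` on
the queries carry no sign, and agreement up to signs suffices. -/
theorem Config.Like.advance {K : ℕ} (hK : NoPostFrom steps K) (hK' : PostUntil steps K)
    (hna : ∀ k o o', o.length = o'.length → steps k o = steps k o') {c c' : Config n t}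
    (h : c.Like K c') (b : Bool) :
    (advance steps c b).Like K (CliffordPBC.advance steps c' b) := by
  obtain ⟨k, st, m, q⟩ := c
  obtain ⟨k', st', m', q'⟩ := c'
  obtain ⟨rfl, hst, hm, rfl, heq⟩ := h
  simp only at hst hm heq
  unfold CliffordPBC.advance
  split_ifs with hq
  · exact ⟨rfl, hst, hm, rfl, heq⟩
  obtain rfl : q = none := by simpa using hq
  simp only
  rw [← hna k st.out st'.out hst.out]
  cases hs : steps k st.out with
  | measure i post =>
    simp only [Config.advanceStep]
    rcases lt_or_ge k K with hk | hk
    · obtain rfl := heq hk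
      obtain rfl : post = true := by
        cases post
        · exact absurd hs (hK' k hk _ _)
        · rfl
      rcases st.measure (.single i .Z) with s | ⟨P, s⟩ | c
      · exact ⟨rfl, by simpa [Config.resolve] using .refl _, hm, rfl,
          fun _ => by simp [Config.resolve]⟩
      · rcases m with _ | ⟨x, m⟩ <;> rcases m' with _ | ⟨x', m'⟩
        · exact ⟨rfl, .refl _, hm, rfl, fun _ => rfl⟩
        · simp at hm
        · simp at hm
        · exact ⟨rfl, by simpa [Config.resolve] using .refl _, Nat.succ.inj hm, rfl,
            fun _ => by simp [Config.resolve]⟩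
      · exact ⟨rfl, .refl _, hm, rfl, fun _ => rfl⟩
    · have hlt : ¬ k < K := not_lt.2 hk
      obtain rfl : post = false := by
        cases post
        · rfl
        · exact absurd hs (hK k hk _ _)
      have hver := hst.measure (.single i .Z)
      generalize st.measure (.single i .Z) = v at hver ⊢
      generalize st'.measure (.single i .Z) = v' at hver ⊢
      rcases hver with h | ⟨hP, h⟩ | ⟨x, x'⟩
      · exact ⟨rfl, h _ _, hm, rfl, fun h => by simp [Config.resolve] at h; omega⟩
      · rcases m with _ | ⟨x, m⟩ <;> rcases m' with _ | ⟨x', m'⟩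
        · refine ⟨rfl, hst, hm, ?_, fun h => absurd h hlt⟩
          simp only [Config.resolve, Bool.false_eq_true, if_false]
          congr 2
          exact Pauli.ext' rfl hP
        · simp at hm
        · simp at hm
        · exact ⟨rfl, h _ _, Nat.succ.inj hm, rfl,
            fun h => by simp [Config.resolve] at h; omega⟩
      · exact ⟨rfl, ⟨by simp [Config.resolve, hst.out], hst.frame, hst.tab⟩, hm, rfl,
          fun h => by simp [Config.resolve] at h; omega⟩
  | _ =>
    refine ⟨rfl, ⟨hst.out, List.rel_append (forall₂_like_refl _) hst.frame, hst.tab⟩, hm, rfl,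
      fun h => ?_⟩
    obtain rfl := heq (by simp [Config.advanceStep] at h; omega)
    rfl

theorem simNext_nonAdaptive {K : ℕ} (hK : NoPostFrom steps K) (hK' : PostUntil steps K)
    (hna : ∀ k o o', o.length = o'.length → steps k o = steps k o') (k : ℕ) (st : SimState n t)
    (s : List Bool) {m m' : List Bool} (hm : m.length = m'.length) :
    simNext steps k st s m = simNext steps k st s m' := by
  have : ∀ {c c' : Config n t}, c.Like K c' → (simulate steps c s).Like K (simulate steps c' s) := by
    induction s with
    | nil => exact id
    | cons b s ih => exact fun h => ih (h.advance hK hK' hna b)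
  exact (this (c := ⟨k, st, m, none⟩) (c' := ⟨k, st, m', none⟩)
    ⟨rfl, .refl _, hm, rfl, fun _ => rfl⟩).query

end CliffordPBC
end

noncomputable section
namespace CliffordPBC

/-! ## Complexity of the simulation -/

theorem encNat_injective : Function.Injective encNat := fun a b h => by
  have := congrArg Val.size h
  rw [size_encNat, size_encNat] at this
  omega

theorem encLetter_injective : Function.Injective encLetter := by
  intro a b h
  cases a <;> cases b <;> first | rfl | exact absurd (encNat_injective h) (by decide)

def encPair {N : ℕ} (g : Pauli N × Pauli N) : Val := .pair (encPauli g.1) (encPauli g.2)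

abbrev encTab {N : ℕ} (l : Tableau N) : Val := encList encPair l

theorem size_encPauli_le {N : ℕ} (P : Pauli N) : (encPauli P).size ≤ 8 * N + 5 := by
  have h1 := size_encBool_le P.neg
  have h2 := size_encList_le (e := encLetter) (l := List.ofFn P.letter) (B := 7) fun a _ => by
    cases a <;> simp [encLetter, encNat, Val.size]
  simp only [List.length_ofFn] at h2
  simp only [encPauli, Val.size]
  omega

namespace PolyTime

variable {α : Type} {inp : α → Val} {N : α → ℕ} {P Q : ∀ a, Pauli (N a)}

section pauli

theorem pauli_mk {neg : α → Bool} {f : ∀ a, Fin (N a) → Letter}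
    (hN : PolyTime inp fun a => encNat (N a)) (hneg : PolyTime inp fun a => encBool (neg a))
    (hf : PolyTime (fun x : Σ a, Fin (N a) => .pair (inp x.1) (encNat x.2))
      fun x => encLetter (f x.1 x.2)) :
    PolyTime inp fun a => encPauli (⟨neg a, f a⟩ : Pauli (N a)) :=
  hneg.pair (hN.ofFn (et := fun _ => encLetter) hf)

theorem pauli_neg (hP : PolyTime inp fun a => encPauli (P a)) :
    PolyTime inp fun a => encBool (P a).neg := hP.fst

theorem pauli_letter {j : ∀ a, Fin (N a)} (hP : PolyTime inp fun a => encPauli (P a))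
    (hj : PolyTime inp fun a => encNat (j a)) :
    PolyTime inp fun a => encLetter ((P a).letter (j a)) :=
  lookup (et := fun _ => encLetter) hP.snd hj

theorem letters_comp {f g : α → Letter} (hf : PolyTime inp fun a => encLetter (f a))
    (hg : PolyTime inp fun a => encLetter (g a)) (F : Letter → Letter → Val) :
    PolyTime inp fun a => F (f a) (g a) :=
  finite_comp (f := fun a => (f a, g a)) (e := fun p => .pair (encLetter p.1) (encLetter p.2))
    (by
      rintro ⟨a, b⟩ ⟨a', b'⟩ h
      simp only [Val.pair.injEq] at h
      rw [encLetter_injective h.1, encLetter_injective h.2])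
    (hf.pair hg) fun p => F p.1 p.2

variable (hN : PolyTime inp fun a => encNat (N a)) (hP : PolyTime inp fun a => encPauli (P a))
  (hQ : PolyTime inp fun a => encPauli (Q a))
include hN hP

theorem pauli_flip {b : α → Bool} (hb : PolyTime inp fun a => encBool (b a)) :
    PolyTime inp fun a => encPauli ((P a).flip (b a)) :=
  pauli_mk hN (hP.pauli_neg.xor hb) (pauli_letter (hP.weaken Sigma.fst) psnd)

theorem pauli_abs : PolyTime inp fun a => encPauli (P a).abs :=
  pauli_mk hN (const (encBool false)) (pauli_letter (hP.weaken Sigma.fst) psnd)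

include hQ

/-- The sum over the lines is a fold whose accumulator lives in the finite type `ZMod 4`, so its
addition and `F` are finite tables. The bound `7` is the size of the numeral `3`. -/
theorem pauli_phase (F : ZMod 4 → Val) : PolyTime inp fun a => F ((P a).phase (Q a)) := by
  have e4 : Function.Injective fun x : ZMod 4 => encNat x.val :=
    encNat_injective.comp (ZMod.val_injective 4)
  refine finite_comp e4 ?_ F
  have h1 := hN.ofFn (τ := fun _ => ZMod 4) (et := fun _ x => encNat x.val)
    (f := fun a j => ((P a).letter j).phase ((Q a).letter j))
    (letters_comp (pauli_letter (hP.weaken Sigma.fst) psnd)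
      (pauli_letter (hQ.weaken Sigma.fst) psnd) fun a b => encNat (a.phase b).val)
  refine (foldl (σ := fun _ => ZMod 4) (es := fun _ x => encNat x.val) (init := fun _ => 0)
    (step := fun _ x y => x + y) h1 (const (encNat 0)) ?_ ⟨7, fun a m _ => ?_⟩).congr fun a => ?_
  · refine finite_comp (f := fun x : Σ _ : α, ZMod 4 × ZMod 4 => x.2)
      (e := fun p => .pair (encNat p.1.val) (encNat p.2.val)) ?_ psnd fun p => encNat (p.1 + p.2).val
    rintro ⟨a, b⟩ ⟨a', b'⟩ h
    simp only [Val.pair.injEq] at h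
    rw [e4 h.1, e4 h.2]
  · rw [size_encNat]
    have := ZMod.val_lt (m.foldl (· + ·) (0 : ZMod 4))
    simp only [Polynomial.eval_ofNat]
    omega
  · rw [← List.sum_eq_foldl, List.sum_ofFn]; rfl

theorem pauli_sym : PolyTime inp fun a => encBool (decide ((P a).sym (Q a) = 1)) :=
  (pauli_phase hN hP hQ fun x =>
    encBool (decide (ZMod.castHom (by norm_num : 2 ∣ 4) (ZMod 2) x = 1))).congr fun a => by
      rw [Pauli.castHom_phase]

theorem pauli_mul : PolyTime inp fun a => encPauli ((P a).mul (Q a)) :=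
  pauli_mk hN ((hP.pauli_neg.xor hQ.pauli_neg).xor
    (pauli_phase hN hP hQ fun x => encBool (decide (x = 1) || decide (x = 2))))
    (letters_comp (pauli_letter (hP.weaken Sigma.fst) psnd)
      (pauli_letter (hQ.weaken Sigma.fst) psnd) fun a b => encLetter (a.mul b))

theorem pauli_conj : PolyTime inp fun a => encPauli ((P a).conj (Q a)) :=
  ((pauli_sym hN hP hQ).ite (pauli_mul hN hP hQ) hP).congr fun a => by
    simp only [Pauli.conj, decide_eq_true_eq]
    split <;> rfl

end pauli

theorem pauli_single {i : ∀ a, Fin (N a)} (hN : PolyTime inp fun a => encNat (N a))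
    (hi : PolyTime inp fun a => encNat (i a)) (c : Letter) :
    PolyTime inp fun a => encPauli (.single (i a) c) := by
  refine pauli_mk hN (const (encBool false)) ?_
  refine ((psnd.eqNat (k := fun x : Σ a, Fin (N a) => (i x.1 : ℕ)) (hi.weaken Sigma.fst)).ite
    (const (encLetter c)) (const (encLetter .I))).congr fun x => ?_
  by_cases h : x.2 = i x.1
  · simp [h]
  · have : ¬ (x.2 : ℕ) = i x.1 := fun e => h (Fin.ext e)
    simp [h, this]

/-! ### Tableaux -/

variable {l : ∀ a, Tableau (N a)} {L : ∀ a, List (Pauli (N a))}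

theorem pull (hN : PolyTime inp fun a => encNat (N a))
    (hL : PolyTime inp fun a => encList encPauli (L a))
    (hP : PolyTime inp fun a => encPauli (P a)) :
    PolyTime inp fun a => encPauli (CliffordPBC.pull (L a) (P a)) := by
  obtain ⟨q, hq⟩ := hN.out_size
  exact foldl (et := fun _ => encPauli) (es := fun _ => encPauli) (step := fun a => Pauli.conj) hL hP
    (pauli_conj (hN.weaken Sigma.fst) psnd.fst psnd.snd)
    ⟨8 * q + 5, fun a m _ => (size_encPauli_le _).trans (by
      have := hq a
      rw [size_encNat] at this
      simp only [Polynomial.eval_add, Polynomial.eval_mul, Polynomial.eval_ofNat]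
      omega)⟩

theorem sweep (hN : PolyTime inp fun a => encNat (N a)) (hl : PolyTime inp fun a => encTab (l a))
    (hP : PolyTime inp fun a => encPauli (P a)) :
    PolyTime inp fun a => encPauli (CliffordPBC.sweep (l a) (P a)) := by
  obtain ⟨q, hq⟩ := hN.out_size
  refine foldl (σ := fun a => Pauli (N a)) (τ := fun a => Pauli (N a) × Pauli (N a))
    (et := fun _ => encPair) (es := fun _ => encPauli) (l := l) (init := P)
    (step := fun a M g => if M.sym g.2 = 1 then M.mul g.1 else M) hl hP ?_
    ⟨8 * q + 5, fun a m _ => (size_encPauli_le _).trans (by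
      have := hq a
      rw [size_encNat] at this
      simp only [Polynomial.eval_add, Polynomial.eval_mul, Polynomial.eval_ofNat]
      omega)⟩
  refine ((pauli_sym (hN.weaken Sigma.fst) psnd.fst psnd.snd.snd).ite
    (pauli_mul (hN.weaken Sigma.fst) psnd.fst psnd.snd.fst) psnd.fst).congr fun x => ?_
  simp only [decide_eq_true_eq]
  split <;> rfl

theorem tab_fst (hl : PolyTime inp fun a => encTab (l a)) :
    PolyTime inp fun a => encList encPauli ((l a).map Prod.fst) :=
  map (et' := fun _ => encPauli) (f := fun _ => Prod.fst) hl psnd.fst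

theorem tab_swap (hl : PolyTime inp fun a => encTab (l a)) :
    PolyTime inp fun a => encTab ((l a).map Prod.swap) :=
  map (et' := fun _ => encPair) (f := fun _ => Prod.swap) hl
    (pair (out := fun x : Σ a, Pauli (N a) × Pauli (N a) => encPauli x.2.2) psnd.snd psnd.fst)

theorem addPair (hN : PolyTime inp fun a => encNat (N a)) (hl : PolyTime inp fun a => encTab (l a))
    (hP : PolyTime inp fun a => encPauli (P a)) (hQ : PolyTime inp fun a => encPauli (Q a)) :
    PolyTime inp fun a => encTab ((l a).addPair (P a) (Q a)) :=
  append (et := fun _ => encPair) hl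
    ((hP.pair (sweep hN hl.tab_swap hQ)).pair nil)

theorem anticommuting (hN : PolyTime inp fun a => encNat (N a))
    (hL : PolyTime inp fun a => encList encPauli (L a))
    (hP : PolyTime inp fun a => encPauli (P a)) :
    PolyTime inp fun a => encList encPauli (CliffordPBC.anticommuting (P a) (L a)) :=
  filter (et := fun _ => encPauli) (p := fun a R => decide ((P a).sym R = 1)) hL
    (pauli_sym (hN.weaken Sigma.fst) (hP.weaken Sigma.fst) psnd)

section lines

variable {n t : α → ℕ} (hn : PolyTime inp fun a => encNat (n a))
  (ht : PolyTime inp fun a => encNat (t a))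
include hn ht

theorem headCands : PolyTime inp fun a => encList encPauli (CliffordPBC.headCands (n a) (t a)) := by
  have h1 := hn.ofFn (τ := fun a => Fin (n a)) (et := fun _ i => encNat i) (f := fun a i => i) psnd
  refine (flatMap (et' := fun _ => encPauli) (f := fun a i => [.single (Fin.castAdd (t a) i) .X,
    .single (Fin.castAdd (t a) i) .Z]) h1 ?_).congr fun a => by
      rw [show List.ofFn (fun i => i) = List.finRange _ from List.ofFn_id _]; rfl
  have hN := (hn.add ht).weaken (v := fun x : Σ a, Fin (n a) => encNat x.2) Sigma.fst
  exact (pauli_single (i := fun x : Σ a, Fin (n a) => Fin.castAdd (t x.1) x.2) hN psnd _).pair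
    ((pauli_single (i := fun x : Σ a, Fin (n a) => Fin.castAdd (t x.1) x.2) hN psnd _).pair nil)

theorem tailCands : PolyTime inp fun a => encList encPauli (CliffordPBC.tailCands (n a) (t a)) := by
  have h1 := ht.ofFn (τ := fun a => Fin (t a)) (et := fun _ i => encNat i) (f := fun a i => i) psnd
  refine (flatMap (et' := fun _ => encPauli) (f := fun a i => [.single (Fin.natAdd (n a) i) .X,
    .single (Fin.natAdd (n a) i) .Z]) h1 ?_).congr fun a => by
      rw [show List.ofFn (fun i => i) = List.finRange _ from List.ofFn_id _]; rfl
  have hN := (hn.add ht).weaken (v := fun x : Σ a, Fin (t a) => encNat x.2) Sigma.fst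
  have hi : PolyTime (fun x : Σ a, Fin (t a) => .pair (inp x.1) (encNat x.2))
    (fun x => encNat (Fin.natAdd (n x.1) x.2)) := ((hn.weaken Sigma.fst).add psnd)
  exact (pauli_single (i := fun x : Σ a, Fin (t a) => Fin.natAdd (n x.1) x.2) hN hi _).pair
    ((pauli_single (i := fun x : Σ a, Fin (t a) => Fin.natAdd (n x.1) x.2) hN hi _).pair nil)

theorem pauli_tail {P : ∀ a, Pauli (n a + t a)} (hP : PolyTime inp fun a => encPauli (P a)) :
    PolyTime inp fun a => encPauli (P a).tail :=
  pauli_mk ht hP.pauli_neg (pauli_letter (j := fun x : Σ a, Fin (t a) => Fin.natAdd (n x.1) x.2)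
    (hP.weaken Sigma.fst) ((hn.weaken Sigma.fst).add psnd))

omit hn in
theorem pauli_extend {P : ∀ a, Pauli (n a)} (hP : PolyTime inp fun a => encPauli (P a)) :
    PolyTime inp fun a => encPauli ((P a).extend (t a)) := by
  have h1 := append (et := fun _ => encLetter) hP.snd (replicate (et := fun _ => encLetter)
    (x := fun _ => .I) ht (const _))
  refine (hP.pauli_neg.pair h1).congr fun a => ?_
  rw [encPauli, Pauli.extend, List.ofFn_fin_append, List.ofFn_const]

theorem addGen {l : ∀ a, Tableau (n a + t a)} {P : ∀ a, Pauli (n a + t a)}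
    (hl : PolyTime inp fun a => encTab (l a)) (hP : PolyTime inp fun a => encPauli (P a)) :
    PolyTime inp fun a => encTab (CliffordPBC.addGen (l a) (P a)) := by
  have hN := hn.add ht
  have hM := sweep hN hl hP
  let φ : {x : Σ a, Pauli (n a + t a) × List (Pauli (n a + t a)) //
      CliffordPBC.anticommuting (CliffordPBC.sweep (l x.1) (P x.1))
        (CliffordPBC.headCands (n x.1) (t x.1)) = x.2.1 :: x.2.2} → α := fun x => x.1.1
  refine caseList (et := fun _ => encPauli) (anticommuting hN (headCands hn ht) hM)
    (hl.restrict.congr fun a => ?_)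
    ((addPair (hN.weaken φ) (hl.weaken φ) (hM.weaken φ) psnd.fst).congr fun x => ?_)
  · rw [CliffordPBC.addGen, a.2]
  · rw [CliffordPBC.addGen, x.2]

theorem initTab {S : ∀ a, List (Pauli (n a))} (hS : PolyTime inp fun a => encList encPauli (S a)) :
    PolyTime inp fun a => encTab (CliffordPBC.initTab (t a) (S a)) := by
  have hN := hn.add ht
  obtain ⟨q, hq⟩ := hN.out_size
  obtain ⟨q', hq'⟩ := hS.out_size
  refine foldl (et := fun _ => encPauli) (es := fun _ => encTab) (init := fun _ => [])
    (step := fun a l P => CliffordPBC.addGen l (P.extend (t a))) hS nil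
    (addGen (hn.weaken Sigma.fst) (ht.weaken Sigma.fst) psnd.fst
      (pauli_extend (ht.weaken Sigma.fst) psnd.snd))
    -- A generator adds at most one pair. A Pauli on `N` lines has size at most `8N + 5`, so a pair
    -- has size at most `16N + 11`.
    ⟨q' * (16 * q + 12) + 1, fun a m hm => ?_⟩
  have hlen : ∀ (m : List (Pauli (n a))) (l : Tableau (n a + t a)),
      (m.foldl (fun l P => CliffordPBC.addGen l (P.extend (t a))) l).length ≤
        l.length + m.length := by
    intro m
    induction m with
    | nil => simp
    | cons P m ih =>
      intro l
      refine (ih _).trans ?_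
      have : (CliffordPBC.addGen l (P.extend (t a))).length ≤ l.length + 1 := by
        rw [CliffordPBC.addGen]
        split <;> simp [Tableau.addPair]
      simp only [List.length_cons]
      omega
  have h1 := hlen m []
  have h2 := hm.length_le
  have h3 := (length_lt_size_encList (e := encPauli) (S a)).le.trans (hq' a)
  have h4 := hq a
  rw [size_encNat] at h4
  refine (size_encList_le (B := 16 * (n a + t a) + 11) fun g _ => ?_).trans ?_
  · rw [encPair]
    have := size_encPauli_le g.1
    have := size_encPauli_le g.2
    simp only [Val.size]
    omega
  · simp only [Polynomial.eval_add, Polynomial.eval_mul, Polynomial.eval_ofNat, Polynomial.eval_one]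
    simp only [List.length_nil, zero_add] at h1
    gcongr ?_ * ?_ + 1 <;> omega

end lines

end PolyTime

end CliffordPBC
end

/-! ### Polynomial time of one simulated step. -/

noncomputable section
namespace CliffordPBC

def encState {n t : ℕ} (st : SimState n t) : Val :=
  .pair (encBits st.out) (.pair (encList encPauli st.frame) (encTab st.tab))

def encConfig {n t : ℕ} (c : Config n t) : Val :=
  .pair (encNat c.pos) (.pair (encState c.st) (.pair (encBits c.input) (encNext c.query)))

def Step.tag {N : ℕ} : Step N → ℕ
  | .skip => 0
  | .H _ => 1
  | .S _ => 2
  | .CX _ _ _ => 3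
  | .measure _ _ => 4

theorem SimState.measure_eq_ask {n t : ℕ} {st : SimState n t} {M R : Pauli (n + t)}
    {l : List (Pauli (n + t))} (h1 : anticommuting (pull st.frame M) (st.tab.map Prod.fst) = [])
    (h2 : anticommuting (sweep st.tab (pull st.frame M)) (headCands n t) = [])
    (h3 : anticommuting (sweep st.tab (pull st.frame M)) (tailCands n t) = R :: l) :
    st.measure M = .ask (sweep st.tab (pull st.frame M)).tail
      (st.extend (sweep st.tab (pull st.frame M)) R) := by
  rw [measure, h1]
  simp only
  rw [h2]
  simp only
  rw [h3]

namespace PolyTime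

variable {α β : Type} {inp out : α → Val}

/-- Computation on a part of the domain on which some data are available. -/
theorem withData {D : α → Type} {ed : ∀ a, D a → Val} {R : ∀ a, D a → Prop} {d : α → Val}
    (h : PolyTime (fun x : {x : Σ a, D a // R x.1 x.2} => .pair (inp x.1.1) (ed x.1.1 x.1.2))
      fun x => out x.1.1)
    (hd : PolyTime inp d) (φ : β → α) (hφ : ∀ b, ∃ y, R (φ b) y ∧ d (φ b) = ed (φ b) y) :
    PolyTime (fun b => inp (φ b)) fun b => out (φ b) := by
  choose y hy hdy using hφ
  refine (refl.pair ((hd.reindex φ).congr hdy)).comp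
    (h.reindex fun b => ⟨⟨φ b, y b⟩, hy b⟩)

/-- The tag is compared with `0`, `1`, `2` and `3` in turn, which leaves the measurements. The other
component is decoded only once the tag has fixed its format. -/
theorem caseStep {N : α → ℕ} {g : ∀ a, Step (N a)} (hg : PolyTime inp fun a => encStep (g a))
    (hskip : PolyTime (fun a : {a // g a = .skip} => inp a) fun a => out a)
    (hH : PolyTime (fun x : {x : Σ a, Fin (N a) // g x.1 = .H x.2} =>
      .pair (inp x.1.1) (encNat x.1.2)) fun x => out x.1.1)
    (hS : PolyTime (fun x : {x : Σ a, Fin (N a) // g x.1 = .S x.2} =>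
      .pair (inp x.1.1) (encNat x.1.2)) fun x => out x.1.1)
    (hCX : PolyTime (fun x : {x : Σ a, Fin (N a) × Fin (N a) // ∃ h, g x.1 = .CX x.2.1 x.2.2 h} =>
      .pair (inp x.1.1) (.pair (encNat x.1.2.1) (encNat x.1.2.2))) fun x => out x.1.1)
    (hM : PolyTime (fun x : {x : Σ a, Fin (N a) × Bool // g x.1 = .measure x.2.1 x.2.2} =>
      .pair (inp x.1.1) (.pair (encNat x.1.2.1) (encBool x.1.2.2))) fun x => out x.1.1) :
    PolyTime inp out := by
  let dat : ∀ {N : ℕ}, Step N → Val := fun g => match g with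
    | .skip => .nil
    | .H i => encNat i
    | .S i => encNat i
    | .CX c d _ => .pair (encNat c) (encNat d)
    | .measure i post => .pair (encNat i) (encBool post)
  have he : ∀ {N : ℕ} (g : Step N), encStep g = .pair (encNat g.tag) (dat g) := by
    intro N g; cases g <;> rfl
  have hg' : PolyTime inp fun a => .pair (encNat (g a).tag) (dat (g a)) :=
    hg.congr fun a => he _
  have htag := fun j => hg'.fst.eqNat (const (encNat j))
  have hd := hg'.snd
  refine (htag 0).caseBool ?_ (hskip.reindex fun a : {a // decide ((g a).tag = 0) = true} =>
    ⟨a.1, ?_⟩)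
  · refine (htag 1).restrict.caseBool ?_ (withData
      (D := fun a => Fin (N a)) (ed := fun _ i => encNat i) (R := fun a i => g a = .H i) hH hd _ ?_)
    · refine (htag 2).restrict.restrict.caseBool ?_ (withData
        (D := fun a => Fin (N a)) (ed := fun _ i => encNat i) (R := fun a i => g a = .S i) hS hd _ ?_)
      · refine (htag 3).restrict.restrict.restrict.caseBool (withData
          (D := fun a => Fin (N a) × Bool) (ed := fun _ p => .pair (encNat p.1) (encBool p.2)) (R := fun a p => g a = .measure p.1 p.2)
          hM hd _ ?_) (withData
          (D := fun a => Fin (N a) × Fin (N a)) (ed := fun _ p => .pair (encNat p.1) (encNat p.2)) (R := fun a p => ∃ h, g a = .CX p.1 p.2 h)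
          hCX hd _ ?_)
        · rintro ⟨⟨⟨⟨a, h0⟩, h1⟩, h2⟩, h3⟩
          simp only at h0 h1 h2 h3 ⊢
          cases h : g a <;> simp [h, Step.tag] at h0 h1 h2 h3
          exact ⟨(_, _), rfl, rfl⟩
        · rintro ⟨⟨⟨⟨a, h0⟩, h1⟩, h2⟩, h3⟩
          simp only at h0 h1 h2 h3 ⊢
          cases h : g a <;> simp [h, Step.tag] at h0 h1 h2 h3
          exact ⟨(_, _), ⟨‹_›, rfl⟩, rfl⟩
      · rintro ⟨⟨⟨a, h0⟩, h1⟩, h2⟩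
        simp only at h0 h1 h2 ⊢
        cases h : g a <;> simp [h, Step.tag] at h0 h1 h2
        exact ⟨_, rfl, rfl⟩
    · rintro ⟨⟨a, h0⟩, h1⟩
      simp only at h0 h1 ⊢
      cases h : g a <;> simp [h, Step.tag] at h0 h1
      exact ⟨_, rfl, rfl⟩
  · obtain ⟨a, h0⟩ := a
    simp only at h0 ⊢
    cases h : g a <;> simp [h, Step.tag] at h0
    rfl

theorem step_frame {N : α → ℕ} {g : ∀ a, Step (N a)} (hN : PolyTime inp fun a => encNat (N a))
    (hg : PolyTime inp fun a => encStep (g a)) :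
    PolyTime inp fun a => encList encPauli (g a).frame := by
  refine caseStep hg (nil.congr fun a => by rw [a.2]; rfl) ?_ ?_ ?_
    (nil.congr fun a => by rw [a.2]; rfl)
  · let φ : {x : Σ a, Fin (N a) // g x.1 = .H x.2} → α := fun x => x.1.1
    have h1 := fun c => pauli_single (i := fun x : {x : Σ a, Fin (N a) // g x.1 = .H x.2} => x.1.2)
      (hN.weaken φ) psnd c
    exact ((h1 .Z).pair ((h1 .Z).pair ((h1 .Y).pair nil))).congr fun x => by rw [x.2]; rfl
  · let φ : {x : Σ a, Fin (N a) // g x.1 = .S x.2} → α := fun x => x.1.1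
    have h1 := fun c => pauli_single (i := fun x : {x : Σ a, Fin (N a) // g x.1 = .S x.2} => x.1.2)
      (hN.weaken φ) psnd c
    exact ((pauli_flip (hN.weaken φ) (h1 .Z) (const (encBool true))).pair nil).congr fun x => by
      rw [x.2]; rfl
  · let T := {x : Σ a, Fin (N a) × Fin (N a) // ∃ h, g x.1 = .CX x.2.1 x.2.2 h}
    let φ : T → α := fun x => x.1.1
    have hN' := hN.weaken (v := fun x : T => .pair (encNat x.1.2.1) (encNat x.1.2.2)) φ
    have h1 := fun c => pauli_single (i := fun x : T => x.1.2.1) hN' psnd.fst c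
    have h2 := fun c => pauli_single (i := fun x : T => x.1.2.2) hN' psnd.snd c
    exact ((pauli_flip hN' (h1 .Z) (const (encBool true))).pair
      ((pauli_flip hN' (h2 .X) (const (encBool true))).pair
      ((pauli_mul hN' (h1 .Z) (h2 .X)).pair nil))).congr fun x => by
        obtain ⟨h, e⟩ := x.2
        rw [e]; rfl

section config

variable {n t : α → ℕ} (hn : PolyTime inp fun a => encNat (n a))
  (ht : PolyTime inp fun a => encNat (t a)) {st : ∀ a, SimState (n a) (t a)}
  (hst : PolyTime inp fun a => encState (st a)) {b post coin : α → Bool}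
  (hb : PolyTime inp fun a => encBool (b a)) (hpost : PolyTime inp fun a => encBool (post a))
  (hcoin : PolyTime inp fun a => encBool (coin a))
  {M Q : ∀ a, Pauli (n a + t a)} (hM : PolyTime inp fun a => encPauli (M a))
  (hQ : PolyTime inp fun a => encPauli (Q a))
  {pos : α → ℕ} (hpos : PolyTime inp fun a => encNat (pos a))
  {m : α → List Bool} (hm : PolyTime inp fun a => encBits (m a))

include hst in
theorem state_frame : PolyTime inp fun a => encList encPauli (st a).frame := hst.snd.fst

include hst in
theorem state_tab : PolyTime inp fun a => encTab (st a).tab := hst.snd.snd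

include hst hb in
theorem out_append : PolyTime inp fun a => encBits ((st a).out ++ [b a]) :=
  append (et := fun _ => encBool) hst.fst (hb.pair nil)

include hn ht hst hb hM hQ

theorem state_rotate : PolyTime inp fun a => encState ((st a).rotate (M a) (Q a) (b a)) :=
  (out_append hst hb).pair ((append (et := fun _ => encPauli)
    (l' := fun a => [((M a).mul (Q a)).flip (!b a)]) hst.state_frame
    ((pauli_flip (hn.add ht) (pauli_mul (hn.add ht) hM hQ) hb.not).pair nil)).pair hst.state_tab)

theorem state_extend : PolyTime inp fun a => encState ((st a).extend (M a) (Q a) (b a)) :=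
  (out_append hst hb).pair (hst.state_frame.pair
    (addPair (hn.add ht) hst.state_tab (pauli_flip (hn.add ht) hM hb) hQ))

omit hb
include hpost hpos hm

theorem resolve_ask : PolyTime inp fun a =>
    encConfig (Config.resolve ⟨pos a, st a, m a, none⟩ (post a) (coin a)
      (.ask (M a).tail ((st a).extend (M a) (Q a)))) := by
  have htail := pauli_tail hn ht hM
  refine caseList (et := fun _ => encBool) hm ?_ ?_
  · refine (PolyTime.restrict (((hpos.pair (hst.pair (nil.pair ((hpost.ite htail
      (pauli_abs ht htail)).pair hpost))))))).congr fun x => ?_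
    rw [x.2]
    simp only [Config.resolve, encConfig, encNext]
    congr 4
    split <;> rfl
  · let φ : {x : Σ a, Bool × List Bool // m x.1 = x.2.1 :: x.2.2} → α := fun x => x.1.1
    refine ((((hpos.succ.weaken φ)).pair ((state_extend (hn.weaken φ)
      (ht.weaken φ) (hst.weaken φ)
      ((hpost.not.weaken φ).and (psnd.fst.xor (htail.pauli_neg.weaken φ)))
      (hM.weaken φ) (hQ.weaken φ)).pair
      (psnd.snd.pair nil)))).congr fun y => ?_
    rw [y.2]
    rfl

omit hQ
include hcoin

set_option maxHeartbeats 1600000 in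
theorem resolve_measure : PolyTime inp fun a =>
    encConfig (Config.resolve ⟨pos a, st a, m a, none⟩ (post a) (coin a) ((st a).measure (M a))) := by
  have hN := hn.add ht
  have hcp := hcoin.and hpost.not
  have h1 := pull hN hst.state_frame hM
  have h2 := sweep hN hst.state_tab h1
  refine caseList (et := fun _ => encPauli) (anticommuting hN hst.state_tab.tab_fst h1) ?_ ?_
  swap
  · let φ : {x : Σ a, Pauli (n a + t a) × List (Pauli (n a + t a)) //
      CliffordPBC.anticommuting (CliffordPBC.pull (st x.1).frame (M x.1))
        ((st x.1).tab.map Prod.fst) = x.2.1 :: x.2.2} → α := fun x => x.1.1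
    refine ((hpos.weaken φ).succ.pair ((state_rotate (hn.weaken φ) (ht.weaken φ) (hst.weaken φ)
      (hcp.weaken φ) (h1.weaken φ) psnd.fst).pair ((hm.weaken φ).pair nil))).congr fun x => ?_
    rw [SimState.measure, x.2]; rfl
  refine caseList (et := fun _ => encPauli) (anticommuting hN (headCands hn ht) h2).restrict ?_ ?_
  swap
  · let φ : {x : Σ a : {a // CliffordPBC.anticommuting (CliffordPBC.pull (st a).frame (M a))
        ((st a).tab.map Prod.fst) = []}, Pauli (n a + t a) × List (Pauli (n a + t a)) //
      CliffordPBC.anticommuting (CliffordPBC.sweep (st x.1).tab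
        (CliffordPBC.pull (st x.1).frame (M x.1))) (CliffordPBC.headCands (n x.1) (t x.1)) =
          x.2.1 :: x.2.2} → α := fun x => x.1.1
    refine ((hpos.weaken φ).succ.pair ((state_extend (hn.weaken φ) (ht.weaken φ) (hst.weaken φ)
      (hcp.weaken φ) (h2.weaken φ) psnd.fst).pair ((hm.weaken φ).pair nil))).congr fun x => ?_
    rw [SimState.measure, x.1.1.2]; simp only; rw [x.2]; rfl
  refine caseList (et := fun _ => encPauli) (anticommuting hN (tailCands hn ht) h2).restrict.restrict
    ?_ ?_
  · have h3 := (hpos.succ.pair (((out_append hst (h2.pauli_neg.and hpost.not)).pair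
      (hst.state_frame.pair hst.state_tab)).pair (hm.pair nil)))
    refine h3.restrict.restrict.restrict.congr fun x => ?_
    rw [SimState.measure, x.1.1.2]; simp only; rw [x.1.2]; simp only; rw [x.2]; rfl
  let φ : {x : Σ a : {a : {a // CliffordPBC.anticommuting (CliffordPBC.pull (st a).frame (M a))
        ((st a).tab.map Prod.fst) = []} //
      CliffordPBC.anticommuting (CliffordPBC.sweep (st a).tab
        (CliffordPBC.pull (st a).frame (M a))) (CliffordPBC.headCands (n a) (t a)) = []},
        Pauli (n a + t a) × List (Pauli (n a + t a)) //
      CliffordPBC.anticommuting (CliffordPBC.sweep (st x.1).tab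
        (CliffordPBC.pull (st x.1).frame (M x.1))) (CliffordPBC.tailCands (n x.1) (t x.1)) =
          x.2.1 :: x.2.2} → α := fun x => x.1.1
  refine (resolve_ask (coin := fun x => coin (φ x)) (hn.weaken φ) (ht.weaken φ) (hst.weaken φ)
    (hpost.weaken φ) (h2.weaken φ) psnd.fst (hpos.weaken φ) (hm.weaken φ)).congr fun x => ?_
  rw [SimState.measure_eq_ask x.1.1.1.2 x.1.1.2 x.2]

end config

end PolyTime

end CliffordPBC
end

/-! ### Size bounds and polynomial time of the simulation loop. -/

noncomputable section
namespace CliffordPBC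

theorem Config.resolve_query {n t : ℕ} (c : Config n t) (post coin : Bool) (v : Verdict n t) :
    c.resolve post coin v = Config.resolve ⟨c.pos, c.st, c.input, none⟩ post coin v := by
  cases v <;> rfl

/-- Bounds for the sizes of the components of a configuration. -/
structure Config.Bounded {n t : ℕ} (c : Config n t) (p o f l i : ℕ) : Prop where
  pos : c.pos ≤ p
  out : c.st.out.length ≤ o
  frame : c.st.frame.length ≤ f
  tab : c.st.tab.length ≤ l
  input : c.input.length ≤ i

theorem SimState.measure_bounded {n t : ℕ} (st : SimState n t) (M : Pauli (n + t)) :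
    match st.measure M with
    | .coin s => ∀ b, (s b).out.length = st.out.length + 1 ∧
        (s b).frame.length ≤ st.frame.length + 1 ∧ (s b).tab.length ≤ st.tab.length + 1
    | .ask _ s => ∀ b, (s b).out.length = st.out.length + 1 ∧
        (s b).frame.length ≤ st.frame.length + 1 ∧ (s b).tab.length ≤ st.tab.length + 1
    | .fixed _ => True := by
  simp only [measure]
  rcases anticommuting (pull st.frame M) (st.tab.map Prod.fst) with _ | ⟨Q, m⟩
  · rcases anticommuting (sweep st.tab (pull st.frame M)) (headCands n t) with _ | ⟨R, m⟩
    · rcases anticommuting (sweep st.tab (pull st.frame M)) (tailCands n t) with _ | ⟨R, m⟩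
      · trivial
      · simp [extend, Tableau.addPair]
    · simp [extend, Tableau.addPair]
  · simp [rotate]

/-- A gate adds at most three rotations, a measurement at most one rotation or one pair. Available
outcomes are only consumed. -/
theorem Config.Bounded.advance {n t : ℕ} {steps : ℕ → List Bool → Step (n + t)} {c : Config n t}
    {p o f l i : ℕ} (h : c.Bounded p o f l i) (b : Bool) :
    (advance steps c b).Bounded (p + 1) (o + 1) (f + 3) (l + 1) i := by
  obtain ⟨h1, h2, h3, h4, h5⟩ := h
  unfold CliffordPBC.advance
  split_ifs
  · exact ⟨by omega, by omega, by omega, by omega, h5⟩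
  cases steps c.pos c.st.out with
  | measure j post =>
    simp only [Config.advanceStep]
    have hb := c.st.measure_bounded (.single j .Z)
    generalize c.st.measure (.single j .Z) = v at hb ⊢
    rcases v with s | ⟨P, s⟩ | x
    · obtain ⟨e1, e2, e3⟩ := hb (b && !post)
      exact ⟨Nat.succ_le_succ h1, by simp only [resolve]; omega, by simp only [resolve]; omega,
        by simp only [resolve]; omega, h5⟩
    · rcases hm : c.input with _ | ⟨x, m⟩
      · simp only [resolve, hm]
        exact ⟨by simp only; omega, by simp only; omega, by simp only; omega, by simp only; omega,
          by simp⟩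
      · obtain ⟨e1, e2, e3⟩ := hb (!post && xor x P.neg)
        simp only [resolve, hm]
        rw [hm, List.length_cons] at h5
        exact ⟨by simp only; omega, by simp only; omega, by simp only; omega, by simp only; omega,
          by simp only; omega⟩
    · exact ⟨Nat.succ_le_succ h1, by simp only [resolve, List.length_append, List.length_singleton]; omega,
        by simp only [resolve]; omega, by simp only [resolve]; omega, h5⟩
  | _ =>
    refine ⟨Nat.succ_le_succ h1, by simp only [advanceStep]; omega, ?_,
      by simp only [advanceStep]; omega, h5⟩
    simp only [advanceStep, Step.frame, List.length_append, List.length_cons, List.length_nil]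
    omega

theorem Config.Bounded.simulate {n t : ℕ} {steps : ℕ → List Bool → Step (n + t)} {c : Config n t}
    {p o f l i : ℕ} (h : c.Bounded p o f l i) (s : List Bool) :
    (simulate steps c s).Bounded (p + s.length) (o + s.length) (f + 3 * s.length) (l + s.length) i := by
  induction s generalizing c p o f l with
  | nil => exact h
  | cons b s ih =>
    have := ih (h.advance (steps := steps) b)
    rw [simulate_cons]
    simp only [List.length_cons]
    convert this using 1 <;> omega

theorem Config.Bounded.size_le {n t : ℕ} {c : Config n t} {p o f l i : ℕ}
    (h : c.Bounded p o f l i) :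
    (encConfig c).size ≤ 2 * p + 4 * o + f * (8 * (n + t) + 6) + l * (16 * (n + t) + 12) + 4 * i +
      8 * t + 20 := by
  obtain ⟨h1, h2, h3, h4, h5⟩ := h
  have e1 := size_encBits_le c.st.out
  have e2 := size_encBits_le c.input
  have e3 := size_encList_le (e := encPauli) (l := c.st.frame) fun P _ => size_encPauli_le P
  have e4 := size_encList_le (e := encPair) (l := c.st.tab) (B := 16 * (n + t) + 11) fun g _ => by
    have := size_encPauli_le g.1
    have := size_encPauli_le g.2
    simp only [encPair, Val.size]
    omega
  have e5 : (encNext c.query).size ≤ 8 * t + 9 := by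
    rcases c.query with _ | ⟨P, x⟩
    · simp [encNext, Val.size]
    · have := size_encPauli_le P
      have := size_encBool_le x
      simp only [encNext, Val.size]
      omega
  have f3 := Nat.mul_le_mul_right (8 * (n + t) + 6) h3
  have f4 := Nat.mul_le_mul_right (16 * (n + t) + 12) h4
  have f3' := e3.trans (Nat.succ_le_succ f3)
  have f4' := e4.trans (Nat.succ_le_succ f4)
  simp only [encConfig, encState, encTab, Val.size, size_encNat]
  omega

namespace PolyTime

variable {α : Type} {inp : α → Val} {n t : α → ℕ} (hn : PolyTime inp fun a => encNat (n a))
  (ht : PolyTime inp fun a => encNat (t a)) {c : ∀ a, Config (n a) (t a)}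
  (hc : PolyTime inp fun a => encConfig (c a)) {coin : α → Bool}
  (hcoin : PolyTime inp fun a => encBool (coin a))
include hn ht hc hcoin

theorem advanceStep {g : ∀ a, Step (n a + t a)} (hg : PolyTime inp fun a => encStep (g a)) :
    PolyTime inp fun a => encConfig ((c a).advanceStep (coin a) (g a)) := by
  have hnm : PolyTime inp fun a => encConfig (⟨(c a).pos + 1, ⟨(c a).st.out,
      (g a).frame ++ (c a).st.frame, (c a).st.tab⟩, (c a).input, none⟩ : Config (n a) (t a)) :=
    hc.fst.succ.pair ((hc.snd.fst.fst.pair ((append (et := fun _ => encPauli)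
      (step_frame (hn.add ht) hg) hc.snd.fst.snd.fst).pair hc.snd.fst.snd.snd)).pair
        (hc.snd.snd.fst.pair nil))
  refine caseStep hg (hnm.restrict.congr fun a => by rw [a.2]; rfl) ?_ ?_ ?_ ?_
  · exact (hnm.weaken fun x : {x : Σ a, Fin (n a + t a) // g x.1 = .H x.2} => x.1.1).congr
      fun a => by rw [a.2]; rfl
  · exact (hnm.weaken fun x : {x : Σ a, Fin (n a + t a) // g x.1 = .S x.2} => x.1.1).congr
      fun a => by rw [a.2]; rfl
  · exact (hnm.weaken fun x : {x : Σ a, Fin (n a + t a) × Fin (n a + t a) //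
      ∃ h, g x.1 = .CX x.2.1 x.2.2 h} => x.1.1).congr fun a => by
        obtain ⟨h, e⟩ := a.2
        rw [e]; rfl
  · let T := {x : Σ a, Fin (n a + t a) × Bool // g x.1 = .measure x.2.1 x.2.2}
    let φ : T → α := fun x => x.1.1
    refine (resolve_measure (hn.weaken φ) (ht.weaken φ) (st := fun x => (c (φ x)).st)
      (hc.snd.fst.weaken φ) psnd.snd (hcoin.weaken φ)
      (pauli_single (i := fun x : T => x.1.2.1) ((hn.add ht).weaken φ) psnd.fst .Z)
      (hc.fst.weaken φ) (m := fun x => (c (φ x)).input) (hc.snd.snd.fst.weaken φ)).congr fun x => ?_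
    rw [x.2, Config.advanceStep]
    exact congrArg encConfig (Config.resolve_query _ _ _ _).symm

theorem advance {steps : ∀ a, ℕ → List Bool → Step (n a + t a)}
    (hg : PolyTime inp fun a => encStep (steps a (c a).pos (c a).st.out)) :
    PolyTime inp fun a => encConfig (CliffordPBC.advance (steps a) (c a) (coin a)) := by
  refine hc.snd.snd.snd.branch
    ((advanceStep hn ht hc hcoin hg).restrict.congr fun a => ?_) (hc.restrict.congr fun a => ?_)
  · obtain ⟨a, ha⟩ := a
    have : (c a).query = none := by
      rcases h : (c a).query with _ | x
      · rfl
      · simp [h, encNext] at ha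
    simp [CliffordPBC.advance, this]
  · obtain ⟨a, ha⟩ := a
    have : (c a).query.isSome := by
      rcases h : (c a).query with _ | x
      · simp [h, encNext] at ha
      · rfl
    simp [CliffordPBC.advance, this]

omit hcoin

theorem simulate {steps : ∀ a, ℕ → List Bool → Step (n a + t a)} {s : α → List Bool}
    (hs : PolyTime inp fun a => encBits (s a))
    (hsteps : PolyTime (fun x : Σ _ : α, ℕ × List Bool =>
      .pair (inp x.1) (.pair (encNat x.2.1) (encBits x.2.2)))
      fun x => encStep (steps x.1 x.2.1 x.2.2)) :
    PolyTime inp fun a => encConfig (CliffordPBC.simulate (steps a) (c a) (s a)) := by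
  obtain ⟨qn, hqn⟩ := hn.out_size
  obtain ⟨qt, hqt⟩ := ht.out_size
  obtain ⟨qc, hqc⟩ := hc.out_size
  obtain ⟨qs, hqs⟩ := hs.out_size
  refine foldl (σ := fun a => Config (n a) (t a)) (τ := fun _ => Bool) (et := fun _ => encBool)
    (es := fun _ => encConfig) (step := fun a => CliffordPBC.advance (steps a)) hs hc ?_
    -- The bound of `Config.Bounded.size_le` after at most `qs` steps, when all components of the
    -- initial configuration are bounded by its encoded size `qc`.
    ⟨2 * (qc + qs) + 4 * (qc + qs) + (qc + 3 * qs) * (8 * (qn + qt) + 6) +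
      (qc + qs) * (16 * (qn + qt) + 12) + 4 * qc + 8 * qt + 20, fun a m hm => ?_⟩
  · let T := Σ a, Config (n a) (t a) × Bool
    let φ : T → α := fun x => x.1
    refine advance (c := fun x : T => x.2.1) (steps := fun x => steps (φ x)) (hn.weaken φ)
      (ht.weaken φ) psnd.fst psnd.snd ?_
    refine (pfst.pair (psnd.fst.fst.pair psnd.fst.snd.fst.fst)).comp
      (hsteps.reindex fun x : T => ⟨x.1, x.2.1.pos, x.2.1.st.out⟩)
  · have h1 := hqn a
    have h2 := hqt a
    have h3 := hqc a
    have h4 := (length_lt_size_encList (e := encBool) (s a)).le.trans (hqs a)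
    rw [size_encNat] at h1 h2
    have h5 := hm.length_le
    have e1 := length_lt_size_encList (e := encBool) (c a).st.out
    have e2 := length_lt_size_encList (e := encBool) (c a).input
    have e3 := length_lt_size_encList (e := encPauli) (c a).st.frame
    have e4 := length_lt_size_encList (e := encPair) (c a).st.tab
    simp only [encConfig, encState, encTab, encBits, Val.size, size_encNat] at h3
    generalize hC : qc.eval (inp a).size = C at *
    have hb : (c a).Bounded C C C C C := ⟨by omega, by omega, by omega, by omega, by omega⟩
    refine (hb.simulate (steps := steps a) m).size_le.trans ?_
    simp only [Polynomial.eval_add, Polynomial.eval_mul, Polynomial.eval_ofNat, hC]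
    have g1 : n a ≤ qn.eval (inp a).size := by omega
    have g2 : t a ≤ qt.eval (inp a).size := by omega
    have g3 : m.length ≤ qs.eval (inp a).size := by omega
    gcongr

end PolyTime

end CliffordPBC
end

noncomputable section
namespace CliffordPBC

/-! ## The simulating family -/

theorem coinAverage_append (m f : ℕ) (F : (Fin m → Bool) → List Bool → Dist) :
    coinAverage (fun r : Fin (m + f) → Bool =>
      F (fun i => r (Fin.castAdd f i)) (List.ofFn fun j => r (Fin.natAdd m j))) =
      coinAverage fun a => coinAvg f (F a) := by
  simp only [← coinAverage_ofFn]
  rw [coinAverage, coinAverage, ← (Fin.appendEquiv m f).sum_comp, Fintype.sum_prod_type]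
  have e1 : ∀ (a : Fin m → Bool) (b : Fin f → Bool),
      (fun i => (Fin.appendEquiv m f) (a, b) (Fin.castAdd f i)) = a :=
    fun a b => funext fun i => Fin.append_left a b i
  have e2 : ∀ (a : Fin m → Bool) (b : Fin f → Bool),
      (fun i => (Fin.appendEquiv m f) (a, b) (Fin.natAdd m i)) = b :=
    fun a b => funext fun i => Fin.append_right a b i
  simp only [e1, e2, coinAverage]
  rw [← Finset.smul_sum, smul_smul, pow_add, mul_inv]

theorem coinAvg_mapDomain (f : ℕ) (F : List Bool → Dist) (g : List Bool → List Bool) :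
    (coinAvg f F).mapDomain g = coinAvg f fun s => (F s).mapDomain g := by
  induction f generalizing F with
  | zero => rfl
  | succ f ih =>
    simp only [coinAvg, ← ih, Finsupp.mapDomain_smul, Finsupp.mapDomain_add]

namespace CliffordFamily

variable (C : CliffordFamily)

/-- The initial record of the simulation. -/
def initState (w : List Bool) : SimState (C.n w) (C.t w) := ⟨[], [], initTab (C.t w) (C.gens w)⟩

/-- The coins of the circuit. -/
def fstCoins {w : List Bool} (r : Fin (C.coins w + C.len w) → Bool) : Fin (C.coins w) → Bool :=
  fun i => r (Fin.castAdd _ i)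

/-- The coins of the simulation. -/
def sndCoins {w : List Bool} (r : Fin (C.coins w + C.len w) → Bool) : List Bool :=
  List.ofFn fun j => r (Fin.natAdd _ j)

theorem initState_spec (w : List Bool) :
    (C.initState w).tab.Valid ∧ (C.initState w).tab.measuredPart = [] ∧
      ∀ ρ : Op (C.t w), (C.initState w).Describes (C.input w ρ) ρ ∧
        (ρ.PosSemidef → (C.input w ρ).PosSemidef) := by
  obtain ⟨h1, h2, -, -, h5⟩ := initTab_spec (t := C.t w) (C.gens_stabiliser w).1
    (C.gens_stabiliser w).2.1.not_inSpan
  exact ⟨h1, h2, fun ρ => ⟨⟨_, by simp [initState, frameOp, input], (h5 ρ).1⟩, (h5 ρ).2⟩⟩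

theorem polyTime_fstCoins : PolyTime
    (fun a : (Σ w : List Bool, Fin (C.coins w + C.len w) → Bool) × List Bool =>
      .pair (encBits a.1.1) (.pair (encCoins a.1.2) (encBits a.2)))
    (fun a => encCoins (C.fstCoins a.1.2)) := by
  refine (PolyTime.take (et := fun _ => encBool) PolyTime.psnd.fst (C.coins_poly.weaken
    fun a : (Σ w : List Bool, Fin (C.coins w + C.len w) → Bool) × List Bool => a.1.1)).congr
    fun a => ?_
  rw [encCoins, encBits, List.ofFn_add, List.take_left' (by simp)]
  rfl

theorem polyTime_simulate : PolyTime
    (fun a : (Σ w : List Bool, Fin (C.coins w + C.len w) → Bool) × List Bool =>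
      .pair (encBits a.1.1) (.pair (encCoins a.1.2) (encBits a.2)))
    (fun a => encConfig (simulate (C.step a.1.1 (C.fstCoins a.1.2))
      ⟨0, C.initState a.1.1, a.2, none⟩ (C.sndCoins a.1.2))) := by
  let T := (Σ w : List Bool, Fin (C.coins w + C.len w) → Bool) × List Bool
  have hw := fun {v : List Bool → Val} (h : PolyTime encBits v) =>
    h.weaken (fun a : T => a.1.1) (v := fun a : T => .pair (encCoins a.1.2) (encBits a.2))
  have hn := hw C.n_poly
  have ht := hw C.t_poly
  have hco := hw C.coins_poly
  have hr : PolyTime (fun a : T => .pair (encBits a.1.1) (.pair (encCoins a.1.2) (encBits a.2)))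
    (fun a => encBits (List.ofFn a.1.2)) := PolyTime.psnd.fst
  have h2 : PolyTime (fun a : T => .pair (encBits a.1.1) (.pair (encCoins a.1.2) (encBits a.2)))
      (fun a => encBits (C.sndCoins a.1.2)) := by
    refine (PolyTime.drop (et := fun _ => encBool) hr hco).congr fun a => ?_
    rw [encBits, List.ofFn_add, List.drop_left' (by simp)]
    rfl
  have hc : PolyTime (fun a : T => .pair (encBits a.1.1) (.pair (encCoins a.1.2) (encBits a.2)))
      (fun a => encConfig ⟨0, C.initState a.1.1, a.2, none⟩) :=
    (PolyTime.const (encNat 0)).pair ((PolyTime.nil.pair (PolyTime.nil.pair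
      (PolyTime.initTab hn ht (hw C.gens_poly)))).pair (PolyTime.psnd.snd.pair PolyTime.nil))
  refine PolyTime.simulate (n := fun a : T => C.n a.1.1) (t := fun a : T => C.t a.1.1)
    (c := fun a : T => ⟨0, C.initState a.1.1, a.2, none⟩) (s := fun a : T => C.sndCoins a.1.2)
    (steps := fun a => C.step a.1.1 (C.fstCoins a.1.2)) hn ht hc h2 ?_
  exact (PolyTime.pfst.fst.pair ((C.polyTime_fstCoins.weaken fun x : Σ _ : T, ℕ × List Bool => x.1).pair
    PolyTime.psnd)).comp (C.step_poly.reindex fun x : Σ _ : T, ℕ × List Bool =>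
      (⟨x.1.1.1, C.fstCoins x.1.1.2⟩, x.2))

/-- The PBC circuits that simulate a family of Clifford circuits. -/
def pbc : PBCFamily C.t where
  -- Besides the coins of the circuit, one coin for each of its steps.
  coins w := C.coins w + C.len w
  next w r := simNext (C.step w (C.fstCoins r)) 0 (C.initState w) (C.sndCoins r)
  isPBC w _ := simNext_isPBC _ 0 (C.initState_spec w).1
  coins_poly := C.coins_poly.add C.len_poly
  next_poly := C.polyTime_simulate.snd.snd.snd

variable {C} {w : List Bool} {ρ : Op (C.t w)}

theorem input_spec (hρ : IsState ρ) : (C.input w ρ).PosSemidef ∧ (C.input w ρ).trace = 1 :=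
  ⟨((C.initState_spec w).2.2 ρ).2 hρ.1, by
    rw [((C.initState_spec w).2.2 ρ).1.trace_eq, hρ.2]⟩

theorem stepwiseDist_eq (hρ : IsState ρ) (r : Fin (C.coins w) → Bool)
    (hm : mass (C.stepwiseDist w r ρ) = 1) :
    C.stepwiseDist w r ρ =
      coinAvg (C.len w) (simDist (C.step w r) 0 (C.initState w) (C.t w) ρ) := by
  obtain ⟨h1, h2, h3⟩ := C.initState_spec w
  refine simulate_correct _ 0 (C.initState w) _ _ _ h1 (h3 ρ).1 ((h3 ρ).2 hρ.1) hρ.1 (by simp [h2]) ?_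
  rw [(input_spec hρ).2]
  exact hm

variable (C)

/-- The simulation followed by further processing of its outcomes. -/
theorem exists_post (g : ∀ w, (Fin (C.coins w) → Bool) → List Bool → List Bool)
    (hg : PolyTime
      (fun a : (Σ w : List Bool, Fin (C.coins w) → Bool) × List Bool =>
        .pair (encBits a.1.1) (.pair (encCoins a.1.2) (encBits a.2)))
      (fun a => encBits (g a.1.1 a.1.2 a.2))) :
    ∃ post : ∀ w, (Fin (C.pbc.coins w) → Bool) → List Bool → List Bool,
      PolyTime
        (fun a : (Σ w : List Bool, Fin (C.pbc.coins w) → Bool) × List Bool =>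
          .pair (encBits a.1.1) (.pair (encCoins a.1.2) (encBits a.2)))
        (fun a => encBits (post a.1.1 a.1.2 a.2)) ∧
      ∀ w (ρ : Op (C.t w)), IsState ρ → (∀ r, mass (C.stepwiseDist w r ρ) = 1) →
        coinAverage (fun r => (C.stepwiseDist w r ρ).mapDomain (g w r)) =
          coinAverage (fun r => (C.pbc.stepwiseDist w r ρ).mapDomain (post w r)) := by
  -- Rerun the simulation with all outcomes of the PBC circuit, read off the recorded outcomes and
  -- process them with `g`.
  refine ⟨fun w r m => g w (C.fstCoins r) (simulate (C.step w (C.fstCoins r))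
    ⟨0, C.initState w, m, none⟩ (C.sndCoins r)).st.out, ?_, fun w ρ hρ hm => ?_⟩
  · let T := (Σ w : List Bool, Fin (C.coins w + C.len w) → Bool) × List Bool
    exact (PolyTime.pfst.pair (C.polyTime_fstCoins.pair C.polyTime_simulate.snd.fst.fst)).comp
      (hg.reindex fun a : T => (⟨a.1.1, C.fstCoins a.1.2⟩, (simulate (C.step a.1.1
        (C.fstCoins a.1.2)) ⟨0, C.initState a.1.1, a.2, none⟩ (C.sndCoins a.1.2)).st.out))
  · have h1 : ∀ r, (C.stepwiseDist w r ρ).mapDomain (g w r) = coinAvg (C.len w) fun s =>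
        (simDist (C.step w r) 0 (C.initState w) (C.t w) ρ s).mapDomain (g w r) := fun r => by
      rw [stepwiseDist_eq hρ r (hm r), coinAvg_mapDomain]
    rw [funext h1, ← coinAverage_append]
    refine congrArg (fun F => coinAverage F) (funext fun r => ?_)
    rw [simDist, ← Finsupp.mapDomain_comp]
    rfl

variable {C}

/-- The steps consist of postselected measurements and gates, then of other measurements and
gates. -/
def PostselectsFirst (C : CliffordFamily) : Prop :=
  ∃ K : List Bool → ℕ, ∀ w r, NoPostFrom (C.step w r) (K w) ∧ PostUntil (C.step w r) (K w)

theorem NoPostselection.postselectsFirst (h : C.NoPostselection) : C.PostselectsFirst :=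
  ⟨fun _ => 0, fun w r => ⟨fun k _ o i => h w r k o i, fun _ hk => absurd hk (Nat.not_lt_zero _)⟩⟩

theorem NoPostselection.pbc (h : C.NoPostselection) : C.pbc.NoPostselection := fun w _ o P =>
  simNext_noPost (K := 0) (fun k _ o i => h w _ k o i) _ le_rfl (C.initState_spec w).1 o P

theorem PostselectsFirst.pbc_nonAdaptive (h : C.PostselectsFirst) (hC : C.NonAdaptive) :
    C.pbc.NonAdaptive := by
  obtain ⟨K, hK⟩ := h
  exact fun w r o o' ho => simNext_nonAdaptive (hK w _).1 (hK w _).2 (hC w _) 0 _ _ ho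

theorem PostselectsFirst.condDist_eq (h : C.PostselectsFirst) (hρ : IsState ρ)
    (r : Fin (C.coins w) → Bool) : C.condDist w r ρ = C.stepwiseDist w r ρ := by
  obtain ⟨K, hK⟩ := h
  rw [stepwiseDist, runStepwise_of_postFirst (fun k o => (C.step w r k o).action_proper)
    (postFirst_of_steps (hK w r).1 (hK w r).2) _ _ _ (input_spec hρ).1, (input_spec hρ).2,
    Complex.one_re, one_div]
  rfl

theorem PostselectsFirst.pbc_condDist_eq (h : C.PostselectsFirst) (hρ : IsState ρ)
    (r : Fin (C.pbc.coins w) → Bool) : C.pbc.condDist w r ρ = C.pbc.stepwiseDist w r ρ := by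
  obtain ⟨K, hK⟩ := h
  have := runStepwise_of_postFirst (act := fun _ o => pbcAction (C.pbc.next w r o))
    (fun k o => pbcAction_proper _)
    (postFirst_of_simNext (hK w _).1 (hK w _).2 _ 0 (C.initState_spec w).1) (C.t w) 0 [] hρ.1
  rw [PBCFamily.stepwiseDist, this, hρ.2, Complex.one_re, one_div]
  rfl

/-- Here the event of non-zero probability becomes the condition of the stepwise simulation that no
mass is lost. -/
theorem PostselectsFirst.mass_stepwiseDist (h : C.PostselectsFirst) (hρ : IsState ρ)
    (r : Fin (C.coins w) → Bool) (hm : mass (C.dist w r ρ) ≠ 0) :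
    mass (C.stepwiseDist w r ρ) = 1 := by
  rw [← h.condDist_eq hρ, condDist, mass_smul, inv_mul_cancel₀ hm]

theorem NoPostselection.dist_eq (h : C.NoPostselection) (r : Fin (C.coins w) → Bool) :
    C.stepwiseDist w r ρ = C.dist w r ρ ∧ mass (C.dist w r ρ) = (C.input w ρ).trace.re := by
  refine run_of_no_post (fun k o => (C.step w r k o).action_proper) _ _ _ _ ?_
  intro k o M _ _ hs
  cases e : C.step w r k o with
  | measure i post =>
    simp only [e, Step.action, Action.measure.injEq] at hs
    exact h w r k o i (hs.2 ▸ e)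
  | _ => simp [e, Step.action] at hs

theorem _root_.CliffordPBC.PBCFamily.NoPostselection.dist_eq {t : List Bool → ℕ} {B : PBCFamily t}
    (h : B.NoPostselection) {w : List Bool} (r : Fin (B.coins w) → Bool) (ρ : Op (t w)) :
    B.stepwiseDist w r ρ = B.dist w r ρ := by
  refine (run_of_no_post (fun k o => pbcAction_proper (B.next w r o)) _ _ _ _ ?_).1
  intro k o M _ _ hs
  rcases e : B.next w r o with _ | ⟨P, p⟩ <;>
    simp only [e, pbcAction, Action.measure.injEq, reduceCtorEq] at hs
  exact h w r o P (hs.2 ▸ e)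

theorem PostselectsFirst.exists_post_condDist (h : C.PostselectsFirst)
    (g : ∀ w, (Fin (C.coins w) → Bool) → List Bool → List Bool)
    (hg : PolyTime
      (fun a : (Σ w : List Bool, Fin (C.coins w) → Bool) × List Bool =>
        .pair (encBits a.1.1) (.pair (encCoins a.1.2) (encBits a.2)))
      (fun a => encBits (g a.1.1 a.1.2 a.2))) :
    ∃ post : ∀ w, (Fin (C.pbc.coins w) → Bool) → List Bool → List Bool,
      PolyTime
        (fun a : (Σ w : List Bool, Fin (C.pbc.coins w) → Bool) × List Bool =>
          .pair (encBits a.1.1) (.pair (encCoins a.1.2) (encBits a.2)))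
        (fun a => encBits (post a.1.1 a.1.2 a.2)) ∧
      ∀ w (ρ : Op (C.t w)), IsState ρ → (∀ r, mass (C.dist w r ρ) ≠ 0) →
        coinAverage (fun r => (C.condDist w r ρ).mapDomain (g w r)) =
          coinAverage (fun r => (C.pbc.condDist w r ρ).mapDomain (post w r)) := by
  obtain ⟨post, hp, hpost⟩ := C.exists_post g hg
  refine ⟨post, hp, fun w ρ hρ hm => ?_⟩
  simp only [h.condDist_eq hρ, h.pbc_condDist_eq hρ]
  exact hpost w ρ hρ fun r => h.mass_stepwiseDist hρ r (hm r)

theorem exists_post_id :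
    ∃ post : ∀ w, (Fin (C.pbc.coins w) → Bool) → List Bool → List Bool,
      PolyTime
        (fun a : (Σ w : List Bool, Fin (C.pbc.coins w) → Bool) × List Bool =>
          .pair (encBits a.1.1) (.pair (encCoins a.1.2) (encBits a.2)))
        (fun a => encBits (post a.1.1 a.1.2 a.2)) ∧
      ∀ w (ρ : Op (C.t w)), IsState ρ → (∀ r, mass (C.stepwiseDist w r ρ) = 1) →
        coinAverage (fun r => C.stepwiseDist w r ρ) =
          coinAverage (fun r => (C.pbc.stepwiseDist w r ρ).mapDomain (post w r)) := by
  obtain ⟨post, hp, hpost⟩ := C.exists_post (fun _ _ o => o) PolyTime.psnd.snd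
  refine ⟨post, hp, fun w ρ hρ hm => ?_⟩
  rw [← hpost w ρ hρ hm]
  exact congrArg _ (funext fun r => Finsupp.mapDomain_id.symm)

/-- Simulation of circuits with stepwise postselection. -/
theorem weaklySimulatedBy_stepwise :
    WeaklySimulatedBy C C.pbc C.stepwiseDist C.pbc.stepwiseDist
      (fun w ρ => ∀ r, mass (C.stepwiseDist w r ρ) = 1) := exists_post_id

/-- Simulation of circuits without postselection. -/
theorem NoPostselection.weaklySimulatedBy (h : C.NoPostselection) :
    WeaklySimulatedBy C C.pbc C.dist C.pbc.dist (fun _ _ => True) := by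
  obtain ⟨post, hp, hpost⟩ := exists_post_id (C := C)
  refine ⟨post, hp, fun w ρ hρ _ => ?_⟩
  simp only [← (h.dist_eq _).1, ← h.pbc.dist_eq]
  refine hpost w ρ hρ fun r => ?_
  rw [(h.dist_eq r).1, (h.dist_eq r).2, (input_spec hρ).2, Complex.one_re]

end CliffordFamily

end CliffordPBC
end

noncomputable section
namespace CliffordPBC

/-! ## Deferred measurements -/

/-! ### Lines and basis states of a circuit with ancillas. -/

section lines

variable {n t L : ℕ}

/-- The lines of a circuit after the insertion of ancillas. -/
def emb (L : ℕ) : Fin (n + t) → Fin (n + L + t) :=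
  Fin.addCases (fun i => Fin.castAdd t (Fin.castAdd L i)) fun j => Fin.natAdd (n + L) j

/-- The ancillas. -/
def anc (k : Fin L) : Fin (n + L + t) := Fin.castAdd t (Fin.natAdd n k)

/-- Basis states of the lines with ancillas. -/
def join (x : Fin (n + t) → Bool) (a : Fin L → Bool) : Fin (n + L + t) → Bool :=
  Fin.append (Fin.append (fun i => x (Fin.castAdd t i)) a) fun j => x (Fin.natAdd n j)

@[simp] theorem join_emb (x : Fin (n + t) → Bool) (a : Fin L → Bool) (i : Fin (n + t)) :
    join x a (emb L i) = x i := by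
  refine Fin.addCases (fun i => ?_) (fun j => ?_) i <;> simp [join, emb]

@[simp] theorem join_anc (x : Fin (n + t) → Bool) (a : Fin L → Bool) (k : Fin L) :
    join x a (anc k) = a k := by simp [join, anc]

theorem line_cases {p : Fin (n + L + t) → Prop} (h1 : ∀ i, p (emb L i)) (h2 : ∀ k, p (anc k)) (j) :
    p j := by
  refine Fin.addCases (fun j => Fin.addCases (fun i => ?left) (fun k => h2 k) j) (fun i => ?right) j
  case left => simpa [emb] using h1 (Fin.castAdd t i)
  case right => simpa [emb] using h1 (Fin.natAdd n i)

theorem emb_injective : Function.Injective (emb L : Fin (n + t) → _) := fun i j h => by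
  have h1 := join_emb (fun l => decide (l = i)) (fun _ : Fin L => false) i
  rw [h, join_emb] at h1
  exact (by simpa using h1 : j = i).symm

theorem emb_ne_anc (i : Fin (n + t)) (k : Fin L) : emb L i ≠ anc k := fun h => by
  have h1 := join_emb (fun _ => true) (fun _ : Fin L => false) i
  rw [h, join_anc] at h1
  exact absurd h1 (by simp)

theorem anc_injective : Function.Injective (anc : Fin L → Fin (n + L + t)) := fun i j h => by
  simpa [anc, Fin.ext_iff] using h

def joinEquiv (n t L : ℕ) :
    (Fin (n + t) → Bool) × (Fin L → Bool) ≃ (Fin (n + L + t) → Bool) where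
  toFun p := join p.1 p.2
  invFun z := (fun i => z (emb L i), fun k => z (anc k))
  left_inv p := by simp
  right_inv z := funext fun j => by
    refine line_cases (p := fun j => join (fun i => z (emb L i)) (fun k => z (anc k)) j = z j)
      (fun i => ?_) (fun k => ?_) j <;> simp

theorem join_inj {x y : Fin (n + t) → Bool} {a b : Fin L → Bool} :
    join x a = join y b ↔ x = y ∧ a = b := by
  refine ((joinEquiv n t L).injective.eq_iff (a := (x, a)) (b := (y, b))).trans ?_
  simp

theorem update_join_emb (x : Fin (n + t) → Bool) (a : Fin L → Bool) (i : Fin (n + t)) (b : Bool) :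
    Function.update (join x a) (emb L i) b = join (Function.update x i b) a := by
  funext j
  refine line_cases (p := fun j => Function.update (join x a) (emb L i) b j =
    join (Function.update x i b) a j) (fun i' => ?_) (fun k => ?_) j
  · by_cases h : i' = i
    · subst h; simp
    · rw [Function.update_of_ne (emb_injective.ne h)]; simp [h]
  · rw [Function.update_of_ne (emb_ne_anc i k).symm]; simp

theorem update_join_anc (x : Fin (n + t) → Bool) (a : Fin L → Bool) (k : Fin L) (b : Bool) :
    Function.update (join x a) (anc k) b = join x (Function.update a k b) := by
  funext j
  refine line_cases (p := fun j => Function.update (join x a) (anc k) b j =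
    join x (Function.update a k b) j) (fun i => ?_) (fun k' => ?_) j
  · rw [Function.update_of_ne (emb_ne_anc i k)]; simp
  · by_cases h : k' = k
    · subst h; simp
    · rw [Function.update_of_ne (anc_injective.ne h)]; simp [h]

end lines

/-! ### Blocks -/

section blk

variable {n t L : ℕ}

/-- The blocks of an operator with respect to the basis states of the ancillas. -/
def blk (A : Op (n + L + t)) (a b : Fin L → Bool) : Op (n + t) :=
  Matrix.of fun x y => A (join x a) (join y b)

theorem blk_mul (A B : Op (n + L + t)) (a c : Fin L → Bool) :
    blk (A * B) a c = ∑ b, blk A a b * blk B b c := by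
  ext x y
  simp only [blk, Matrix.of_apply, Matrix.mul_apply, Matrix.sum_apply]
  rw [← (joinEquiv n t L).sum_comp, Fintype.sum_prod_type, Finset.sum_comm]
  rfl

theorem blk_conjTranspose (A : Op (n + L + t)) (a b : Fin L → Bool) : blk Aᴴ a b = (blk A b a)ᴴ := by
  ext x y; simp [blk, Matrix.conjTranspose_apply]

theorem trace_eq_sum_blk (A : Op (n + L + t)) : A.trace = ∑ a, (blk A a a).trace := by
  simp only [Matrix.trace, Matrix.diag, blk, Matrix.of_apply]
  rw [← (joinEquiv n t L).sum_comp, Fintype.sum_prod_type, Finset.sum_comm]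
  rfl

/-- An operator that does not touch the ancillas is block diagonal with equal blocks, so it acts on
each block separately. -/
theorem blk_conj {V A : Op (n + L + t)} {U : Op (n + t)}
    (hV : ∀ a b, blk V a b = if a = b then U else 0) (a b : Fin L → Bool) :
    blk (V * A * Vᴴ) a b = U * blk A a b * Uᴴ := by
  simp only [blk_mul, blk_conjTranspose, hV]
  rw [Finset.sum_eq_single b, Finset.sum_eq_single a]
  · simp
  · intro c _ hc; simp [hc.symm]
  · simp
  · intro c _ hc; simp [hc.symm]
  · simp

theorem blk_one (a b : Fin L → Bool) :
    blk (1 : Op (n + L + t)) a b = if a = b then 1 else 0 := by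
  ext x y
  simp only [blk, Matrix.of_apply, Matrix.one_apply, join_inj]
  by_cases h : a = b <;> simp [h, Matrix.one_apply]

theorem blk_onLine (i : Fin (n + t)) (G : Matrix Bool Bool ℂ) (a b : Fin L → Bool) :
    blk (onLine (emb L i) G) a b = if a = b then onLine i G else 0 := by
  ext x y
  have h : (∀ j, j ≠ emb L i → join x a j = join y b j) ↔ (∀ j, j ≠ i → x j = y j) ∧ a = b := by
    constructor
    · intro h
      exact ⟨fun j hj => by simpa using h _ (emb_injective.ne hj),
        funext fun k => by simpa using h _ (emb_ne_anc i k).symm⟩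
    · rintro ⟨h, rfl⟩
      refine line_cases (fun j hj => ?_) (fun k _ => by simp)
      simpa using h j fun e => hj (by rw [e])
  simp only [blk, Matrix.of_apply, onLine_apply, h, join_emb]
  by_cases hab : a = b <;> simp [hab, onLine_apply]

theorem blk_cnot (c d : Fin (n + t)) (a b : Fin L → Bool) :
    blk (cnot (emb L c) (emb L d)) a b = if a = b then cnot c d else 0 := by
  ext x y
  simp only [blk, cnot, Matrix.of_apply, update_join_emb, join_emb, join_inj]
  by_cases hab : a = b <;> simp [hab]

/-- A controlled NOT is a permutation of the basis and its own inverse; conjugation therefore just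
relabels rows and columns. -/
theorem cnot_conj_apply {N : ℕ} {c d : Fin N} (h : c ≠ d) (A : Op N) (x y : Fin N → Bool) :
    (cnot c d * A * (cnot c d)ᴴ) x y =
      A (Function.update x d (xor (x d) (x c))) (Function.update y d (xor (y d) (y c))) := by
  have key : ∀ x z : Fin N → Bool, x = Function.update z d (xor (z d) (z c)) ↔
      z = Function.update x d (xor (x d) (x c)) := by
    have : ∀ x z : Fin N → Bool, x = Function.update z d (xor (z d) (z c)) →
        z = Function.update x d (xor (x d) (x c)) := by
      rintro _ z rfl
      simp [Function.update_of_ne h]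
    exact fun x z => ⟨this x z, this z x⟩
  have h1 : ∀ z, (cnot c d * A) x z = A (Function.update x d (xor (x d) (x c))) z := by
    intro z
    simp only [Matrix.mul_apply, cnot, Matrix.of_apply, key x]
    simp
  have h2 : ∀ z, (cnot c d)ᴴ z y =
      if z = Function.update y d (xor (y d) (y c)) then 1 else 0 := by
    intro z
    simp only [Matrix.conjTranspose_apply, cnot, Matrix.of_apply, key y, apply_ite star, star_one,
      star_zero]
  rw [Matrix.mul_apply]
  simp only [h1, h2, mul_ite, mul_one, mul_zero, Finset.sum_ite_eq', Finset.mem_univ,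
    if_true]

theorem collapse_Z_apply {N : ℕ} (i : Fin N) (c : Bool) (A : Op N) (x y : Fin N → Bool) :
    collapse (onLine i Letter.Z.mat) c A x y = if x i = c ∧ y i = c then A x y else 0 := by
  have hE : eigenproj (onLine i Letter.Z.mat) c =
      Matrix.diagonal fun x : Fin N → Bool => if x i = c then (1 : ℂ) else 0 := by
    ext x y
    rw [eigenproj, ← Pauli.op_single]
    simp only [Matrix.smul_apply, Matrix.add_apply, op_single_Z_apply, Matrix.one_apply,
      Matrix.diagonal_apply]
    by_cases h : x = y
    · subst h
      cases c <;> cases x i <;> norm_num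
    · simp [h]
  rw [collapse_eq, hE, Matrix.mul_diagonal, Matrix.diagonal_mul]
  split_ifs <;> simp_all

theorem blk_collapse_anc (k : Fin L) (c : Bool) (A : Op (n + L + t)) (a : Fin L → Bool) :
    blk (collapse (onLine (anc k) Letter.Z.mat) c A) a a = if a k = c then blk A a a else 0 := by
  ext x y
  simp only [blk, Matrix.of_apply, collapse_Z_apply, join_anc, and_self]
  split_ifs <;> simp

theorem blk_cnot_anc (i : Fin (n + t)) (k : Fin L) (A : Op (n + L + t)) (a b : Fin L → Bool)
    (x y : Fin (n + t) → Bool) :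
    blk (cnot (emb L i) (anc k) * A * (cnot (emb L i) (anc k))ᴴ) a b x y =
      blk A (Function.update a k (xor (a k) (x i))) (Function.update b k (xor (b k) (y i))) x y := by
  simp only [blk, Matrix.of_apply, cnot_conj_apply (emb_ne_anc i k), update_join_anc, join_anc,
    join_emb]

/-- Assignments that differ only in bit `k` are paired; the one with bit `false` represents the
pair. -/
theorem sum_split_bit {M : Type} [AddCommMonoid M] (k : Fin L) (G : (Fin L → Bool) → M) :
    ∑ a, G a = ∑ a : Fin L → Bool, if a k then 0 else G a + G (Function.update a k true) := by
  have hi : Function.Involutive fun a : Fin L → Bool => Function.update a k (!a k) := by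
    intro a; simp
  have h1 : ∑ a, G a = ∑ a, (if a k then 0 else G a) + ∑ a, (if a k then G a else 0) := by
    rw [← Finset.sum_add_distrib]
    exact Finset.sum_congr rfl fun a _ => by cases a k <;> simp
  have h2 : ∑ a, (if a k then G a else 0) = ∑ a, if Function.update a k (!a k) k then
      G (Function.update a k (!a k)) else 0 :=
    (Equiv.sum_comp (hi.toPerm _) fun a => if a k then G a else 0).symm
  rw [h1, h2, ← Finset.sum_add_distrib]
  refine Finset.sum_congr rfl fun a _ => ?_
  cases h : a k <;> simp

end blk

/-! ### Measurements of ancillas -/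

variable {n t L : ℕ}

/-- `Z` on an ancilla is diagonal in the block index, so measuring ancillas only selects diagonal
blocks. In the block of `a` the outcomes are the bits of `a`, and a postselected one must be
`false`. The schedule is `e`. -/
theorem run_ancillas {act : ℕ → List Bool → Action (n + L + t)} {e : ℕ → Option (Fin L × Bool)}
    (f k : ℕ) (o : List Bool) (A : Op (n + L + t))
    (hact : ∀ i ≥ k, ∀ o, act i o = match e i with
      | none => .gate 1
      | some (j, post) => .measure (onLine (anc j) Letter.Z.mat) post) :
    run act f k o A = ∑ a : Fin L → Bool,
      if ∀ i ∈ List.range' k f, ∀ j, e i = some (j, true) → a j = false then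
        Finsupp.single (o ++ (List.range' k f).filterMap fun i => (e i).map fun p => a p.1)
          (blk A a a).trace.re else 0 := by
  induction f generalizing k o A with
  | zero =>
    simp only [run, List.range'_zero, List.not_mem_nil, false_imp_iff, implies_true, if_true,
      List.filterMap_nil, List.append_nil]
    rw [trace_eq_sum_blk, Complex.re_sum]
    exact map_sum (Finsupp.singleAddHom o) _ _
  | succ f ih =>
    have ih' := fun o A => ih (k + 1) o A fun i hi => hact i (by omega)
    rw [run, hact k le_rfl, List.range'_succ]
    simp only [List.forall_mem_cons, List.filterMap_cons]
    rcases he : e k with _ | ⟨j, _ | _⟩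
    · simp only [ih', one_mul, Matrix.conjTranspose_one, mul_one, Option.map_none, reduceCtorEq,
        false_imp_iff, implies_true, true_and]
    · simp only [ih', Bool.false_eq_true, if_false, Option.map_some, ← Finset.sum_add_distrib,
        Option.some.injEq, Prod.mk.injEq, and_false, false_imp_iff, implies_true, true_and,
        blk_collapse_anc]
      refine Finset.sum_congr rfl fun a _ => ?_
      cases h : a j <;> simp only [reduceCtorEq, if_true, if_false, Matrix.trace_zero,
        Complex.zero_re, Finsupp.single_zero, ite_self, add_zero, zero_add, List.append_assoc,
        List.singleton_append]
    · simp only [ih', if_true, add_zero, Option.map_some, Option.some.injEq, Prod.mk.injEq,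
        and_true, blk_collapse_anc, forall_eq']
      refine Finset.sum_congr rfl fun a _ => ?_
      cases h : a j <;> simp only [reduceCtorEq, if_true, if_false, Matrix.trace_zero,
        Complex.zero_re, Finsupp.single_zero, ite_self, List.append_assoc, true_and, false_and,
        List.singleton_append]

/-! ### Deferral -/

def Step.isMeasure {N : ℕ} : Step N → Bool
  | .measure _ _ => true
  | _ => false

def Step.isPost {N : ℕ} : Step N → Bool
  | .measure _ post => post
  | _ => false

/-- A gate acts on the original lines; a measurement is replaced by a controlled NOT to the
ancilla `k`. -/
def Step.defer (k : Fin L) : Step (n + t) → Step (n + L + t)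
  | .skip => .skip
  | .H i => .H (emb L i)
  | .S i => .S (emb L i)
  | .CX c d h => .CX (emb L c) (emb L d) (emb_injective.ne h)
  | .measure i _ => .CX (emb L i) (anc k) (emb_ne_anc i k)

/-- The steps of a circuit of length `L` are followed by the postselected measurements, then by all
measurements of ancillas. -/
def deferStep (L : ℕ) (s : ℕ → Step (n + t)) (k : ℕ) : Step (n + L + t) :=
  if h : k < L then (s k).defer ⟨k, h⟩
  else if h : k - L < L then
    -- A postselected ancilla is measured again, without postselection, in the third stretch; so
    -- that stretch alone repeats all outcomes of the original circuit in their order.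
    if (s (k - L)).isPost then .measure (anc ⟨k - L, h⟩) true else .skip
  else if h : k - L - L < L then
    if (s (k - L - L)).isMeasure then .measure (anc ⟨k - L - L, h⟩) false else .skip
  else .skip

/-- The bit of ancilla `k`. -/
def bit (a : Fin L → Bool) (k : ℕ) : Bool := if h : k < L then a ⟨k, h⟩ else false

theorem bit_update_of_ne (a : Fin L → Bool) (k : Fin L) (b : Bool) {j : ℕ} (h : j ≠ k) :
    bit (Function.update a k b) j = bit a j := by
  rw [bit, bit]
  split_ifs
  · rw [Function.update_of_ne]
    exact fun e => h (congrArg Fin.val e)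
  · rfl

theorem bit_val (a : Fin L → Bool) (k : Fin L) : bit a k = a k := by simp [bit]

/-- The outcomes of the first `k` steps as recorded by the ancillas. -/
def readout (s : ℕ → Step (n + t)) (a : Fin L → Bool) (k : ℕ) : List Bool :=
  ((List.range k).filter fun j => (s j).isMeasure).map (bit a)

/-- All postselected measurements among the first `k` steps have outcome `+1`. -/
def Okay (s : ℕ → Step (n + t)) (a : Fin L → Bool) (k : ℕ) : Prop :=
  ∀ j < k, (s j).isPost → bit a j = false

instance (s : ℕ → Step (n + t)) (a : Fin L → Bool) (k : ℕ) : Decidable (Okay s a k) :=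
  inferInstanceAs (Decidable (∀ j < k, _))

/-- The number of postselected measurements. -/
def postCount (L : ℕ) (s : ℕ → Step (n + t)) : ℕ :=
  ((List.range L).filter fun j => (s j).isPost).length

theorem readout_succ (s : ℕ → Step (n + t)) (a : Fin L → Bool) (k : ℕ) :
    readout s a (k + 1) = readout s a k ++ if (s k).isMeasure then [bit a k] else [] := by
  rw [readout, List.range_succ, List.filter_append, List.map_append, ← readout]
  cases h : (s k).isMeasure <;> simp [h]

theorem okay_succ (s : ℕ → Step (n + t)) (a : Fin L → Bool) (k : ℕ) :
    Okay s a (k + 1) ↔ Okay s a k ∧ ((s k).isPost → bit a k = false) := by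
  simp only [Okay, Nat.lt_succ_iff_lt_or_eq, or_imp, forall_and, forall_eq]

theorem readout_update (s : ℕ → Step (n + t)) (a : Fin L → Bool) (k : Fin L) (b : Bool) :
    readout s (Function.update a k b) k = readout s a k := by
  refine List.map_congr_left fun j hj => bit_update_of_ne _ _ _ ?_
  have := List.mem_range.1 (List.mem_of_mem_filter hj)
  omega

theorem okay_update (s : ℕ → Step (n + t)) (a : Fin L → Bool) (k : Fin L) (b : Bool) :
    Okay s (Function.update a k b) k ↔ Okay s a k :=
  forall_congr' fun j => forall_congr' fun hj => by rw [bit_update_of_ne _ _ _ hj.ne]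

/-- The outcomes of the postselected stretch are all `+1` and are dropped; the remaining ones are
the readout of the ancillas. -/
theorem run_deferred_measurements (s : ℕ → Step (n + t)) (A : Op (n + L + t)) :
    (run (fun k _ => (deferStep L s k).action) (2 * L) L [] A).mapDomain
      (List.drop (postCount L s)) =
      ∑ a : Fin L → Bool, if Okay s a L then
        Finsupp.single (readout s a L) (blk A a a).trace.re else 0 := by
  let e : ℕ → Option (Fin L × Bool) := fun k =>
    if h : k - L < L then if (s (k - L)).isPost then some (⟨k - L, h⟩, true) else none
    else if h : k - L - L < L then
      if (s (k - L - L)).isMeasure then some (⟨k - L - L, h⟩, false) else none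
    else none
  rw [run_ancillas (e := e)]
  swap
  · intro i hi o
    simp only [deferStep, not_lt.2 hi, dif_neg, not_false_eq_true, e]
    split_ifs <;> rfl
  have e1 : ∀ i < L, e (L + i) = if h : i < L then
      if (s i).isPost then some (⟨i, h⟩, true) else none else none := fun i hi => by
    simp [e, hi]
  have e2 : ∀ i < L, e (L + (L + i)) = if h : i < L then
      if (s i).isMeasure then some (⟨i, h⟩, false) else none else none := fun i hi => by
    simp [e, hi]
  have hr : List.range' L (2 * L) =
      (List.range L).map (L + ·) ++ (List.range L).map fun i => L + (L + i) := by
    rw [two_mul, ← List.range'_append_1, List.range'_eq_map_range, List.range'_eq_map_range]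
    simp only [add_assoc]
  have hok : ∀ a : Fin L → Bool,
      (∀ i ∈ List.range' L (2 * L), ∀ j, e i = some (j, true) → a j = false) ↔ Okay s a L := by
    intro a
    rw [hr]
    simp only [List.mem_append, List.mem_map, List.mem_range]
    constructor
    · intro h j hj hp
      rw [bit, dif_pos hj]
      exact h _ (.inl ⟨j, hj, rfl⟩) _ (by rw [e1 j hj, dif_pos hj, if_pos hp])
    · rintro h _ (⟨i, hi, rfl⟩ | ⟨i, hi, rfl⟩) j hj
      · rw [e1 i hi, dif_pos hi] at hj
        split_ifs at hj with hp
        simp only [Option.some.injEq, Prod.mk.injEq, and_true] at hj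
        have := h i hi hp
        rwa [bit, dif_pos hi, hj] at this
      · rw [e2 i hi, dif_pos hi] at hj
        split_ifs at hj
        simp at hj
  rw [Finsupp.mapDomain_finsetSum]
  refine Finset.sum_congr rfl fun a _ => ?_
  simp only [hok]
  split_ifs with h
  swap
  · exact Finsupp.mapDomain_zero
  rw [Finsupp.mapDomain_single, hr, List.filterMap_append, List.filterMap_map, List.filterMap_map,
    List.nil_append]
  congr 1
  have p1 : ∀ l : List ℕ, (∀ i ∈ l, i < L) → l.filterMap ((fun i => (e i).map fun p => a p.1) ∘
      (L + ·)) = List.replicate (l.filter fun j => (s j).isPost).length false := by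
    intro l hl
    induction l with
    | nil => rfl
    | cons i l ih =>
      have hi := hl i (by simp)
      rw [List.filterMap_cons, ih fun i hi => hl i (by simp [hi])]
      simp only [Function.comp_apply, e1 i hi, dif_pos hi]
      cases hp : (s i).isPost
      · simp [hp]
      · have := h i hi hp
        rw [bit, dif_pos hi] at this
        simp [hp, this, List.replicate_succ]
  have p2 : ∀ l : List ℕ, (∀ i ∈ l, i < L) → l.filterMap ((fun i => (e i).map fun p => a p.1) ∘
      (fun i => L + (L + i))) = (l.filter fun j => (s j).isMeasure).map (bit a) := by
    intro l hl
    induction l with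
    | nil => rfl
    | cons i l ih =>
      have hi := hl i (by simp)
      rw [List.filterMap_cons, ih fun i hi => hl i (by simp [hi])]
      simp only [Function.comp_apply, e2 i hi, dif_pos hi]
      cases hp : (s i).isMeasure
      · simp [hp]
      · simp [hp, bit, hi]
  rw [p1 _ (by simp), p2 _ (by simp), List.drop_left' (by simp [postCount])]
  rfl

theorem Step.defer_gate {g : Step (n + t)} {U : Op (n + t)} (h : g.action = .gate U) (k : Fin L) :
    ∃ V : Op (n + L + t), (g.defer k).action = .gate V ∧
      ∀ a b, blk V a b = if a = b then U else 0 := by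
  cases g <;> simp only [Step.action, Action.gate.injEq, reduceCtorEq] at h <;> subst h
  · exact ⟨_, rfl, blk_one⟩
  · exact ⟨_, rfl, blk_onLine _ _⟩
  · exact ⟨_, rfl, blk_onLine _ _⟩
  · exact ⟨_, rfl, blk_cnot _ _⟩

/-- After `k` steps, the diagonal block of `a` is the unnormalised state of that branch of the
original circuit whose outcomes are the bits of `a`. `hA` says that the ancillas of later steps are
still in the state `|0⟩`. -/
theorem run_defer (s : ℕ → Step (n + t)) (f k : ℕ) (hk : k + f = L) (A : Op (n + L + t))
    (hA : ∀ a b, (∃ j : Fin L, k ≤ j ∧ (a j ∨ b j)) → blk A a b = 0) :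
    (run (fun k _ => (deferStep L s k).action) (f + 2 * L) k [] A).mapDomain
      (List.drop (postCount L s)) =
      ∑ a : Fin L → Bool, if Okay s a k then
        run (fun k _ => (s k).action) f k (readout s a k) (blk A a a) else 0 := by
  induction f generalizing k A with
  | zero =>
    obtain rfl : k = L := by omega
    rw [zero_add, run_deferred_measurements]
    rfl
  | succ f ih =>
    have hkL : k < L := by omega
    rw [show f + 1 + 2 * L = f + 2 * L + 1 by omega, run]
    simp only [deferStep, dif_pos hkL]
    rcases hs : (s k).action with U | ⟨M, post⟩ | _
    · obtain ⟨V, hV, hblk⟩ := (s k).defer_gate hs ⟨k, hkL⟩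
      rw [hV]
      have hm : (s k).isMeasure = false ∧ (s k).isPost = false := by
        cases h : s k <;> simp [h, Step.action] at hs <;> exact ⟨rfl, rfl⟩
      simp only
      refine (ih (k + 1) (by omega) (V * A * Vᴴ) fun a b hab => ?_).trans ?_
      · rw [blk_conj hblk, hA a b (hab.imp fun j hj => ⟨by omega, hj.2⟩), mul_zero, zero_mul]
      · refine Finset.sum_congr rfl fun a _ => ?_
        have : Okay s a (k + 1) ↔ Okay s a k := by rw [okay_succ]; simp [hm.2]
        simp only [this, readout_succ, hm.1, blk_conj hblk, run, hs, Bool.false_eq_true, if_false,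
          List.append_nil]
    · obtain ⟨i, hi⟩ : ∃ i, s k = .measure i post := by
        cases h : s k <;> simp [h, Step.action] at hs
        exact ⟨_, by rw [hs.2]⟩
      have hM : M = onLine i Letter.Z.mat := by
        simp only [hi, Step.action, Action.measure.injEq] at hs
        exact hs.1.symm
      rw [hi]
      let K : Fin L := ⟨k, hkL⟩
      have hA' : ∀ a b, (a K ∨ b K) → blk A a b = 0 := fun a b h => hA a b ⟨K, le_rfl, h⟩
      simp only [Step.defer, Step.action]
      refine (ih (k + 1) (by omega) _ fun a b hab => ?_).trans ?_
      · obtain ⟨j, hj, hab⟩ := hab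
        have hjK : j ≠ K := fun e => by rw [e] at hj; simp [K] at hj
        ext x y
        rw [blk_cnot_anc, hA _ _ ⟨j, by omega, by
          rw [Function.update_of_ne (show j ≠ ⟨k, hkL⟩ from hjK),
            Function.update_of_ne (show j ≠ ⟨k, hkL⟩ from hjK)]
          exact hab⟩]
      -- Before the step only blocks with bit `K` equal to `false` contribute; after it, the two
      -- values of this bit are the two outcomes.
      refine (sum_split_bit K _).trans (Eq.trans ?_ (sum_split_bit K _).symm)
      refine Finset.sum_congr rfl fun a _ => ?_
      cases ha : a K
      swap
      · rfl
      -- The controlled NOT copies the measured bit to the fresh ancilla, so fixing the ancilla to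
      -- `c` fixes this bit in rows and columns, exactly as the collapse does.
      have hb : ∀ c, blk (cnot (emb L i) (anc K) * A * (cnot (emb L i) (anc K))ᴴ)
          (Function.update a K c) (Function.update a K c) =
          collapse (onLine i Letter.Z.mat) c (blk A a a) := by
        intro c
        ext x y
        rw [blk_cnot_anc, collapse_Z_apply]
        simp only [Function.update_self, Function.update_idem]
        split_ifs with hc
        · rw [hc.1, hc.2, Bool.xor_self, ← ha, Function.update_eq_self]
        · rw [hA']
          · rfl
          · simp only [Function.update_self, bne_iff_ne, ne_eq]
            by_contra h
            push Not at h
            exact hc ⟨h.1.symm, h.2.symm⟩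
      have hself : a = Function.update a K false := by rw [← ha, Function.update_eq_self]
      have hz : blk A (Function.update a K true) (Function.update a K true) = 0 :=
        hA' _ _ (.inl (by simp))
      have hok := fun c => okay_update s a K c
      have hro := fun c => readout_update s a K c
      have hbit : ∀ c, bit (Function.update a K c) k = c := fun c => by
        rw [show k = (K : ℕ) from rfl, bit_val, Function.update_self]
      simp only [K] at hok hro
      have hbit0 : bit a k = false := by rw [show k = (K : ℕ) from rfl, bit_val, ha]
      have hb0 := hb false
      rw [← hself] at hb0
      simp only [Bool.false_eq_true, if_false, hz, run_zero, ite_self, add_zero, okay_succ,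
        readout_succ, hi, Step.isMeasure, Step.isPost, if_true, hbit, hbit0, hb0, hb, K, hok, hro]
      rw [run, hi]
      simp only [Step.action]
      by_cases hO : Okay s a k <;> cases post <;> simp [hO]
    · cases h : s k <;> simp [h, Step.action] at hs

end CliffordPBC
end

noncomputable section
namespace CliffordPBC

/-! ### The input with ancillas -/

variable {n t : ℕ}

/-- Generators of a stabiliser state together with `L` ancillas in the state `|0⟩`. -/
def addAncillas (L : ℕ) (S : List (Pauli n)) : List (Pauli (n + L)) :=
  S.map (Pauli.extend L) ++ List.ofFn fun k : Fin L => Pauli.single (Fin.natAdd n k) .Z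

theorem op_single_natAdd {L : ℕ} (k : Fin L) (a : Letter) :
    (Pauli.single (Fin.natAdd n k) a).op = tensorState 1 (Pauli.single k a).op := by
  rw [Pauli.op_of_headTrivial]
  · congr 2
    ext1
    · rfl
    · funext j
      by_cases h : j = k
      · subst h; simp [Pauli.tail, Pauli.single]
      · have : Fin.natAdd n j ≠ Fin.natAdd n k := fun e => h (by simpa [Fin.ext_iff] using e)
        simp [Pauli.tail, Pauli.single, Function.update_of_ne h, Function.update_of_ne this]
  · intro i
    have : Fin.castAdd L i ≠ Fin.natAdd n k := fun e => by
      have := congrArg Fin.val e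
      simp at this
      omega
    simp [Pauli.single, Function.update_of_ne this]

theorem sym_single_natAdd_extend {L : ℕ} (k : Fin L) (a : Letter) (P : Pauli n) :
    (Pauli.single (Fin.natAdd n k) a).sym (P.extend L) = 0 := by
  rw [Pauli.sym_comm, Pauli.sym_single]
  simp only [Pauli.extend, Fin.append_right]
  cases a <;> rfl

theorem sym_single_single_of_ne {N : ℕ} {i j : Fin N} (h : j ≠ i) (a b : Letter) :
    (Pauli.single i a).sym (Pauli.single j b) = 0 := by
  rw [Pauli.sym_single]
  simp only [Pauli.single, Function.update_of_ne h]
  cases b <;> rfl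

theorem sym_single_Z {N : ℕ} (i j : Fin N) :
    (Pauli.single i .Z).sym (Pauli.single j .Z) = 0 := by
  by_cases h : j = i
  · rw [h, Pauli.sym_self]
  · exact sym_single_single_of_ne h _ _

/-- The operator fixes the basis state `|0⟩`. -/
def FixesZero {L : ℕ} (B : Op L) : Prop := ∀ x, B x (fun _ => false) = if x = fun _ => false then 1 else 0

theorem FixesZero.one {L : ℕ} : FixesZero (1 : Op L) := fun x => by rw [Matrix.one_apply]

theorem FixesZero.mul {L : ℕ} {A B : Op L} (hA : FixesZero A) (hB : FixesZero B) :
    FixesZero (A * B) := fun x => by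
  simp only [Matrix.mul_apply, hB _, mul_ite, mul_one, mul_zero, Finset.sum_ite_eq',
    Finset.mem_univ, if_true]
  exact hA x

theorem FixesZero.single {L : ℕ} (k : Fin L) : FixesZero (Pauli.single k .Z).op := fun x => by
  rw [op_single_Z_apply]
  by_cases h : x = fun _ => false <;> simp [h]

/-- Compare the entries between basis states with all ancillas zero. This cancels a product of
ancilla generators, including any question about its sign. -/
theorem eq_of_tensorState {L : ℕ} {A A' : Op n} {B B' : Op L} (hB : FixesZero B)
    (hB' : FixesZero B') (h : tensorState A B = tensorState A' B') : A = A' := by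
  ext x y
  have := congrFun₂ h (Fin.append x fun _ => false) (Fin.append y fun _ => false)
  simpa [tensorState, hB _, hB' _] using this

theorem prod_map_op_extend (L : ℕ) (S : List (Pauli n)) :
    ((S.map (Pauli.extend L)).map Pauli.op).prod = tensorState (S.map Pauli.op).prod 1 := by
  induction S with
  | nil => exact tensorState_one.symm
  | cons P S ih =>
    simp only [List.map_cons, List.prod_cons, ih, Pauli.op_extend, tensorState_mul, mul_one]

theorem exists_prod_map_op {L : ℕ} {Q : List (Pauli (n + L))}
    (hQ : Q.Sublist (List.ofFn fun k : Fin L => Pauli.single (Fin.natAdd n k) .Z)) :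
    ∃ B, FixesZero B ∧ (Q.map Pauli.op).prod = tensorState (1 : Op n) B := by
  have : ∀ P ∈ Q, ∃ k, P = Pauli.single (Fin.natAdd n k) .Z := fun P hP => by
    obtain ⟨k, hk⟩ := (List.mem_ofFn' _ _).1 (hQ.subset hP)
    exact ⟨k, hk.symm⟩
  clear hQ
  induction Q with
  | nil => exact ⟨1, .one, tensorState_one.symm⟩
  | cons P Q ih =>
    obtain ⟨B, hB, h⟩ := ih fun P hP => this P (by simp [hP])
    obtain ⟨k, rfl⟩ := this P (by simp)
    exact ⟨_, (FixesZero.single k).mul hB, by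
      rw [List.map_cons, List.prod_cons, h, op_single_natAdd, tensorState_mul, mul_one]⟩

theorem InSpan.of_addAncillas {L : ℕ} {S : List (Pauli n)} {A : Op n}
    (h : InSpan (addAncillas L S) (tensorState A 1)) : InSpan S A := by
  obtain ⟨Q, hQ, h⟩ := h
  obtain ⟨Q₁, Q₂, rfl, h₁, h₂⟩ := List.sublist_append_iff.1 hQ
  obtain ⟨S', hS', rfl⟩ := List.sublist_map_iff.1 h₁
  obtain ⟨B, hB, hQ₂⟩ := exists_prod_map_op h₂
  rw [List.map_append, List.prod_append, prod_map_op_extend, hQ₂, tensorState_mul, mul_one,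
    one_mul] at h
  refine ⟨S', hS', h.imp (fun h => eq_of_tensorState .one hB h) fun h => ?_⟩
  refine eq_of_tensorState .one hB (h.trans ?_)
  rw [← neg_one_smul ℂ (tensorState _ _), ← tensorState_smul_left, neg_one_smul]

/-- Every product of the new generators is a product of old ones tensored with an operator that
fixes `|0⟩`. So a relation between the old generators, or the value `-1`, would already occur
without ancillas. -/
theorem IsStabiliserGenerators.addAncillas (L : ℕ) {S : List (Pauli n)}
    (h : IsStabiliserGenerators S) : IsStabiliserGenerators (addAncillas L S) := by
  obtain ⟨hc, hi, hn⟩ := h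
  refine ⟨?_, ?_, ?_⟩
  · refine List.pairwise_append.2 ⟨List.pairwise_map.2 (hc.imp fun {P Q} hPQ => ?_), ?_, ?_⟩
    · exact commute_of_sym ((sym_extend P Q).trans (sym_eq_zero_of_commute hPQ))
    · exact List.pairwise_ofFn.2 fun i j _ => commute_of_sym (sym_single_Z _ _)
    · intro P hP Q hQ
      obtain ⟨P, _, rfl⟩ := List.mem_map.1 hP
      obtain ⟨k, rfl⟩ := (List.mem_ofFn' _ _).1 hQ
      exact (commute_of_sym (sym_single_natAdd_extend k .Z P)).symm
  · intro i hdep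
    have hlen : (S.map (Pauli.extend L)).length = S.length := List.length_map ..
    rcases lt_or_ge i.1 S.length with hiS | hiS
    · refine hi ⟨i, hiS⟩ ?_
      have e1 : (CliffordPBC.addAncillas L S).eraseIdx i =
          CliffordPBC.addAncillas L (S.eraseIdx i) := by
        refine (List.eraseIdx_append_of_lt_length (by omega) _).trans ?_
        rw [List.eraseIdx_map]
        rfl
      have e2 : (CliffordPBC.addAncillas L S).get i = (S.get ⟨i, hiS⟩).extend L :=
        (List.getElem_append_left (by omega)).trans (List.getElem_map ..)
      rw [e1, e2] at hdep
      refine InSpan.of_addAncillas (L := L) ?_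
      rw [← Pauli.op_extend]
      exact hdep
    · have hiL : i.1 - S.length < L := by
        have := i.2
        simp only [CliffordPBC.addAncillas, List.length_append, hlen, List.length_ofFn] at this
        omega
      have e1 : (CliffordPBC.addAncillas L S).get i =
          Pauli.single (Fin.natAdd n ⟨i.1 - S.length, hiL⟩) .Z := by
        refine (List.getElem_append_right (by omega)).trans ?_
        simp only [List.getElem_ofFn, hlen]
      have e2 : (CliffordPBC.addAncillas L S).eraseIdx i = S.map (Pauli.extend L) ++
          (List.ofFn fun k : Fin L => Pauli.single (Fin.natAdd n k) .Z).eraseIdx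
            (i.1 - S.length) := by
        refine (List.eraseIdx_append_of_length_le (by omega) _).trans ?_
        rw [hlen]
      rw [e1, e2] at hdep
      -- `X` on this ancilla commutes with all the other generators but not with its `Z`.
      have hX := InSpan.commute (P := (Pauli.single (Fin.natAdd n ⟨i.1 - S.length, hiL⟩) .X).op)
        (fun R hR => ?_) hdep
      · have := sym_eq_zero_of_commute hX
        rw [Pauli.sym_single] at this
        simp only [Pauli.single, Function.update_self] at this
        exact absurd this (by decide)
      · rcases List.mem_append.1 hR with hR | hR
        · obtain ⟨P, _, rfl⟩ := List.mem_map.1 hR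
          exact commute_of_sym (sym_single_natAdd_extend _ _ _)
        · obtain ⟨j, hj, hne, rfl⟩ := List.mem_eraseIdx_iff_getElem.1 hR
          rw [List.getElem_ofFn]
          refine commute_of_sym (sym_single_single_of_ne (fun e => hne ?_) _ _)
          simpa [Fin.ext_iff] using e
  · intro hmem
    have key : ∀ M ∈ Submonoid.closure {A : Op (n + L) | ∃ P ∈ CliffordPBC.addAncillas L S,
        A = P.op}, ∃ A ∈ Submonoid.closure {A : Op n | ∃ P ∈ S, A = P.op}, ∃ B : Op L,
        FixesZero B ∧ M = tensorState A B := by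
      intro M hM
      induction hM using Submonoid.closure_induction with
      | mem M hM =>
        obtain ⟨P, hP, rfl⟩ := hM
        rcases List.mem_append.1 hP with hP | hP
        · obtain ⟨P, hP', rfl⟩ := List.mem_map.1 hP
          exact ⟨P.op, Submonoid.subset_closure ⟨P, hP', rfl⟩, 1, .one, Pauli.op_extend P⟩
        · obtain ⟨k, rfl⟩ := (List.mem_ofFn' _ _).1 hP
          exact ⟨1, one_mem _, _, .single k, op_single_natAdd k .Z⟩
      | one => exact ⟨1, one_mem _, 1, .one, tensorState_one.symm⟩
      | mul M M' _ _ h h' =>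
        obtain ⟨A, hA, B, hB, rfl⟩ := h
        obtain ⟨A', hA', B', hB', rfl⟩ := h'
        exact ⟨_, mul_mem hA hA', _, hB.mul hB', tensorState_mul _ _ _ _⟩
    obtain ⟨A, hA, B, hB, h⟩ := key _ hmem
    rw [← tensorState_one, ← neg_one_smul ℂ (tensorState _ _), ← tensorState_smul_left,
      neg_one_smul] at h
    exact hn (eq_of_tensorState .one hB h ▸ hA)

theorem prod_map_diagonal {ι κ : Type} [Fintype κ] [DecidableEq κ] (l : List ι) (d : ι → κ → ℂ) :
    (l.map fun i => Matrix.diagonal (d i)).prod =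
      Matrix.diagonal fun x => (l.map fun i => d i x).prod := by
  induction l with
  | nil => simp
  | cons i l ih => simp [ih, Matrix.diagonal_mul_diagonal]

theorem half_one_add_Z {N : ℕ} (k : Fin N) :
    (1 / 2 : ℂ) • (1 + (Pauli.single k .Z).op) =
      Matrix.diagonal fun x : Fin N → Bool => if x k then 0 else 1 := by
  ext x y
  rw [Matrix.smul_apply, Matrix.add_apply, op_single_Z_apply, Matrix.one_apply,
    Matrix.diagonal_apply]
  by_cases h : x = y
  · subst h
    cases x k <;> norm_num
  · simp [h]

/-- The projectors `(1 + Z)/2` of the ancillas multiply to `|0⟩⟨0|`, and the powers of `2` from the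
additional lines and generators cancel. -/
theorem stabiliserState_addAncillas (L : ℕ) (S : List (Pauli n)) :
    stabiliserState (addAncillas L S) = tensorState (stabiliserState S)
      (Matrix.of fun a b : Fin L → Bool =>
        if (a = fun _ => false) ∧ b = fun _ => false then (1 : ℂ) else 0) := by
  have h1 : ((S.map (Pauli.extend L)).map fun P => (1 / 2 : ℂ) • (1 + P.op)).prod =
      tensorState (S.map fun P => (1 / 2 : ℂ) • (1 + P.op)).prod 1 := by
    induction S with
    | nil => exact tensorState_one.symm
    | cons P S ih =>
      simp only [List.map_cons, List.prod_cons, ih, Pauli.op_extend]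
      rw [← tensorState_one, ← tensorState_add_left, ← tensorState_smul_left, tensorState_mul,
        mul_one]
  have h2 : ∀ l : List (Fin L), ((l.map fun k => Pauli.single (Fin.natAdd n k) .Z).map
      fun P => (1 / 2 : ℂ) • (1 + P.op)).prod =
      tensorState (1 : Op n) (l.map fun k => (1 / 2 : ℂ) • (1 + (Pauli.single k .Z).op)).prod := by
    intro l
    induction l with
    | nil => exact tensorState_one.symm
    | cons k l ih =>
      simp only [List.map_cons, List.prod_cons, ih, op_single_natAdd]
      rw [← mul_one (1 : Op n), ← tensorState_mul, mul_one, tensorState_smul_right]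
      congr 2
      ext x y
      simp [tensorState, mul_add, ← tensorState_one]
  rw [stabiliserState, addAncillas, List.map_append, List.prod_append, h1, List.ofFn_eq_map, h2,
    tensorState_mul, mul_one, one_mul, stabiliserState, tensorState_smul_left]
  simp only [half_one_add_Z]
  congr 1
  · rw [List.length_append, List.length_map, List.length_map, List.length_finRange, pow_add,
      pow_add]
    field_simp
  · rw [prod_map_diagonal]
    congr 1
    ext a b
    rw [Matrix.diagonal_apply, Matrix.of_apply, ← List.ofFn_eq_map, List.prod_ofFn]
    by_cases ha : a = fun _ => false
    · subst ha
      simp [eq_comm]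
    · obtain ⟨k, hk⟩ : ∃ k, a k = true := by
        by_contra hn
        push Not at hn
        exact ha (funext fun k => by simpa using hn k)
      rw [Finset.prod_eq_zero (Finset.mem_univ k) (by simp [hk])]
      simp [ha]

theorem blk_tensorState {L : ℕ} (σ : Op n) (B : Op L) (ρ : Op t) (a b : Fin L → Bool) :
    blk (tensorState (tensorState σ B) ρ) a b = B a b • tensorState σ ρ := by
  ext x y
  simp only [blk, tensorState, join, Matrix.of_apply, Fin.append_left, Fin.append_right,
    Matrix.smul_apply, smul_eq_mul]
  ring

/-! ### Non-adaptive circuits -/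

/-- Recorded outcomes `+1` up to step `k`. -/
def dummy {N : ℕ} (s : ℕ → List Bool → Step N) : ℕ → List Bool
  | 0 => []
  | k + 1 => dummy s k ++ if (s k (dummy s k)).isMeasure then [false] else []

/-- The steps of a non-adaptive circuit. -/
def fixedStep {N : ℕ} (s : ℕ → List Bool → Step N) (k : ℕ) : Step N := s k (dummy s k)

/-- All records that can occur at step `k` have the same length, and a non-adaptive circuit sees
nothing else; so `dummy` represents them all. -/
theorem run_fixedStep {N : ℕ} {s : ℕ → List Bool → Step N}
    (hs : ∀ k o o', o.length = o'.length → s k o = s k o') (f k : ℕ) (o : List Bool) (A : Op N)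
    (ho : o.length = (dummy s k).length) :
    run (fun k o => (s k o).action) f k o A = run (fun k _ => (fixedStep s k).action) f k o A := by
  induction f generalizing k o A with
  | zero => rfl
  | succ f ih =>
    have hd : (dummy s (k + 1)).length =
        (dummy s k).length + if (fixedStep s k).isMeasure then 1 else 0 := by
      rw [dummy, List.length_append, fixedStep]
      split_ifs <;> rfl
    have e : (s k o).action = (fixedStep s k).action := by rw [hs k o _ ho]; rfl
    rw [run, run]
    rcases ha : (fixedStep s k).action with U | ⟨M, post⟩ | _ <;> rw [ha] at e <;> simp only [e]
    · have hm : (fixedStep s k).isMeasure = false := by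
        cases h : fixedStep s k <;> simp [h, Step.action] at ha <;> rfl
      exact ih (k + 1) o _ (by simp [hd, ho, hm])
    · have hm : (fixedStep s k).isMeasure = true := by
        cases h : fixedStep s k <;> simp [h, Step.action] at ha
        rfl
      rw [ih (k + 1) (o ++ [false]) _ (by simp [hd, ho, hm]),
        ih (k + 1) (o ++ [true]) _ (by simp [hd, ho, hm])]

theorem run_deferStep {L : ℕ} (s : ℕ → Step (n + t)) (S : List (Pauli n)) (ρ : Op t) :
    (run (fun k _ => (deferStep L s k).action) (L + 2 * L) 0 []
      (tensorState (stabiliserState (addAncillas L S)) ρ)).mapDomain (List.drop (postCount L s)) =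
      run (fun k _ => (s k).action) L 0 [] (tensorState (stabiliserState S) ρ) := by
  rw [stabiliserState_addAncillas, run_defer s L 0 (by omega)]
  · rw [Finset.sum_eq_single fun _ => false]
    · rw [blk_tensorState]
      simp [Okay, readout]
    · intro a _ ha
      rw [blk_tensorState]
      simp [ha, run_zero]
    · simp
  · rintro a b ⟨j, -, hj⟩
    rw [blk_tensorState, Matrix.of_apply, if_neg, zero_smul]
    rintro ⟨rfl, rfl⟩
    simp at hj

end CliffordPBC
end

noncomputable section
namespace CliffordPBC

/-! ### The family with deferred measurements -/

theorem val_emb {n t : ℕ} (L : ℕ) (i : Fin (n + t)) :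
    (emb L i : ℕ) = if (i : ℕ) < n then (i : ℕ) else i + L := by
  refine Fin.addCases (fun i => ?_) (fun j => ?_) i
  · simp [emb]
  · simp [emb]; omega

namespace PolyTime

variable {α : Type} {inp : α → Val}

section step

variable {N : α → ℕ} {g : ∀ a, Step (N a)} (hg : PolyTime inp fun a => encStep (g a))
include hg

theorem isMeasure : PolyTime inp fun a => encBool (g a).isMeasure :=
  caseStep hg ((const (encBool false)).congr fun a => by rw [a.2]; rfl)
    ((const (encBool false)).congr fun x => by rw [x.2]; rfl)
    ((const (encBool false)).congr fun x => by rw [x.2]; rfl)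
    ((const (encBool false)).congr fun x => by obtain ⟨_, h⟩ := x.2; rw [h]; rfl)
    ((const (encBool true)).congr fun x => by rw [x.2]; rfl)

theorem isPost : PolyTime inp fun a => encBool (g a).isPost :=
  caseStep hg ((const (encBool false)).congr fun a => by rw [a.2]; rfl)
    ((const (encBool false)).congr fun x => by rw [x.2]; rfl)
    ((const (encBool false)).congr fun x => by rw [x.2]; rfl)
    ((const (encBool false)).congr fun x => by obtain ⟨_, h⟩ := x.2; rw [h]; rfl)
    (psnd.snd.congr fun x => by rw [x.2]; rfl)

end step

section fixed

variable {N : α → ℕ} {s : ∀ a, ℕ → List Bool → Step (N a)} {k : α → ℕ}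
  (hs : PolyTime (fun x : Σ _ : α, ℕ × List Bool =>
    .pair (inp x.1) (.pair (encNat x.2.1) (encBits x.2.2))) fun x => encStep (s x.1 x.2.1 x.2.2))
  (hk : PolyTime inp fun a => encNat (k a))
include hs hk

theorem dummy : PolyTime inp fun a => encBits (CliffordPBC.dummy (s a) (k a)) := by
  let step : ∀ a, ℕ × List Bool → ℕ × List Bool := fun a p =>
    (p.1 + 1, p.2 ++ if (s a p.1 p.2).isMeasure then [false] else [])
  have hit : ∀ a i, (step a)^[i] (0, []) = (i, CliffordPBC.dummy (s a) i) := by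
    intro a i
    induction i with
    | zero => rfl
    | succ i ih => rw [Function.iterate_succ_apply', ih]; rfl
  have hlen : ∀ a i, (CliffordPBC.dummy (s a) i).length ≤ i := by
    intro a i
    induction i with
    | zero => exact le_rfl
    | succ i ih =>
      rw [CliffordPBC.dummy, List.length_append]
      split_ifs <;> simp only [List.length_cons, List.length_nil] <;> omega
  obtain ⟨q, hq⟩ := hk.out_size
  have h1 := natIterate (σ := fun _ => ℕ × List Bool)
    (es := fun _ p => .pair (encNat p.1) (encBits p.2)) (init := fun _ => (0, [])) (step := step) hk
    ((const (encNat 0)).pair nil)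
    (psnd.fst.succ.pair (append (et := fun _ => encBool) psnd.snd
      ((hs.isMeasure.ite (const (encBits [false])) nil).congr fun x => by split_ifs <;> rfl)))
    ⟨3 * q + 3, fun a i hi => by
      rw [hit]
      have h2 := size_encBits_le (CliffordPBC.dummy (s a) i)
      have h3 := hlen a i
      have h4 := hq a
      rw [size_encNat] at h4
      simp only [Val.size, size_encNat, Polynomial.eval_add, Polynomial.eval_mul,
        Polynomial.eval_ofNat]
      omega⟩
  exact h1.snd.congr fun a => by rw [hit]

theorem fixedStep : PolyTime inp fun a => encStep (CliffordPBC.fixedStep (s a) (k a)) :=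
  (refl.pair (hk.pair (dummy hs hk))).comp (hs.reindex fun a => ⟨a, k a, CliffordPBC.dummy (s a) (k a)⟩)

end fixed

variable {n t L : α → ℕ} (hn : PolyTime inp fun a => encNat (n a))
  (hL : PolyTime inp fun a => encNat (L a))
include hn hL

theorem emb {i : ∀ a, Fin (n a + t a)} (hi : PolyTime inp fun a => encNat (i a)) :
    PolyTime inp fun a => encNat (CliffordPBC.emb (L a) (i a)) :=
  ((hi.lt hn).ite hi (hi.add hL)).congr fun a => by
    rw [val_emb]
    by_cases h : (i a : ℕ) < n a <;> simp [h]

theorem step_defer {g : ∀ a, Step (n a + t a)} {k : ∀ a, Fin (L a)}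
    (hg : PolyTime inp fun a => encStep (g a)) (hk : PolyTime inp fun a => encNat (k a)) :
    PolyTime inp fun a => encStep ((g a).defer (k a)) := by
  -- The code of `skip` is the same for every number of lines.
  refine caseStep hg ((const (encStep (.skip : Step 0))).congr fun a => by rw [a.2]; rfl) ?_ ?_ ?_ ?_
  · let φ : {x : Σ a, Fin (n a + t a) // g x.1 = .H x.2} → α := fun x => x.1.1
    exact ((const (encNat 1)).pair (emb (i := fun x : {x : Σ a, Fin (n a + t a) //
      g x.1 = .H x.2} => x.1.2) (hn.weaken φ) (hL.weaken φ) psnd)).congr fun x => by rw [x.2]; rfl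
  · let φ : {x : Σ a, Fin (n a + t a) // g x.1 = .S x.2} → α := fun x => x.1.1
    exact ((const (encNat 2)).pair (emb (i := fun x : {x : Σ a, Fin (n a + t a) //
      g x.1 = .S x.2} => x.1.2) (hn.weaken φ) (hL.weaken φ) psnd)).congr fun x => by rw [x.2]; rfl
  · let T := {x : Σ a, Fin (n a + t a) × Fin (n a + t a) // ∃ h, g x.1 = .CX x.2.1 x.2.2 h}
    let φ : T → α := fun x => x.1.1
    exact ((const (encNat 3)).pair ((emb (i := fun x : T => x.1.2.1) (hn.weaken φ) (hL.weaken φ)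
      psnd.fst).pair (emb (i := fun x : T => x.1.2.2) (hn.weaken φ) (hL.weaken φ)
      psnd.snd))).congr fun x => by
        obtain ⟨h, e⟩ := x.2
        rw [e]; rfl
  · let T := {x : Σ a, Fin (n a + t a) × Bool // g x.1 = .measure x.2.1 x.2.2}
    let φ : T → α := fun x => x.1.1
    exact ((const (encNat 3)).pair ((emb (i := fun x : T => x.1.2.1) (hn.weaken φ) (hL.weaken φ)
      psnd.fst).pair ((hn.weaken φ).add (hk.weaken φ)))).congr fun x => by rw [x.2]; rfl

theorem deferStep {s : ∀ a, ℕ → Step (n a + t a)} {k : α → ℕ}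
    (hs : PolyTime (fun x : Σ _ : α, ℕ => .pair (inp x.1) (encNat x.2))
      fun x => encStep (s x.1 x.2)) (hk : PolyTime inp fun a => encNat (k a)) :
    PolyTime inp fun a => encStep (CliffordPBC.deferStep (L a) (s a) (k a)) := by
  have hs' : ∀ {k' : α → ℕ}, PolyTime inp (fun a => encNat (k' a)) →
      PolyTime inp fun a => encStep (s a (k' a)) := fun {k'} h =>
    (refl.pair h).comp (hs.reindex fun a => ⟨a, k' a⟩)
  have h1 := hk.sub hL
  have h2 := h1.sub hL
  have hskip : PolyTime inp fun _ => encStep (.skip : Step 0) := const _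
  have hm : ∀ {k' : α → ℕ} (b : Bool), PolyTime inp (fun a => encNat (k' a)) →
      PolyTime inp fun a => .pair (encNat 4) (.pair (encNat (n a + k' a)) (encBool b)) :=
    fun b h => (const _).pair ((hn.add h).pair (const _))
  refine caseBool (hk.lt hL) ?_ ?_
  · refine PolyTime.congr (((h1.lt hL).ite ((hs' h1).isPost.ite (hm true h1) hskip)
      ((h2.lt hL).ite ((hs' h2).isMeasure.ite (hm false h2) hskip) hskip)).restrict) fun a => ?_
    rw [CliffordPBC.deferStep, dif_neg (of_decide_eq_false a.2)]
    simp only [decide_eq_true_eq]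
    split_ifs <;> rfl
  · exact (step_defer (n := fun a : {a // decide (k a < L a) = true} => n a)
      (t := fun a => t a) (L := fun a => L a) (g := fun a => s a (k a))
      (k := fun a => ⟨k a, of_decide_eq_true a.2⟩) hn.restrict hL.restrict (hs' hk).restrict
      hk.restrict).congr fun a => by
        rw [CliffordPBC.deferStep, dif_pos (of_decide_eq_true a.2)]

end PolyTime

namespace CliffordFamily

variable (C : CliffordFamily)

theorem polyTime_fixedStep : PolyTime
    (fun a : (Σ w : List Bool, Fin (C.coins w) → Bool) × ℕ =>
      .pair (encBits a.1.1) (.pair (encCoins a.1.2) (encNat a.2)))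
    (fun a => encStep (fixedStep (C.step a.1.1 a.1.2) a.2)) := by
  let T := (Σ w : List Bool, Fin (C.coins w) → Bool) × ℕ
  refine PolyTime.fixedStep (s := fun a : T => C.step a.1.1 a.1.2) (k := fun a : T => a.2) ?_
    PolyTime.psnd.snd
  exact (PolyTime.pfst.fst.pair (PolyTime.pfst.snd.fst.pair PolyTime.psnd)).comp
    (C.step_poly.reindex fun x : Σ _ : T, ℕ × List Bool => (x.1.1, x.2))

/-- A family of non-adaptive circuits with its measurements deferred to the end, the postselected
ones first. -/
def deferred : CliffordFamily where
  n w := C.n w + C.len w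
  t := C.t
  -- The original steps, one slot per step for postselected ancillas, and one slot per step for all
  -- measured ancillas.
  len w := C.len w + 2 * C.len w
  coins := C.coins
  gens w := addAncillas (C.len w) (C.gens w)
  step w r k _ := deferStep (C.len w) (fixedStep (C.step w r)) k
  gens_stabiliser w := (C.gens_stabiliser w).addAncillas _
  n_poly := C.n_poly.add C.len_poly
  t_poly := C.t_poly
  len_poly := (C.len_poly.add (C.len_poly.add C.len_poly)).congr fun w => by rw [two_mul]
  coins_poly := C.coins_poly
  gens_poly := by
    refine PolyTime.append (et := fun _ => encPauli) (PolyTime.map (et := fun _ => encPauli)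
      (et' := fun _ => encPauli) C.gens_poly ?_) (PolyTime.ofFn (et := fun _ => encPauli)
        C.len_poly ?_)
    · exact PolyTime.pauli_extend (n := fun x : Σ w, Pauli (C.n w) => C.n x.1)
        (C.len_poly.weaken Sigma.fst) PolyTime.psnd
    · let T := Σ w, Fin (C.len w)
      have hn := C.n_poly.weaken (v := fun x : T => encNat x.2) Sigma.fst
      exact PolyTime.pauli_single (N := fun x : T => C.n x.1 + C.len x.1)
        (i := fun x => Fin.natAdd _ x.2) (hn.add (C.len_poly.weaken Sigma.fst))
        (hn.add PolyTime.psnd) _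
  step_poly := by
    let T := (Σ w : List Bool, Fin (C.coins w) → Bool) × ℕ × List Bool
    have hw := fun {v : List Bool → Val} (h : PolyTime encBits v) =>
      h.weaken (fun a : T => a.1.1)
        (v := fun a : T => .pair (encCoins a.1.2) (.pair (encNat a.2.1) (encBits a.2.2)))
    refine PolyTime.deferStep (n := fun a : T => C.n a.1.1) (t := fun a => C.t a.1.1)
      (L := fun a => C.len a.1.1) (s := fun a => fixedStep (C.step a.1.1 a.1.2))
      (k := fun a => a.2.1) (hw C.n_poly) (hw C.len_poly) ?_ PolyTime.psnd.snd.fst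
    exact (PolyTime.pfst.fst.pair (PolyTime.pfst.snd.fst.pair PolyTime.psnd)).comp
      (C.polyTime_fixedStep.reindex fun x : Σ _ : T, ℕ => (x.1.1, x.2))

theorem deferred_nonAdaptive : C.deferred.NonAdaptive := fun _ _ _ _ _ _ => rfl

theorem deferred_postselectsFirst : C.deferred.PostselectsFirst := by
  -- The stretch of postselected measurements ends after twice the original length.
  refine ⟨fun w => 2 * C.len w, fun w r => ⟨fun k hk o i h => ?_, fun k hk o i h => ?_⟩⟩
  all_goals
    change deferStep (C.len w) (fixedStep (C.step w r)) k = _ at h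
    dsimp only at hk
    rw [deferStep] at h
    split_ifs at h <;> first
      | omega
      | (cases h)
      | (cases hg : fixedStep (C.step w r) k <;> rw [hg] at h <;> cases h)

/-- The outcomes of the original circuit from those of the circuit with deferred measurements. -/
def undefer (w : List Bool) (r : Fin (C.coins w) → Bool) : List Bool → List Bool :=
  List.drop (postCount (C.len w) (fixedStep (C.step w r)))

theorem polyTime_undefer : PolyTime
    (fun a : (Σ w : List Bool, Fin (C.coins w) → Bool) × List Bool =>
      .pair (encBits a.1.1) (.pair (encCoins a.1.2) (encBits a.2)))
    (fun a => encBits (C.undefer a.1.1 a.1.2 a.2)) := by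
  let T := (Σ w : List Bool, Fin (C.coins w) → Bool) × List Bool
  refine PolyTime.drop (et := fun _ : T => encBool) (l := fun a : T => a.2)
    (m := fun a : T => postCount (C.len a.1.1) (fixedStep (C.step a.1.1 a.1.2)))
    PolyTime.psnd.snd (PolyTime.length (et := fun _ => encNat) (PolyTime.filter
      (et := fun _ => encNat) (p := fun a j => (fixedStep (C.step a.1.1 a.1.2) j).isPost)
      (PolyTime.range (C.len_poly.weaken fun a : T => a.1.1)) (PolyTime.isPost ?_)))
  exact (PolyTime.pfst.fst.pair (PolyTime.pfst.snd.fst.pair PolyTime.psnd)).comp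
    (C.polyTime_fixedStep.reindex fun x : Σ _ : T, ℕ => (x.1.1, x.2))

variable {C}

theorem NonAdaptive.dist_eq (hC : C.NonAdaptive) (w : List Bool) (r : Fin (C.coins w) → Bool)
    (ρ : Op (C.t w)) : C.dist w r ρ = (C.deferred.dist w r ρ).mapDomain (C.undefer w r) :=
  (run_fixedStep (fun k o o' h => hC w r k o o' h) _ 0 [] _ rfl).trans
    (run_deferStep (fixedStep (C.step w r)) (C.gens w) ρ).symm

theorem NonAdaptive.mass_eq (hC : C.NonAdaptive) (w : List Bool) (r : Fin (C.coins w) → Bool)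
    (ρ : Op (C.t w)) : mass (C.dist w r ρ) = mass (C.deferred.dist w r ρ) := by
  rw [hC.dist_eq, mass_mapDomain]

/-- Dropping the repeated outcomes does not change the mass, so conditioning commutes with it, and
the statement for `deferred` carries over. -/
theorem NonAdaptive.weaklySimulatedBy (hC : C.NonAdaptive) :
    WeaklySimulatedBy C C.deferred.pbc C.condDist C.deferred.pbc.condDist
      (fun w ρ => ∀ r, mass (C.dist w r ρ) ≠ 0) := by
  obtain ⟨post, hpost, h⟩ :=
    C.deferred_postselectsFirst.exists_post_condDist C.undefer C.polyTime_undefer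
  refine ⟨post, hpost, fun w ρ hρ hm => (congrArg _ (funext fun r => ?_)).trans
    (h w ρ hρ fun r => hC.mass_eq w r ρ ▸ hm r)⟩
  change (mass (C.dist w r ρ))⁻¹ • C.dist w r ρ =
    Finsupp.mapDomain _ ((mass (C.deferred.dist w r ρ))⁻¹ • C.deferred.dist w r ρ)
  rw [hC.mass_eq, Finsupp.mapDomain_smul, hC.dist_eq]

end CliffordFamily

end CliffordPBC
end

/-- `C.pbc` serves all parts but the last. There the sign of a postselected query might depend on
earlier outcomes, and conditioning might differ from stepwise renormalisation; `C.deferred`, which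
postselects first, removes both obstacles. -/
theorem mainTheorem6 (C : CliffordFamily) :
    (C.NoPostselection →
      ∃ B : PBCFamily C.t, B.NoPostselection ∧
        WeaklySimulatedBy C B C.dist B.dist (fun _ _ => True)) ∧
    (C.NoPostselection → C.NonAdaptive →
      ∃ B : PBCFamily C.t, B.NoPostselection ∧ B.NonAdaptive ∧
        WeaklySimulatedBy C B C.dist B.dist (fun _ _ => True)) ∧
    (∃ B : PBCFamily C.t,
        WeaklySimulatedBy C B C.stepwiseDist B.stepwiseDist
          (fun w ρ => ∀ r, mass (C.stepwiseDist w r ρ) = 1)) ∧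
    (C.NonAdaptive →
      ∃ B : PBCFamily C.t, B.NonAdaptive ∧
        WeaklySimulatedBy C B C.condDist B.condDist
          (fun w ρ => ∀ r, mass (C.dist w r ρ) ≠ 0)) :=
  ⟨fun h => ⟨C.pbc, h.pbc, h.weaklySimulatedBy⟩,
    fun h hC => ⟨C.pbc, h.pbc, h.postselectsFirst.pbc_nonAdaptive hC, h.weaklySimulatedBy⟩,
    ⟨C.pbc, C.weaklySimulatedBy_stepwise⟩,
    fun hC => ⟨C.deferred.pbc,
      C.deferred_postselectsFirst.pbc_nonAdaptive C.deferred_nonAdaptive, hC.weaklySimulatedBy⟩⟩
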